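/- For $N\ge 1$ let $\mathbb{GT}_N$ be the set of signatures $\lambda=(\lambda_1\ge\dots\ge\lambda_N)$, $\lambda_i\in\mathbb Z$, with Schur functions $$s_\lambda(x_1,\dots,x_N)=\frac{\det[x_i^{\lambda_j+N-j}]}{\prod_{i<j}(x_i-x_j)}$$ (Laurent polynomials, hence also defined by continuity where coordinates coincide). Write $1^m=(1,\dots,1)\in\mathbb C^m$. Let $\rho_N$ be a probability measure on $\mathbb{GT}_N$ for each $N$, and assume that the Schur generating function $$S_{\rho_N}(x_1,\dots,x_N)=\sum_{\lambda\in\mathbb{GT}_N}\rho_N(\lambda)\,\frac{s_\lambda(x_1,\dots,x_N)}{s_\lambda(1^N)}$$ converges in a complex neighborhood of $1^N$. Let $m[\rho_N]=\frac1N\sum_{i=1}^N\delta\big(\frac{\lambda_i+N-i}{N}\big)$ be the empirical measure of a $\rho_N$-distributed $\lambda$. Let $\mathsf F$ be a function analytic in a complex neighborhood of $1$. **(1)** Let $F_k(z_1,\dots,z_k)$, $k\ge1$, be symmetric functions analytic near $1^k$ such that, for every fixed $k\ge 1$, $$\lim_{N\to\infty}\sqrt[N]{S_{\rho_N}(u_1,\dots,u_k,1^{N-k})}=F_k(u_1,\dots,u_k)$$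 uniformly in a complex neighborhood of $1^k$, where the root is the analytic branch equal to $1$ at $1^k$, assumed to exist on this neighborhood for all large $N$. Assume moreover that for every $k\ge1$, near $1^k$, $$F_k(u_1,\dots,u_k)=\exp\big(\mathsf F(u_1)+\dots+\mathsf F(u_k)\big).$$ Then, as $N\to\infty$, the random measures $m[\rho_N]$ converge in probability, in the sense of moments (every moment of $m[\rho_N]$ converges in probability to the corresponding moment of the limit), to a deterministic probability measure $\boldsymbol\mu$ on $\mathbb R$ with all moments finite. Its moments $\boldsymbol\mu_k=\int x^k\,\boldsymbol\mu(dx)$ are given by $$\boldsymbol\mu_k=\sum_{l=0}^k\binom kl\frac1{(l+1)!}\,\partial_u^l\Big[(1+u)^k\big(\partial_1F_{l+1}(1+u,1+uw_{l+1},\dots,1+uw_{l+1}^l)\big)^{k-l}\Big]\Big|_{u=0},\qquad w_m=e^{2\pi\sqrt{-1}/m},$$ and this expression is equal to $$\boldsymbol\mu_k=\sum_{l=0}^k\binom kl\frac1{(l+1)!}\,\partial_u^l\Big[(1+u)^k\,\mathsf F'(1+u)^{k-l}\Big]\Big|_{u=0}.\qquad(*)$$ **(2)** (The Bufetov–Gorin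 law of large numbers.) If, for every fixed $k\ge1$, $$\lim_{N\to\infty}\frac1N\log S_{\rho_N}(u_1,\dots,u_k,1^{N-k})=\mathsf F(u_1)+\dots+\mathsf F(u_k)$$ uniformly in a complex neighborhood of $1^k$, where the logarithm is the analytic branch vanishing at $1^k$, assumed to exist on this neighborhood for all large $N$, then $m[\rho_N]$ converges in the same sense to a deterministic probability measure $\boldsymbol\mu$ on $\mathbb R$ with all moments finite, whose moments are given by $(*)$ and, for all sufficiently small $\varepsilon>0$, by $$\boldsymbol\mu_k=\frac1{2\pi\sqrt{-1}\,(k+1)}\oint_{|z|=\varepsilon}\Big(\frac1z+1+(1+z)\mathsf F'(1+z)\Big)^{k+1}\frac{dz}{1+z}.$$ -/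

import Mathlib

open Filter Topology MeasureTheory

noncomputable section

/-- Signatures of length `N`: non-increasing `N`-tuples of integers
(indexed from `0`, so `lam i` is `λ_{i+1}`). -/
def Signature (N : ℕ) : Type := {lam : Fin N → ℤ // Antitone lam}

instance (N : ℕ) : MeasurableSpace (Signature N) := ⊤

/-- The shifted coordinate `λ_i + N - i` (with `i` counted from `1`). -/
def Signature.coord {N : ℕ} (lam : Signature N) (i : Fin N) : ℤ :=
  lam.1 i + (N : ℤ) - ((i : ℕ) + 1 : ℤ)

/-- The ratio `det [x_i ^ (λ_j + N - j)] / ∏_{i < j} (x_i - x_j)`. -/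
def schurRatio {N : ℕ} (lam : Signature N) (x : Fin N → ℂ) : ℂ :=
  Matrix.det (Matrix.of fun i j : Fin N => x i ^ lam.coord j) /
    ∏ i : Fin N, ∏ j ∈ Finset.Ioi i, (x i - x j)

/-- The Schur function `s_λ(x_1, …, x_N)`. The ratio of determinants is a Laurent polynomial; its
value at a point with coinciding coordinates is the limit of the ratio along points with pairwise
distinct coordinates. -/
def schur {N : ℕ} (lam : Signature N) : (Fin N → ℂ) → ℂ :=
  extendFrom {x : Fin N → ℂ | Function.Injective x} (schurRatio lam)

/-- The term `ρ(λ) s_λ(x) / s_λ(1^N)` of the Schur generating function. -/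
def schurGFTerm {N : ℕ} (ρ : PMF (Signature N)) (x : Fin N → ℂ) (lam : Signature N) : ℂ :=
  ((ρ lam).toReal : ℂ) * (schur lam x / schur lam 1)

/-- The Schur generating function `S_ρ(x_1, …, x_N)`. -/
def schurGF {N : ℕ} (ρ : PMF (Signature N)) (x : Fin N → ℂ) : ℂ :=
  ∑' lam : Signature N, schurGFTerm ρ x lam

/-- The Schur generating function is well defined: its series converges (absolutely) at every
point of a complex neighborhood of `1^N`. -/
def HasSchurGF {N : ℕ} (ρ : PMF (Signature N)) : Prop :=
  ∀ᶠ x in 𝓝 (1 : Fin N → ℂ), Summable (schurGFTerm ρ x)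

/-- The point `(u_1, …, u_k, 1^{N-k})` (used for `k ≤ N`). -/
def padOnes {k : ℕ} (N : ℕ) (u : Fin k → ℂ) : Fin N → ℂ :=
  fun i => if h : (i : ℕ) < k then u ⟨i, h⟩ else 1

/-- `g` is the branch on the polydisc of radius `r` around `1^k` of the `N`-th root of
`S_ρ(u_1, …, u_k, 1^{N-k})`: it is analytic there, equals `1` at `1^k`, and its `N`-th power is the
Schur generating function near `1^k` (hence everywhere on the polydisc, by analytic
continuation). -/
def IsRootBranch {N : ℕ} (ρ : PMF (Signature N)) (k : ℕ) (r : ℝ) (g : (Fin k → ℂ) → ℂ) : Prop :=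
  AnalyticOnNhd ℂ g (Metric.ball 1 r) ∧ g 1 = 1 ∧
    ∀ᶠ u in 𝓝 (1 : Fin k → ℂ), g u ^ N = schurGF ρ (padOnes N u)

/-- `g` is the branch on the polydisc of radius `r` around `1^k` of
`log S_ρ(u_1, …, u_k, 1^{N-k})` which vanishes at `1^k`. -/
def IsLogBranch {N : ℕ} (ρ : PMF (Signature N)) (k : ℕ) (r : ℝ) (g : (Fin k → ℂ) → ℂ) : Prop :=
  AnalyticOnNhd ℂ g (Metric.ball 1 r) ∧ g 1 = 0 ∧
    ∀ᶠ u in 𝓝 (1 : Fin k → ℂ), Complex.exp (g u) = schurGF ρ (padOnes N u)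

/-- The `N`-th roots of `S_{ρ_N}(u_1, …, u_k, 1^{N-k})` converge to `f`, as `N → ∞`, uniformly in a
complex neighborhood of `1^k`. -/
def RootTendsto (ρ : ∀ N : ℕ, PMF (Signature N)) (k : ℕ) (f : (Fin k → ℂ) → ℂ) : Prop :=
  ∃ r : ℝ, 0 < r ∧ ∃ g : ℕ → (Fin k → ℂ) → ℂ,
    (∀ᶠ N in atTop, IsRootBranch (ρ N) k r (g N)) ∧
    TendstoUniformlyOn g f atTop (Metric.ball 1 r)

/-- The functions `N⁻¹ log S_{ρ_N}(u_1, …, u_k, 1^{N-k})` converge to `f`, as `N → ∞`, uniformly in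
a complex neighborhood of `1^k`. -/
def LogTendsto (ρ : ∀ N : ℕ, PMF (Signature N)) (k : ℕ) (f : (Fin k → ℂ) → ℂ) : Prop :=
  ∃ r : ℝ, 0 < r ∧ ∃ g : ℕ → (Fin k → ℂ) → ℂ,
    (∀ᶠ N in atTop, IsLogBranch (ρ N) k r (g N)) ∧
    TendstoUniformlyOn (fun (N : ℕ) u => (1 / (N : ℂ)) * g N u) f atTop (Metric.ball 1 r)

/-- The assumptions of the general law of large numbers: for every `k ≥ 1`, the function `F_k` is
symmetric and analytic near `1^k`, and it is the limit of the `N`-th roots of the Schur generating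
functions. -/
structure LLNAssumption (ρ : ∀ N : ℕ, PMF (Signature N)) (F : ∀ k : ℕ, (Fin k → ℂ) → ℂ) : Prop where
  hasSchurGF : ∀ N : ℕ, 1 ≤ N → HasSchurGF (ρ N)
  symmetric : ∀ k : ℕ, 1 ≤ k → ∀ σ : Equiv.Perm (Fin k),
    ∀ᶠ u in 𝓝 (1 : Fin k → ℂ), F k (u ∘ σ) = F k u
  analytic : ∀ k : ℕ, 1 ≤ k → AnalyticAt ℂ (F k) 1
  tendsto : ∀ k : ℕ, 1 ≤ k → RootTendsto ρ k (F k)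

/-- The empirical measure `N⁻¹ ∑_i δ((λ_i + N - i) / N)`. -/
def empiricalMeasure {N : ℕ} (lam : Signature N) : Measure ℝ :=
  (N : ENNReal)⁻¹ • ∑ i : Fin N, Measure.dirac ((lam.coord i : ℝ) / (N : ℝ))

/-- The random measures `m[ρ_N]` converge, as `N → ∞`, in probability, in the sense of moments, to
the deterministic measure `μ`: all moments of `μ` are finite, and every moment of the empirical
measure of a `ρ_N`-distributed signature converges in probability to that of `μ`. -/
def ConvergesInMoments (ρ : ∀ N : ℕ, PMF (Signature N)) (μ : Measure ℝ) : Prop :=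
  ∀ k : ℕ, Integrable (fun x : ℝ => x ^ k) μ ∧
    ∀ ε : ℝ, 0 < ε → Tendsto
      (fun N => (ρ N).toMeasure
        {lam | ε ≤ |(∫ x, x ^ k ∂(empiricalMeasure lam)) - ∫ x, x ^ k ∂μ|})
      atTop (𝓝 0)

/-- The partial derivative `∂_1 f` with respect to the first variable. -/
def partialFirst {l : ℕ} (f : (Fin (l + 1) → ℂ) → ℂ) (v : Fin (l + 1) → ℂ) : ℂ :=
  deriv (fun t : ℂ => f (Function.update v 0 t)) (v 0)

/-- The root of unity `w_m = exp(2πi/m)`. -/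
def rootW (m : ℕ) : ℂ := Complex.exp (2 * (Real.pi : ℂ) * Complex.I / (m : ℂ))

/-- The moment of order `k` in the general law of large numbers:
`∑_{l ≤ k} C(k,l) / (l+1)! ∂_u^l [(1+u)^k (∂_1 F_{l+1}(1+u, 1+u w, …, 1+u w^l))^{k-l}]` at `u = 0`,
where `w = w_{l+1}`. -/
def generalMoment (F : ∀ k : ℕ, (Fin k → ℂ) → ℂ) (k : ℕ) : ℂ :=
  ∑ l ∈ Finset.range (k + 1), (k.choose l : ℂ) * (1 / ((l + 1).factorial : ℂ)) *
    iteratedDeriv l (fun u : ℂ => (1 + u) ^ k *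
      partialFirst (F (l + 1)) (fun j => 1 + u * rootW (l + 1) ^ (j : ℕ)) ^ (k - l)) 0

/-- `∑_{l ≤ k} C(k,l) / (l+1)! ∂_u^l [(1+u)^k f'(1+u)^{k-l}]` at `u = 0`. -/
def productMoment (f : ℂ → ℂ) (k : ℕ) : ℂ :=
  ∑ l ∈ Finset.range (k + 1), (k.choose l : ℂ) * (1 / ((l + 1).factorial : ℂ)) *
    iteratedDeriv l (fun u : ℂ => (1 + u) ^ k * deriv f (1 + u) ^ (k - l)) 0

/-- The contour integral
`1 / (2πi(k+1)) ∮_{|z| = ε} (1/z + 1 + (1+z) f'(1+z))^{k+1} dz / (1+z)`. -/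
def contourMoment (f : ℂ → ℂ) (k : ℕ) (ε : ℝ) : ℂ :=
  1 / (2 * (Real.pi : ℂ) * Complex.I * ((k : ℂ) + 1)) *
    circleIntegral (fun z : ℂ => (1 / (1 + z)) * (1 / z + 1 + (1 + z) * deriv f (1 + z)) ^ (k + 1))
      0 ε

end

/-!
# The law of large numbers for signatures through Schur generating functions

Write `x_i = 1 + X_i` and work with formal power series in the `X_i`. By the branching rule a
Schur function is a Laurent polynomial with nonnegative coefficients (`exists_schur_exponents`),
so that convergence of the Schur generating function at the real points `(1 ± δ, …, 1 ± δ)`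
dominates all its terms near `1^N` (`HasSchurGF.exists_bound`). Hence the generating function is
analytic there, and its Taylor series `P` is the coefficientwise sum of the Taylor series of the
normalised Schur functions (`HasSchurGF.taylor_schurGF`).

Let `l_i = λ_i + N - i` and let `Δ` be the Vandermonde product. The operator
`Δ⁻¹ ∑_i x_i^k ∂_i^k Δ` has the Schur functions as eigenfunctions, with eigenvalue the factorial
power sum `∑_i l_i (l_i - 1) ⋯ (l_i - k + 1)`. Applying it to `P` and evaluating at `1^N` gives
the expectation of this sum under `ρ_N`; applying it twice gives the expectation of its square.
The Leibniz rule writes the operator as a sum, over sets `I` of `r + 1 ≤ k + 1` variables, of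
divided differences of `x_i^k ∂_i^{k-r} P` (`vand_mul_schurOp`). Conjugation by `P` replaces `∂_i`
by `∂_i + N γ_i`, where `γ_i = N⁻¹ ∂_i log P`, and after division by `N^{k+1}` each sum over `I`
becomes an average (`schurOp_mul_eq`).

Two facts give the limit of this average. First, either hypothesis says that `γ_i`, restricted to
any fixed number of variables, converges coefficientwise to `f'(1 + X_i)`
(`logDerivTendsto_of_root`, `logDerivTendsto_of_log`). By symmetry, and since a monomial of degree
`n` contains at most `n` variables, this convergence is uniform over all coefficients of degree at
most `n` of all the `γ_i` (`LogDerivTendsto.famTendsto`). Second, taking divided differences is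
bounded for these coefficients uniformly in `N` (`divDiff_bound`), and for a function `φ(X_i)` of
one variable the average over `I` converges to the constant `[X^r] φ / (r + 1)!`, because a given
variable lies only in a fraction `O(1/N)` of the sets `I` (`constTendsto_avg_divDiff_inVar`). So
the rescaled operator acts in the limit as multiplication by a number (`constTendsto_scaledOp`),
the second moment of the normalised factorial power sum converges to the square of the limit of
the first, and the power sum converges in mean square (`meanSquareTendsto_factorialMoment`).
Passing from falling factorials to powers costs terms of order `1/N` (`meanSquareTendsto_moment`).

The limits of the moments are limits of moments of deterministic measures, and such a sequence is
the moment sequence of a probability measure by tightness and truncation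
(`exists_probabilityMeasure_moments`). The limit is found as a sum of Taylor coefficients. The
contour integral is the corresponding sum of residues (`eventually_contourMoment_eq`). In the
formula with roots of unity, the function `u ↦ F_{l+1}(1 + u, 1 + u w, …, 1 + u w^l)` is invariant
under `u ↦ w u`, hence equal to `1 + O(u^{l+1})`, and drops out of the `l`-th derivative
(`generalMoment_eq_productMoment`).
-/

noncomputable section

/-! ### The combinatorial formula for Schur functions -/

theorem sum_Ico_zpow_mul_one_sub {R : Type} [CommRing R] (z : Rˣ) {a b : ℤ} (hab : a ≤ b) :
    (1 - (z : R)) * ∑ m ∈ Finset.Ico a b, ((z ^ m : Rˣ) : R) =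
      ((z ^ a : Rˣ) : R) - ((z ^ b : Rˣ) : R) := by
  induction b, hab using Int.leInduction with
  | base => simp
  | succ b hab ih =>
    rw [← Finset.insert_Ico_right_eq_Ico_add_one hab, Finset.sum_insert (by simp), mul_add, ih,
      zpow_add_one, Units.val_mul]
    ring

/-- The branching rule at the level of alternants: subtracting adjacent columns reduces the
alternant with one variable specialised to `1` to alternants of interlacing exponents. -/
theorem det_zpow_cons_one {R : Type} [CommRing R] {N : ℕ} (z : Fin N → Rˣ) (l : Fin (N + 1) → ℤ)
    (hl : StrictAnti l) :
    Matrix.det (Matrix.of fun i j : Fin (N + 1) =>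
        (((Fin.cons 1 z : Fin (N + 1) → Rˣ) i ^ l j : Rˣ) : R)) =
      (∏ i, (1 - (z i : R))) *
        ∑ m ∈ Fintype.piFinset (fun j : Fin N => Finset.Ico (l j.succ) (l j.castSucc)),
          Matrix.det (Matrix.of fun i j : Fin N => ((z i ^ m j : Rˣ) : R)) := by
  set A : Matrix (Fin (N + 1)) (Fin (N + 1)) R := Matrix.of fun i j : Fin (N + 1) =>
        (((Fin.cons 1 z : Fin (N + 1) → Rˣ) i ^ l j : Rˣ) : R) with hA
  let B : Matrix (Fin (N + 1)) (Fin (N + 1)) R :=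
    Matrix.of fun i j => Fin.cases (A i 0) (fun j' => A i j'.succ - A i j'.castSucc) j
  have h1 : A.det = B.det := by
    refine Matrix.det_eq_of_forall_col_eq_smul_add_pred (fun _ => 1) ?_ ?_
    · intro i; simp [B]
    · intro i j; simp [B]
  -- The row of the variable `1` is `(1, 0, …, 0)` after the subtraction.
  have h2 : B.det = (B.submatrix Fin.succ Fin.succ).det := by
    rw [Matrix.det_succ_row_zero, Finset.sum_eq_single 0]
    · simp only [Fin.val_zero, pow_zero, Fin.succAbove_zero, one_mul]
      have : B 0 0 = 1 := by simp [B, hA]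
      rw [this, one_mul]
    · intro j _ hj
      obtain ⟨j', rfl⟩ := Fin.exists_succ_eq.mpr hj
      have : B 0 j'.succ = 0 := by simp [B, hA]
      rw [this]; ring
    · simp
  have h3 : B.submatrix Fin.succ Fin.succ = Matrix.of fun i j : Fin N =>
      (1 - (z i : R)) * (Matrix.of fun i j : Fin N =>
        ∑ m ∈ Finset.Ico (l j.succ) (l j.castSucc), ((z i ^ m : Rˣ) : R)) i j := by
    ext i j
    simp only [Matrix.of_apply]
    rw [sum_Ico_zpow_mul_one_sub _ (hl (Fin.castSucc_lt_succ (i := j))).le]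
    simp [B, hA]
  rw [h1, h2, h3, Matrix.det_mul_column]
  congr 1
  rw [← Matrix.det_transpose]
  have h4 := (Matrix.detRowAlternating (n := Fin N) (R := R)).toMultilinearMap.map_sum_finset
    (fun (j : Fin N) (m : ℤ) => fun i : Fin N => ((z i ^ m : Rˣ) : R))
    (fun j : Fin N => Finset.Ico (l j.succ) (l j.castSucc))
  have h5 : (Matrix.of fun i j : Fin N =>
        ∑ m ∈ Finset.Ico (l j.succ) (l j.castSucc), ((z i ^ m : Rˣ) : R)).transpose =
      fun j => ∑ m ∈ Finset.Ico (l j.succ) (l j.castSucc),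
        fun i : Fin N => ((z i ^ m : Rˣ) : R) := by
    ext j i
    simp [Finset.sum_apply]
  rw [h5]
  refine h4.trans ?_
  refine Finset.sum_congr rfl fun m _ => ?_
  rw [← Matrix.det_transpose]
  rfl

theorem zpow_sum_exponent {G ι : Type} [CommGroup G] (s : Finset ι) (y : G) (f : ι → ℤ) :
    ∏ i ∈ s, y ^ f i = y ^ ∑ i ∈ s, f i := by
  classical
  induction s using Finset.induction_on with
  | empty => simp
  | insert a s ha ih => rw [Finset.prod_insert ha, Finset.sum_insert ha, ih, zpow_add]

/-- The Vandermonde product `∏_{i < j} (x_i - x_j)`. -/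
def vand {R : Type} [CommRing R] {N : ℕ} (x : Fin N → R) : R :=
  ∏ i : Fin N, ∏ j ∈ Finset.Ioi i, (x i - x j)

theorem vand_succ {R : Type} [CommRing R] {N : ℕ} (x : Fin (N + 1) → R) :
    vand x = (∏ i : Fin N, (x 0 - x i.succ)) * vand (fun i => x i.succ) := by
  simp only [vand]
  rw [Fin.prod_univ_succ]
  congr 1
  · rw [Fin.Ioi_zero_eq_map, Finset.prod_map]; simp
  · refine Finset.prod_congr rfl fun i _ => ?_
    rw [Fin.Ioi_succ, Finset.prod_map]; simp

theorem vand_mul {R : Type} [CommRing R] {N : ℕ} (y : R) (x : Fin N → R) :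
    vand (fun i => y * x i) = y ^ (∑ i : Fin N, (Finset.Ioi i).card) * vand x := by
  simp only [vand, ← Finset.prod_pow_eq_pow_sum, ← Finset.prod_mul_distrib]
  refine Finset.prod_congr rfl fun i _ => ?_
  rw [← Finset.prod_const, ← Finset.prod_mul_distrib]
  exact Finset.prod_congr rfl fun j _ => by ring

/-- Schur functions are Laurent polynomials with nonnegative coefficients: the alternant is the
Vandermonde product times a nonempty sum of Laurent monomials (indexed by Gelfand–Tsetlin patterns),
in every commutative ring. -/
theorem exists_schur_exponents : ∀ (N : ℕ) (l : Fin N → ℤ), StrictAnti l →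
    ∃ T : Multiset (Fin N → ℤ), T ≠ 0 ∧ ∀ (R : Type) [CommRing R] (x : Fin N → Rˣ),
      Matrix.det (Matrix.of fun i j : Fin N => ((x i ^ l j : Rˣ) : R)) =
        vand (fun i => (x i : R)) * (T.map fun m => ((∏ i, x i ^ m i : Rˣ) : R)).sum
  | 0, l, _ => ⟨{fun i => i.elim0}, by simp, fun R _ x => by simp [vand]⟩
  | N + 1, l, hl => by
    classical
    set I := Fintype.piFinset (fun j : Fin N => Finset.Ico (l j.succ) (l j.castSucc)) with hI
    have hanti : ∀ m ∈ I, StrictAnti m := by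
      intro m hm
      rw [hI, Fintype.mem_piFinset] at hm
      cases N with
      | zero => intro a; exact a.elim0
      | succ n =>
        refine Fin.strictAnti_iff_succ_lt.mpr fun i => ?_
        have h1 := (Finset.mem_Ico.mp (hm i.succ)).2
        have h2 := (Finset.mem_Ico.mp (hm i.castSucc)).1
        rw [Fin.succ_castSucc] at h2
        exact h1.trans_le h2
    have ih : ∀ m : I, ∃ T : Multiset (Fin N → ℤ), T ≠ 0 ∧
        ∀ (R : Type) [CommRing R] (x : Fin N → Rˣ),
        Matrix.det (Matrix.of fun i j : Fin N => ((x i ^ m.1 j : Rˣ) : R)) =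
          vand (fun i => (x i : R)) * (T.map fun m => ((∏ i, x i ^ m i : Rˣ) : R)).sum :=
      fun m => exists_schur_exponents N m.1 (hanti m.1 m.2)
    choose T hT0 hT using ih
    set c : ℕ := ∑ i : Fin N, (Finset.Ioi i).card with hc
    -- The exponents of `x_1, …, x_N` come from a row `m` interlacing with `l`; homogeneity of the
    -- quotient, of degree `∑ l - N - c`, then dictates the exponent of `x_0`.
    refine ⟨(∑ m : I, T m).map fun t => Fin.cons ((∑ j, l j) - N - c - ∑ i, t i) t, ?_, ?_⟩
    · have hne : I.Nonempty := by
        rw [hI, Fintype.piFinset_nonempty]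
        exact fun j => Finset.nonempty_Ico.mpr (hl (Fin.castSucc_lt_succ (i := j)))
      obtain ⟨m, hm⟩ := hne
      rw [Ne, Multiset.map_eq_zero]
      intro h0
      rw [Finset.sum_eq_zero_iff] at h0
      exact hT0 ⟨m, hm⟩ (h0 _ (Finset.mem_univ _))
    · intro R _ x
      -- Factoring out `x_0` from every variable reduces to the branching rule, where `x_0 = 1`.
      set y := x 0
      set z : Fin N → Rˣ := fun i => y⁻¹ * x i.succ with hz
      have hx : ∀ i, x i = y * (Fin.cons 1 z : Fin (N + 1) → Rˣ) i := by
        intro i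
        refine Fin.cases ?_ (fun i => ?_) i <;> simp [hz, y]
      have h1 : (Matrix.of fun i j : Fin (N + 1) => ((x i ^ l j : Rˣ) : R)) =
          Matrix.of fun i j => ((y ^ l j : Rˣ) : R) * (Matrix.of fun i j : Fin (N + 1) =>
            (((Fin.cons 1 z : Fin (N + 1) → Rˣ) i ^ l j : Rˣ) : R)) i j := by
        ext i j
        simp only [Matrix.of_apply]
        rw [hx i, mul_zpow, Units.val_mul]
      rw [h1, Matrix.det_mul_row, det_zpow_cons_one z l hl]
      have h2 : vand (fun i => (x i : R)) = (y : R) ^ N * (∏ i, (1 - (z i : R))) *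
          ((y : R) ^ c * vand (fun i => (z i : R))) := by
        rw [vand_succ, hc, ← vand_mul]
        congr 1
        · rw [← Fin.prod_const, ← Finset.prod_mul_distrib]
          refine Finset.prod_congr rfl fun i _ => ?_
          rw [hx i.succ]; simp [y]; ring
        · congr 1; ext i; rw [hx i.succ]; simp
      have h3 : ∑ m ∈ I, Matrix.det (Matrix.of fun i j : Fin N => ((z i ^ m j : Rˣ) : R)) =
          vand (fun i => (z i : R)) *
            ((∑ m : I, T m).map fun t => ((∏ i, z i ^ t i : Rˣ) : R)).sum := by
        have hs : ((∑ m : I, T m).map fun t => ((∏ i, z i ^ t i : Rˣ) : R)).sum =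
            ∑ m : I, ((T m).map fun t => ((∏ i, z i ^ t i : Rˣ) : R)).sum := by
          rw [← Multiset.coe_mapAddMonoidHom, map_sum, ← Multiset.coe_sumAddMonoidHom, map_sum]
        rw [hs, Finset.mul_sum, ← Finset.sum_coe_sort]
        exact Finset.sum_congr rfl fun m _ => hT m R z
      have h4 : ∀ t : Fin N → ℤ, ((∏ i, x i ^ (Fin.cons ((∑ j, l j) - N - c - ∑ i, t i) t :
          Fin (N + 1) → ℤ) i : Rˣ) : R) * ((y : R) ^ N * (y : R) ^ c) =
          (∏ j, ((y ^ l j : Rˣ) : R)) * ((∏ i, z i ^ t i : Rˣ) : R) := by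
        intro t
        have : (∏ i, x i ^ (Fin.cons ((∑ j, l j) - N - c - ∑ i, t i) t :
          Fin (N + 1) → ℤ) i) * (y ^ N * y ^ c) = (∏ j, y ^ l j) * ∏ i, z i ^ t i := by
          have ha : ∏ i, z i ^ t i = y ^ (-∑ i, t i) * ∏ i : Fin N, x i.succ ^ t i := by
            simp only [hz, mul_zpow, Finset.prod_mul_distrib, ← Finset.sum_neg_distrib]
            congr 1
            rw [← zpow_sum_exponent]
            exact Finset.prod_congr rfl fun i _ => by rw [inv_zpow, zpow_neg]
          rw [Fin.prod_univ_succ, ha, zpow_sum_exponent]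
          simp only [Fin.cons_zero, Fin.cons_succ]
          change y ^ _ * _ * _ = _
          rw [mul_right_comm, ← mul_assoc (y ^ ∑ j, l j), ← zpow_natCast, ← zpow_natCast,
            ← zpow_add, ← zpow_add, ← zpow_add]
          congr 2; ring
        have := congrArg (Units.val) this
        simpa [Units.val_mul, Units.coe_prod] using this
      rw [h2, h3, Multiset.map_map]
      have h5 : (∏ j, ((y ^ l j : Rˣ) : R)) *
            ((∑ m : I, T m).map fun t => ((∏ i, z i ^ t i : Rˣ) : R)).sum =
          ((y : R) ^ N * (y : R) ^ c) * ((∑ m : I, T m).map ((fun m : Fin (N + 1) → ℤ =>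
            ((∏ i, x i ^ m i : Rˣ) : R)) ∘
              fun t => Fin.cons ((∑ j, l j) - N - c - ∑ i, t i) t)).sum := by
        rw [← Multiset.sum_map_mul_left, ← Multiset.sum_map_mul_left]
        congr 1
        refine Multiset.map_congr rfl fun t _ => ?_
        rw [← h4 t]; simp only [Function.comp]; ring
      linear_combination (∏ i, (1 - (z i : R))) * vand (fun i => (z i : R)) * h5

/-! ### Divided differences of power series -/

open MvPowerSeries in
theorem coeff_rename_perm {N : ℕ} (σ : Equiv.Perm (Fin N)) (f : MvPowerSeries (Fin N) ℂ)
    (m : Fin N →₀ ℕ) :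
    coeff m (rename σ f) = coeff (m.embDomain σ.symm.toEmbedding) f := by
  rw [← coeff_embDomain_rename σ.toEmbedding f (m.embDomain σ.symm.toEmbedding)]
  refine congrArg (fun k => coeff k (rename σ f)) ?_
  ext i
  obtain ⟨j, rfl⟩ : ∃ j, σ j = i := ⟨σ.symm i, by simp⟩
  have h1 := Finsupp.embDomain_apply_self σ.toEmbedding
    (m.embDomain σ.symm.toEmbedding) j
  have h2 := Finsupp.embDomain_apply_self σ.symm.toEmbedding m (σ j)
  simp only [Equiv.coe_toEmbedding, Equiv.symm_apply_apply] at h1 h2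
  rw [h1, h2]

theorem embDomain_perm_apply {N : ℕ} (σ : Equiv.Perm (Fin N)) (m : Fin N →₀ ℕ) (i : Fin N) :
    m.embDomain σ.toEmbedding i = m (σ.symm i) := by
  have h := Finsupp.embDomain_apply_self σ.toEmbedding m (σ.symm i)
  simpa using h

/-- `ExpAt m a b p q` is the exponent obtained from `m` by giving the variables `a`, `b` the
exponents `p`, `q`. -/
def ExpAt {N : ℕ} (m : Fin N →₀ ℕ) (a b : Fin N) (p q : ℕ) : Fin N →₀ ℕ :=
  (m.update a p).update b q

theorem expAt_apply {N : ℕ} (m : Fin N →₀ ℕ) (a b : Fin N) (p q : ℕ) (i : Fin N) :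
    ExpAt m a b p q i = if i = b then q else if i = a then p else m i := by
  classical
  simp only [ExpAt, Finsupp.update_apply]

/-- The divided difference `(f - s_{ab} f) / (X_a - X_b)`, given by its coefficients. -/
def divDiffPair {N : ℕ} (a b : Fin N) (f : MvPowerSeries (Fin N) ℂ) : MvPowerSeries (Fin N) ℂ :=
  fun m => ∑ t ∈ Finset.range (m b + 1), MvPowerSeries.coeff (ExpAt m a b (m a + 1 + t) (m b - t))
    (f - MvPowerSeries.rename (Equiv.swap a b) f)

open MvPowerSeries in
theorem coeff_divDiffPair {N : ℕ} (a b : Fin N) (f : MvPowerSeries (Fin N) ℂ) (m : Fin N →₀ ℕ) :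
    coeff m (divDiffPair a b f) = ∑ t ∈ Finset.range (m b + 1),
      coeff (ExpAt m a b (m a + 1 + t) (m b - t)) (f - rename (Equiv.swap a b) f) := rfl

open MvPowerSeries in
theorem coeff_X_mul_of_pos {N : ℕ} (a : Fin N) (h : MvPowerSeries (Fin N) ℂ) (m : Fin N →₀ ℕ)
    (hm : m a ≠ 0) : coeff m (X a * h) = coeff (m - Finsupp.single a 1) h := by
  have h1 : Finsupp.single a 1 + (m - Finsupp.single a 1) = m := by
    rw [add_tsub_cancel_of_le]
    rw [Finsupp.single_le_iff]; omega
  conv_lhs => rw [← h1, X_def, coeff_add_monomial_mul, one_mul]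

open MvPowerSeries in
theorem coeff_X_mul_of_zero {N : ℕ} (a : Fin N) (h : MvPowerSeries (Fin N) ℂ) (m : Fin N →₀ ℕ)
    (hm : m a = 0) : coeff m (X a * h) = 0 := by
  rw [X_def, coeff_monomial_mul, if_neg]
  rw [Finsupp.single_le_iff]; omega

open MvPowerSeries in
/-- The coefficients of `f - s_{ab} f` are antisymmetric in the exponents of `X_a` and `X_b`, so
that their sum along each antidiagonal in these two exponents vanishes; this makes the partial sums
defining `divDiffPair` a quotient by `X_a - X_b`. -/
theorem X_sub_X_mul_divDiffPair {N : ℕ} {a b : Fin N} (hab : a ≠ b)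
    (f : MvPowerSeries (Fin N) ℂ) :
    (X a - X b) * divDiffPair a b f = f - rename (Equiv.swap a b) f := by
  set A := f - rename (Equiv.swap a b) f with hA
  have hanti : ∀ m p q, coeff (ExpAt m a b p q) A = - coeff (ExpAt m a b q p) A := by
    intro m p q
    have hs : ∀ p q, (ExpAt m a b p q).embDomain (Equiv.swap a b).symm.toEmbedding =
        ExpAt m a b q p := by
      intro p q
      ext i
      rw [embDomain_perm_apply, expAt_apply, expAt_apply]
      simp only [Equiv.symm_symm, Equiv.swap_apply_def]
      split_ifs <;> simp_all
    simp only [hA, map_sub, coeff_rename_perm, hs]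
    ring
  ext m
  have hself : ExpAt m a b (m a) (m b) = m := by
    ext i; rw [expAt_apply]; split_ifs <;> simp_all
  rw [sub_mul, map_sub]
  have hXb : ∀ q, m b = q + 1 → coeff m (X b * divDiffPair a b f) =
      ∑ t ∈ Finset.range (q + 1), coeff (ExpAt m a b (m a + 1 + t) (q - t)) A := by
    intro q hq
    rw [coeff_X_mul_of_pos b _ _ (by omega), coeff_divDiffPair]
    have h1 : (m - Finsupp.single b 1 : Fin N →₀ ℕ) b = q := by simp [hq]
    have h2 : (m - Finsupp.single b 1 : Fin N →₀ ℕ) a = m a := by simp [hab]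
    rw [h1, h2]
    refine Finset.sum_congr rfl fun t _ => ?_
    refine congrArg (fun k => coeff k A) ?_
    ext i
    rw [expAt_apply, expAt_apply]
    split_ifs with h3 h4 <;> simp_all
  have hXa : ∀ p, m a = p + 1 → coeff m (X a * divDiffPair a b f) =
      ∑ t ∈ Finset.range (m b + 1), coeff (ExpAt m a b (p + 1 + t) (m b - t)) A := by
    intro p hp
    rw [coeff_X_mul_of_pos a _ _ (by omega), coeff_divDiffPair]
    have h1 : (m - Finsupp.single a 1 : Fin N →₀ ℕ) a = p := by simp [hp]
    have h2 : (m - Finsupp.single a 1 : Fin N →₀ ℕ) b = m b := by simp [hab.symm]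
    rw [h1, h2]
    refine Finset.sum_congr rfl fun t _ => ?_
    refine congrArg (fun k => coeff k A) ?_
    ext i
    rw [expAt_apply, expAt_apply]
    split_ifs with h3 h4 <;> simp_all
  have hzero : ∀ q, ∑ t ∈ Finset.range (q + 1), coeff (ExpAt m a b t (q - t)) A = 0 := by
    intro q
    have h1 := Finset.sum_range_reflect (fun t => coeff (ExpAt m a b t (q - t)) A) (q + 1)
    have h2 : ∑ t ∈ Finset.range (q + 1), coeff (ExpAt m a b (q + 1 - 1 - t)
        (q - (q + 1 - 1 - t))) A =
        - ∑ t ∈ Finset.range (q + 1), coeff (ExpAt m a b t (q - t)) A := by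
      rw [← Finset.sum_neg_distrib]
      refine Finset.sum_congr rfl fun t ht => ?_
      rw [hanti]
      have := Finset.mem_range.mp ht
      rw [show q - (q + 1 - 1 - t) = t by omega, show q + 1 - 1 - t = q - t by omega]
    rw [h2] at h1
    exact self_eq_neg.mp h1.symm
  rcases Nat.eq_zero_or_eq_succ_pred (m a) with hp | hp <;>
    rcases Nat.eq_zero_or_eq_succ_pred (m b) with hq | hq
  · rw [coeff_X_mul_of_zero a _ _ hp, coeff_X_mul_of_zero b _ _ hq, ← hself, hp, hq]
    have := hzero 0
    simp at this
    rw [this]; simp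
  · rw [coeff_X_mul_of_zero a _ _ hp, hXb _ hq, hp]
    have h1 := hzero (m b)
    rw [Finset.sum_range_succ'] at h1
    have h2 : coeff (ExpAt m a b 0 (m b - 0)) A = coeff m A := by
      rw [Nat.sub_zero, ← hp, hself]
    rw [h2] at h1
    rw [zero_sub, neg_eq_iff_add_eq_zero, ← h1]
    congr 1
    rw [← Nat.succ_eq_add_one, ← hq]
    refine Finset.sum_congr rfl fun t _ => ?_
    rw [show 0 + 1 + t = t + 1 by omega, show (m b).pred - t = m b - (t + 1) by
      rw [Nat.pred_eq_sub_one]; omega]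
  · rw [coeff_X_mul_of_zero b _ _ hq, hXa _ hp, hq]
    have h2 : coeff (ExpAt m a b (m a) (m b)) A = coeff m A := by rw [hself]
    rw [← h2, hq]
    conv_rhs => rw [hp]
    simp
  · rw [hXb _ hq, hXa _ hp, Finset.sum_range_succ']
    have h2 : coeff (ExpAt m a b ((m a).pred + 1 + 0) (m b - 0)) A = coeff m A := by
      conv_rhs => rw [← hself]
      rw [Nat.sub_zero, add_zero, ← Nat.succ_eq_add_one, ← hp]
    rw [h2]
    have h3 : ∑ t ∈ Finset.range (m b), coeff (ExpAt m a b ((m a).pred + 1 + (t + 1))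
        (m b - (t + 1))) A = ∑ t ∈ Finset.range ((m b).pred + 1),
          coeff (ExpAt m a b (m a + 1 + t) ((m b).pred - t)) A := by
      rw [← Nat.succ_eq_add_one (m b).pred, ← hq]
      refine Finset.sum_congr rfl fun t _ => ?_
      rw [show (m a).pred + 1 + (t + 1) = m a + 1 + t by
        have := hp; rw [Nat.succ_eq_add_one] at this; omega,
        show (m b).pred - t = m b - (t + 1) by rw [Nat.pred_eq_sub_one]; omega]
    rw [h3]; ring

/-- All coefficients of `P` of degree at most `n` are bounded by `B`. -/
def CoeffBound {N : ℕ} (n : ℕ) (B : ℝ) (P : MvPowerSeries (Fin N) ℂ) : Prop :=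
  ∀ m : Fin N →₀ ℕ, m.degree ≤ n → ‖MvPowerSeries.coeff m P‖ ≤ B

open MvPowerSeries in
theorem CoeffBound.rename_perm {N n : ℕ} {B : ℝ} {P : MvPowerSeries (Fin N) ℂ}
    (h : CoeffBound n B P) (σ : Equiv.Perm (Fin N)) : CoeffBound n B (rename σ P) := by
  intro m hm
  rw [coeff_rename_perm]
  refine h _ (le_trans (le_of_eq ?_) hm)
  rw [Finsupp.degree_eq_sum, Finsupp.degree_eq_sum]
  rw [← Equiv.sum_comp σ m]
  refine Finset.sum_congr rfl fun i _ => ?_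
  rw [embDomain_perm_apply, Equiv.symm_symm]

theorem CoeffBound.divDiffPair {N n : ℕ} {B : ℝ} {P : MvPowerSeries (Fin N) ℂ}
    (h : CoeffBound (n + 1) B P) {a b : Fin N} (hab : a ≠ b) :
    CoeffBound n (2 * (n + 1) * B) (divDiffPair a b P) := by
  intro m hm
  rw [coeff_divDiffPair]
  have hB : 0 ≤ B := (norm_nonneg _).trans (h 0 (by simp))
  have hmb : m b ≤ n := (Finsupp.le_degree b m).trans hm
  have hdeg : ∀ t ∈ Finset.range (m b + 1),
      (ExpAt m a b (m a + 1 + t) (m b - t)).degree ≤ n + 1 := by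
    intro t ht
    have ht' := Finset.mem_range.mp ht
    have h1 : ExpAt m a b (m a + 1 + t) (m b - t) + Finsupp.single b t =
        m + Finsupp.single a (1 + t) := by
      ext i
      simp only [Finsupp.add_apply, expAt_apply, Finsupp.single_apply]
      by_cases h1 : i = b
      · subst h1; simp [hab]; omega
      · by_cases h2 : i = a
        · subst h2; simp [hab, Ne.symm hab]; omega
        · simp [h1, h2, Ne.symm h1, Ne.symm h2]
    have h2 := congrArg Finsupp.degree h1
    rw [map_add, map_add, Finsupp.degree_single, Finsupp.degree_single] at h2
    omega
  calc _ ≤ ∑ t ∈ Finset.range (m b + 1), (2 * B) := by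
        refine (norm_sum_le _ _).trans (Finset.sum_le_sum fun t ht => ?_)
        rw [map_sub, two_mul]
        exact (norm_sub_le _ _).trans (add_le_add (h _ (hdeg t ht))
          (h.rename_perm _ _ (hdeg t ht)))
    _ = (m b + 1) * (2 * B) := by simp
    _ ≤ (n + 1) * (2 * B) := by gcongr
    _ = _ := by ring

/-- A family of power series, one for each variable, which is permuted along with the variables. -/
def Equivariant {N : ℕ} (q : Fin N → MvPowerSeries (Fin N) ℂ) : Prop :=
  ∀ (σ : Equiv.Perm (Fin N)) (i : Fin N), MvPowerSeries.rename σ (q i) = q (σ i)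

/-- The divided difference `∑_{i ∈ I} q_i / ∏_{j ∈ I, j ≠ i} (X_i - X_j)` in the fraction field. -/
def divDiffFrac {N : ℕ} (I : Finset (Fin N)) (q : Fin N → MvPowerSeries (Fin N) ℂ) :
    FractionRing (MvPowerSeries (Fin N) ℂ) :=
  ∑ i ∈ I, (∏ j ∈ I.erase i, algebraMap (MvPowerSeries (Fin N) ℂ)
      (FractionRing (MvPowerSeries (Fin N) ℂ)) (MvPowerSeries.X i - MvPowerSeries.X j))⁻¹ *
    algebraMap _ _ (q i)

theorem X_sub_X_ne_zero {N : ℕ} {i j : Fin N} (hij : i ≠ j) :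
    (MvPowerSeries.X i - MvPowerSeries.X j : MvPowerSeries (Fin N) ℂ) ≠ 0 :=
  sub_ne_zero.mpr fun h => hij (MvPowerSeries.X_inj.mp h)

theorem algebraMap_X_sub_X_ne_zero {N : ℕ} {i j : Fin N} (hij : i ≠ j) :
    algebraMap (MvPowerSeries (Fin N) ℂ) (FractionRing (MvPowerSeries (Fin N) ℂ))
      (MvPowerSeries.X i - MvPowerSeries.X j) ≠ 0 := by
  rw [Ne, IsFractionRing.to_map_eq_zero_iff]
  exact X_sub_X_ne_zero hij

open MvPowerSeries in
theorem divDiffFrac_erase {N : ℕ} {I : Finset (Fin N)} (q : Fin N → MvPowerSeries (Fin N) ℂ)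
    {b : Fin N} (hb : b ∈ I) :
    divDiffFrac (I.erase b) q = ∑ i ∈ I, (∏ j ∈ I.erase i, algebraMap (MvPowerSeries (Fin N) ℂ)
      (FractionRing (MvPowerSeries (Fin N) ℂ)) (X i - X j))⁻¹ *
        algebraMap (MvPowerSeries (Fin N) ℂ) _ (X i - X b) * algebraMap _ _ (q i) := by
  rw [← Finset.add_sum_erase _ _ hb, sub_self, map_zero, mul_zero, zero_mul, zero_add, divDiffFrac]
  refine Finset.sum_congr rfl fun i hi => ?_
  congr 1
  have hib : i ≠ b := Finset.ne_of_mem_erase hi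
  have h1 : b ∈ I.erase i := Finset.mem_erase.mpr ⟨hib.symm, hb⟩
  rw [← Finset.mul_prod_erase _ _ h1, mul_inv, Finset.erase_right_comm]
  have := algebraMap_X_sub_X_ne_zero hib
  field_simp

open MvPowerSeries in
/-- Newton's recursion for divided differences. -/
theorem X_sub_X_mul_divDiffFrac {N : ℕ} {I : Finset (Fin N)}
    (q : Fin N → MvPowerSeries (Fin N) ℂ) {a b : Fin N} (ha : a ∈ I) (hb : b ∈ I) :
    algebraMap (MvPowerSeries (Fin N) ℂ) _ (X a - X b) * divDiffFrac I q =
      divDiffFrac (I.erase b) q - divDiffFrac (I.erase a) q := by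
  rw [divDiffFrac_erase q hb, divDiffFrac_erase q ha, ← Finset.sum_sub_distrib, divDiffFrac,
    Finset.mul_sum]
  refine Finset.sum_congr rfl fun i _ => ?_
  simp only [map_sub]
  ring

open MvPowerSeries in
theorem map_divDiffFrac {N : ℕ} {I : Finset (Fin N)} {q : Fin N → MvPowerSeries (Fin N) ℂ}
    (hq : Equivariant q) (σ : Equiv.Perm (Fin N)) :
    IsFractionRing.ringEquivOfRingEquiv (renameEquiv ℂ σ).toRingEquiv (divDiffFrac I q) =
      divDiffFrac (I.map σ.toEmbedding) q := by
  rw [divDiffFrac, divDiffFrac, map_sum, Finset.sum_map]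
  refine Finset.sum_congr rfl fun i _ => ?_
  rw [map_mul, map_inv₀, map_prod]
  simp only [IsFractionRing.ringEquivOfRingEquiv_algebraMap]
  have h1 : ∀ f : MvPowerSeries (Fin N) ℂ, (renameEquiv ℂ σ).toRingEquiv f = rename σ f :=
    fun _ => rfl
  simp only [h1, hq σ i, map_sub, rename_X, Equiv.coe_toEmbedding]
  congr 2
  have h2 : (I.map σ.toEmbedding).erase (σ i) = (I.erase i).map σ.toEmbedding := by
    rw [Finset.map_erase]; rfl
  rw [h2, Finset.prod_map]
  rfl

/-- Divided differences of equivariant families are power series, with coefficients bounded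
independently of the number of variables. -/
theorem exists_divDiff (r : ℕ) : ∀ n : ℕ, ∃ C : ℝ, 0 ≤ C ∧
    ∀ (N : ℕ) (q : Fin N → MvPowerSeries (Fin N) ℂ), Equivariant q →
      ∀ I : Finset (Fin N), I.card = r + 1 → ∃ P : MvPowerSeries (Fin N) ℂ,
        algebraMap _ _ P = divDiffFrac I q ∧
          ∀ B : ℝ, (∀ i, CoeffBound (n + r) B (q i)) → CoeffBound n (C * B) P := by
  induction r with
  | zero =>
    intro n
    refine ⟨1, zero_le_one, fun N q hq I hI => ?_⟩
    obtain ⟨i, rfl⟩ := Finset.card_eq_one.mp hI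
    exact ⟨q i, by simp [divDiffFrac], fun B hB => by simpa using hB i⟩
  | succ r ih =>
    intro n
    obtain ⟨C, hC0, hC⟩ := ih (n + 1)
    refine ⟨2 * (n + 1) * C, by positivity, fun N q hq I hI => ?_⟩
    obtain ⟨a, ha, b, hb, hab⟩ := Finset.one_lt_card.mp (by omega : 1 < I.card)
    obtain ⟨P, hP, hPB⟩ := hC N q hq (I.erase b) (by rw [Finset.card_erase_of_mem hb]; omega)
    have hswap : algebraMap _ _ (MvPowerSeries.rename (Equiv.swap a b) P) =
        divDiffFrac (I.erase a) q := by
      have h1 := map_divDiffFrac (I := I.erase b) hq (Equiv.swap a b)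
      rw [← hP, IsFractionRing.ringEquivOfRingEquiv_algebraMap] at h1
      refine h1.trans ?_
      congr 1
      ext i
      simp only [Finset.mem_map_equiv, Finset.mem_erase, Equiv.symm_swap]
      rcases eq_or_ne i a with rfl | hia
      · simp
      · rcases eq_or_ne i b with rfl | hib
        · simp [hab, hia, ha, hb]
        · simp [Equiv.swap_apply_of_ne_of_ne, hia, hib]
    refine ⟨divDiffPair a b P, ?_, fun B hB => ?_⟩
    · have h1 := congrArg (algebraMap _ (FractionRing (MvPowerSeries (Fin N) ℂ)))
        (X_sub_X_mul_divDiffPair hab P)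
      rw [map_mul, map_sub _ P, hP, hswap, ← X_sub_X_mul_divDiffFrac q ha hb] at h1
      exact mul_left_cancel₀ (algebraMap_X_sub_X_ne_zero hab) h1
    · have h1 : CoeffBound (n + 1) (C * B) P := hPB B fun i => by
        have := hB i; rwa [show n + (r + 1) = n + 1 + r by ring] at this
      have h2 := h1.divDiffPair hab
      rwa [← mul_assoc] at h2

open Classical in
/-- The divided difference over the set of variables `I` as a power series (with value `0` when it
fails to be one). -/
def divDiff {N : ℕ} (I : Finset (Fin N)) (q : Fin N → MvPowerSeries (Fin N) ℂ) :
    MvPowerSeries (Fin N) ℂ :=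
  if h : ∃ P : MvPowerSeries (Fin N) ℂ, algebraMap _ _ P = divDiffFrac I q then h.choose else 0

theorem algebraMap_divDiff {N : ℕ} {I : Finset (Fin N)} (hI : I.Nonempty)
    {q : Fin N → MvPowerSeries (Fin N) ℂ} (hq : Equivariant q) :
    algebraMap _ _ (divDiff I q) = divDiffFrac I q := by
  have hcard : I.card = (I.card - 1) + 1 := by have := hI.card_pos; omega
  obtain ⟨C, -, hC⟩ := exists_divDiff (I.card - 1) 0
  obtain ⟨P, hP, -⟩ := hC N q hq I hcard
  have h : ∃ P : MvPowerSeries (Fin N) ℂ, algebraMap _ _ P = divDiffFrac I q := ⟨P, hP⟩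
  rw [divDiff, dif_pos h]
  exact h.choose_spec

/-- The coefficients of degree at most `n` of a divided difference are bounded by those of degree at
most `n + r` of the family, with a constant that does not depend on the number of variables. -/
theorem divDiff_bound (r n : ℕ) : ∃ C : ℝ, 0 ≤ C ∧
    ∀ (N : ℕ) (q : Fin N → MvPowerSeries (Fin N) ℂ), Equivariant q →
      ∀ I : Finset (Fin N), I.card = r + 1 →
          ∀ B : ℝ, (∀ i, CoeffBound (n + r) B (q i)) → CoeffBound n (C * B) (divDiff I q) := by
  obtain ⟨C, hC0, hC⟩ := exists_divDiff r n
  refine ⟨C, hC0, fun N q hq I hI B hB => ?_⟩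
  obtain ⟨P, hP, hPB⟩ := hC N q hq I hI
  have h1 := algebraMap_divDiff (Finset.card_pos.mp (by omega : 0 < I.card)) hq
  rw [← hP] at h1
  rw [IsFractionRing.injective _ (FractionRing (MvPowerSeries (Fin N) ℂ)) h1]
  exact hPB B hB

theorem divDiff_singleton {N : ℕ} (i : Fin N) {q : Fin N → MvPowerSeries (Fin N) ℂ}
    (hq : Equivariant q) : divDiff {i} q = q i := by
  apply IsFractionRing.injective _ (FractionRing (MvPowerSeries (Fin N) ℂ))
  rw [algebraMap_divDiff (Finset.singleton_nonempty i) hq]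
  simp [divDiffFrac]

theorem X_sub_X_mul_divDiff {N : ℕ} {I : Finset (Fin N)} {q : Fin N → MvPowerSeries (Fin N) ℂ}
    (hq : Equivariant q) {a b : Fin N} (ha : a ∈ I) (hb : b ∈ I) (hab : a ≠ b) :
    (MvPowerSeries.X a - MvPowerSeries.X b) * divDiff I q =
      divDiff (I.erase b) q - divDiff (I.erase a) q := by
  apply IsFractionRing.injective _ (FractionRing (MvPowerSeries (Fin N) ℂ))
  rw [map_mul, map_sub _ (divDiff _ _), algebraMap_divDiff ⟨a, ha⟩ hq,
    algebraMap_divDiff ⟨a, Finset.mem_erase.mpr ⟨hab, ha⟩⟩ hq,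
    algebraMap_divDiff ⟨b, Finset.mem_erase.mpr ⟨hab.symm, hb⟩⟩ hq,
    X_sub_X_mul_divDiffFrac q ha hb]

theorem divDiff_sub {N : ℕ} {I : Finset (Fin N)} (hI : I.Nonempty)
    {q q' : Fin N → MvPowerSeries (Fin N) ℂ} (hq : Equivariant q) (hq' : Equivariant q') :
    divDiff I (fun i => q i - q' i) = divDiff I q - divDiff I q' := by
  have hs : Equivariant (fun i => q i - q' i) := fun σ i => by rw [map_sub, hq, hq']
  apply IsFractionRing.injective _ (FractionRing (MvPowerSeries (Fin N) ℂ))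
  rw [map_sub, algebraMap_divDiff hI hq, algebraMap_divDiff hI hq', algebraMap_divDiff hI hs]
  simp [divDiffFrac, ← Finset.sum_sub_distrib, mul_sub]

/-- A power series invariant under permutations of the variables. -/
def SymmSeries {N : ℕ} (h : MvPowerSeries (Fin N) ℂ) : Prop :=
  ∀ σ : Equiv.Perm (Fin N), MvPowerSeries.rename σ h = h

theorem divDiff_mul_left {N : ℕ} {I : Finset (Fin N)} (hI : I.Nonempty)
    {q : Fin N → MvPowerSeries (Fin N) ℂ} (hq : Equivariant q) {P : MvPowerSeries (Fin N) ℂ}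
    (hP : SymmSeries P) : divDiff I (fun i => P * q i) = P * divDiff I q := by
  have hs : Equivariant (fun i => P * q i) := fun σ i => by rw [map_mul, hq, hP]
  apply IsFractionRing.injective _ (FractionRing (MvPowerSeries (Fin N) ℂ))
  rw [map_mul, algebraMap_divDiff hI hq, algebraMap_divDiff hI hs]
  simp only [divDiffFrac, Finset.mul_sum, map_mul]
  exact Finset.sum_congr rfl fun i _ => by ring

open MvPowerSeries in
theorem rename_perm_pderiv {N : ℕ} (σ : Equiv.Perm (Fin N)) (i : Fin N)
    (f : MvPowerSeries (Fin N) ℂ) :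
    rename σ (pderiv ℂ i f) = pderiv ℂ (σ i) (rename σ f) := by
  ext m
  rw [coeff_rename_perm, coeff_pderiv, coeff_pderiv, coeff_rename_perm]
  have h1 : m.embDomain σ.symm.toEmbedding i = m (σ i) := by
    rw [embDomain_perm_apply, Equiv.symm_symm]
  rw [h1]
  congr 1
  refine congrArg (fun k => coeff k f) ?_
  ext j
  rw [embDomain_perm_apply, Finsupp.add_apply, Finsupp.add_apply, embDomain_perm_apply]
  simp [Finsupp.single_apply]

theorem Equivariant.mul {N : ℕ} {q q' : Fin N → MvPowerSeries (Fin N) ℂ} (hq : Equivariant q)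
    (hq' : Equivariant q') : Equivariant (fun i => q i * q' i) :=
  fun σ i => by rw [map_mul, hq, hq']

theorem Equivariant.add {N : ℕ} {q q' : Fin N → MvPowerSeries (Fin N) ℂ} (hq : Equivariant q)
    (hq' : Equivariant q') : Equivariant (fun i => q i + q' i) :=
  fun σ i => by rw [map_add, hq, hq']

theorem Equivariant.pderiv {N : ℕ} {q : Fin N → MvPowerSeries (Fin N) ℂ} (hq : Equivariant q) :
    Equivariant (fun i => MvPowerSeries.pderiv ℂ i (q i)) :=
  fun σ i => by rw [rename_perm_pderiv, hq]

theorem Equivariant.smul {N : ℕ} {q : Fin N → MvPowerSeries (Fin N) ℂ} (hq : Equivariant q)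
    (c : ℂ) : Equivariant (fun i => c • q i) :=
  fun σ i => by rw [map_smul, hq]

theorem SymmSeries.equivariant {N : ℕ} {h : MvPowerSeries (Fin N) ℂ} (hh : SymmSeries h) :
    Equivariant (fun _ => h) := fun σ _ => hh σ

theorem equivariant_one_add_X_pow (N k : ℕ) :
    Equivariant (fun i : Fin N => (1 + MvPowerSeries.X i : MvPowerSeries (Fin N) ℂ) ^ k) :=
  fun σ i => by simp [MvPowerSeries.rename_X]

theorem Equivariant.iterate {N : ℕ}
    {A : Fin N → MvPowerSeries (Fin N) ℂ → MvPowerSeries (Fin N) ℂ}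
    (hA : ∀ q : Fin N → MvPowerSeries (Fin N) ℂ, Equivariant q → Equivariant (fun i => A i (q i)))
    {h : MvPowerSeries (Fin N) ℂ} (hh : SymmSeries h) (k : ℕ) :
    Equivariant (fun i => (A i)^[k] h) := by
  induction k with
  | zero => exact hh.equivariant
  | succ k ih =>
    simp only [Function.iterate_succ_apply']
    exact hA _ ih

/-! ### Divided differences of functions of one variable -/

/-- The power series `φ(X_i)`. -/
def inVar {N : ℕ} (i : Fin N) : PowerSeries ℂ →ₐ[ℂ] MvPowerSeries (Fin N) ℂ :=
  MvPowerSeries.rename (fun _ : Unit => i)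

theorem coeff_single_inVar {N : ℕ} (i : Fin N) (φ : PowerSeries ℂ) (n : ℕ) :
    MvPowerSeries.coeff (Finsupp.single i n) (inVar i φ) = PowerSeries.coeff n φ := by
  have h := MvPowerSeries.coeff_embDomain_rename (R := ℂ)
    (⟨fun _ : Unit => i, fun _ _ _ => rfl⟩ : Unit ↪ Fin N) φ (Finsupp.single () n)
  rw [Finsupp.embDomain_single] at h
  exact h

theorem coeff_inVar_eq_zero {N : ℕ} {i j : Fin N} (hij : j ≠ i) (φ : PowerSeries ℂ)
    {m : Fin N →₀ ℕ} (hm : m j ≠ 0) : MvPowerSeries.coeff m (inVar i φ) = 0 := by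
  refine MvPowerSeries.coeff_rename_eq_zero _ _ ?_
  rintro ⟨x, rfl⟩
  refine hm ?_
  rw [Finsupp.mapDomain_of_notMem_range]
  rintro ⟨u, hu⟩
  exact hij hu.symm

theorem pderiv_inVar_of_ne {N : ℕ} {i j : Fin N} (hij : j ≠ i) (φ : PowerSeries ℂ) :
    MvPowerSeries.pderiv ℂ j (inVar i φ) = 0 := by
  ext m
  rw [MvPowerSeries.coeff_pderiv, coeff_inVar_eq_zero hij φ (by simp)]
  simp

theorem equivariant_inVar (N : ℕ) (φ : PowerSeries ℂ) :
    Equivariant (fun i : Fin N => inVar i φ) := by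
  intro σ i
  exact MvPowerSeries.rename_rename (fun _ : Unit => i) σ φ

/-- Divided differences of a function of one variable involve only the variables in `I`. -/
theorem pderiv_divDiff_inVar (φ : PowerSeries ℂ) {N : ℕ} : ∀ (I : Finset (Fin N)), I.Nonempty →
    ∀ j ∉ I, MvPowerSeries.pderiv ℂ j (divDiff I fun i => inVar i φ) = 0 := by
  intro I
  induction I using Finset.strongInduction with
  | H I ih =>
    intro hI j hj
    have hq := equivariant_inVar N φ
    obtain ⟨a, ha⟩ := hI
    by_cases h1 : ∃ b ∈ I, b ≠ a
    · obtain ⟨b, hb, hba⟩ := h1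
      have h2 := congrArg (MvPowerSeries.pderiv ℂ j) (X_sub_X_mul_divDiff hq ha hb hba.symm)
      have haI : a ∈ I.erase b := Finset.mem_erase.mpr ⟨hba.symm, ha⟩
      have hbI : b ∈ I.erase a := Finset.mem_erase.mpr ⟨hba, hb⟩
      rw [map_sub, ih _ (Finset.erase_ssubset hb) ⟨a, haI⟩ j
          fun h => hj (Finset.mem_of_mem_erase h),
        ih _ (Finset.erase_ssubset ha) ⟨b, hbI⟩ j fun h => hj (Finset.mem_of_mem_erase h),
        Derivation.leibniz, map_sub, MvPowerSeries.pderiv_X_of_ne (ne_of_mem_of_not_mem ha hj),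
        MvPowerSeries.pderiv_X_of_ne (ne_of_mem_of_not_mem hb hj), sub_zero, smul_zero, add_zero,
        smul_eq_mul] at h2
      exact (mul_eq_zero.mp h2).resolve_left (X_sub_X_ne_zero hba.symm)
    · push Not at h1
      have h2 : I = {a} := Finset.eq_singleton_iff_unique_mem.mpr ⟨ha, h1⟩
      subst h2
      rw [divDiff_singleton a hq]
      exact pderiv_inVar_of_ne (fun h => hj (by simp [h])) φ

theorem coeff_divDiff_inVar_eq_zero (φ : PowerSeries ℂ) {N : ℕ} {I : Finset (Fin N)}
    (hI : I.Nonempty) {j : Fin N} (hj : j ∉ I) {m : Fin N →₀ ℕ} (hm : m j ≠ 0) :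
    MvPowerSeries.coeff m (divDiff I fun i => inVar i φ) = 0 := by
  have h1 := MvPowerSeries.coeff_pderiv (i := j) (divDiff I fun i => inVar i φ)
    (m - Finsupp.single j 1)
  have h2 : m - Finsupp.single j 1 + Finsupp.single j 1 = m := by
    rw [tsub_add_cancel_of_le]; rw [Finsupp.single_le_iff]; omega
  rw [pderiv_divDiff_inVar φ I hI j hj, h2, map_zero] at h1
  refine (mul_eq_zero.mp h1.symm).resolve_right ?_
  exact Nat.cast_add_one_ne_zero _

/-- At a single variable, the divided difference of `φ` over `r + 1` variables is the `r`-fold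
backward shift of `φ`. -/
theorem coeff_single_divDiff_inVar (φ : PowerSeries ℂ) {N : ℕ} (r : ℕ) :
    ∀ (I : Finset (Fin N)), I.card = r + 1 → ∀ a ∈ I, ∀ p : ℕ,
      MvPowerSeries.coeff (Finsupp.single a p) (divDiff I fun i => inVar i φ) =
        PowerSeries.coeff (p + r) φ := by
  induction r with
  | zero =>
    intro I hI a ha p
    obtain ⟨i, rfl⟩ := Finset.card_eq_one.mp hI
    rw [Finset.mem_singleton.mp ha, divDiff_singleton i (equivariant_inVar N φ),
      coeff_single_inVar, add_zero]
  | succ r ih =>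
    intro I hI a ha p
    have hq := equivariant_inVar N φ
    obtain ⟨b, hb, hba⟩ := Finset.exists_mem_ne (by omega : 1 < I.card) a
    have haI : a ∈ I.erase b := Finset.mem_erase.mpr ⟨hba.symm, ha⟩
    have hbI : b ∈ I.erase a := Finset.mem_erase.mpr ⟨hba, hb⟩
    have h2 := congrArg (MvPowerSeries.coeff (Finsupp.single a (p + 1)))
      (X_sub_X_mul_divDiff hq ha hb hba.symm)
    rw [map_sub, ih _ (by rw [Finset.card_erase_of_mem hb]; omega) a haI,
      coeff_divDiff_inVar_eq_zero φ ⟨b, hbI⟩ (Finset.notMem_erase a I) (by simp), sub_mul, map_sub,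
      coeff_X_mul_of_pos a _ _ (by simp), coeff_X_mul_of_zero b _ _ (by simp [hba]), sub_zero,
      sub_zero] at h2
    have h3 : Finsupp.single a (p + 1) - Finsupp.single a 1 = Finsupp.single a p := by
      rw [← Finsupp.single_tsub]; simp
    rw [h3] at h2
    rw [h2, show p + 1 + r = p + (r + 1) by omega]

/-! ### The operators with Schur functions as eigenfunctions -/

open MvPowerSeries in
theorem iterate_pderiv_X_sub_X_mul {N : ℕ} {i j : Fin N} (hij : j ≠ i) (k : ℕ)
    (f : MvPowerSeries (Fin N) ℂ) :
    (pderiv ℂ i)^[k] ((X i - X j) * f) =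
      (X i - X j) * (pderiv ℂ i)^[k] f +
        (k : MvPowerSeries (Fin N) ℂ) * (pderiv ℂ i)^[k - 1] f := by
  induction k with
  | zero => simp
  | succ k ih =>
    rw [Function.iterate_succ_apply', ih, map_add, Derivation.leibniz, Derivation.leibniz, map_sub,
      pderiv_X_self, pderiv_X_of_ne hij, Derivation.map_natCast, smul_zero, add_zero,
      ← Function.iterate_succ_apply' (pderiv ℂ i)]
    simp only [smul_eq_mul, sub_zero, mul_one, Nat.add_sub_cancel]
    rcases Nat.eq_zero_or_pos k with rfl | hk
    · simp
    · rw [← Function.iterate_succ_apply' (pderiv ℂ i), show (k - 1).succ = k by omega]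
      push_cast; ring

open MvPowerSeries in
/-- Leibniz rule: each factor `X_i - X_j` is either kept or differentiated once, and the set `J` of
differentiated factors is distributed over the `k` derivatives in `k!/(k - |J|)!` ways. -/
theorem iterate_pderiv_prod_mul {N : ℕ} (i : Fin N) (S : Finset (Fin N)) : i ∉ S → ∀ (k : ℕ)
    (f : MvPowerSeries (Fin N) ℂ), (pderiv ℂ i)^[k] ((∏ j ∈ S, (X i - X j)) * f) =
      ∑ J ∈ S.powerset, (k.descFactorial J.card : MvPowerSeries (Fin N) ℂ) *
        ((∏ j ∈ S \ J, (X i - X j)) * (pderiv ℂ i)^[k - J.card] f) := by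
  induction S using Finset.induction_on with
  | empty => intro _ k f; simp
  | insert a S ha ih =>
    intro hi k f
    have hai : a ≠ i := fun h => hi (by simp [h])
    have hiS : i ∉ S := fun h => hi (by simp [h])
    rw [Finset.prod_insert ha, mul_comm (X i - X a), mul_assoc, ih hiS,
      Finset.sum_powerset_insert ha, ← Finset.sum_add_distrib]
    refine Finset.sum_congr rfl fun J hJ => ?_
    have hJS := Finset.mem_powerset.mp hJ
    have haJ : a ∉ J := fun h => ha (hJS h)
    have h1 : insert a S \ J = insert a (S \ J) := Finset.insert_sdiff_of_notMem S haJ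
    have h2 : insert a S \ insert a J = S \ J := by
      rw [Finset.insert_sdiff_insert, Finset.sdiff_insert_of_notMem ha]
    have h3 : a ∉ S \ J := fun h => ha (Finset.mem_sdiff.mp h).1
    rw [h1, h2, Finset.prod_insert h3, Finset.card_insert_of_notMem haJ,
      iterate_pderiv_X_sub_X_mul hai, Nat.descFactorial_succ, Nat.sub_sub]
    push_cast
    ring

open MvPowerSeries in
/-- The Vandermonde product is `∏_{j ≠ i} (X_i - X_j)` times a factor not involving `X_i`. -/
theorem exists_vand_eq {N : ℕ} (i : Fin N) : ∃ R : MvPowerSeries (Fin N) ℂ,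
    pderiv ℂ i R = 0 ∧
      vand (fun i : Fin N => (1 + X i : MvPowerSeries (Fin N) ℂ)) =
        R * ∏ j ∈ Finset.univ.erase i, (X i - X j) := by
  have hD : ∀ (s : Finset (Fin N)) (g : Fin N → MvPowerSeries (Fin N) ℂ),
      (∀ a ∈ s, pderiv ℂ i (g a) = 0) → pderiv ℂ i (∏ a ∈ s, g a) = 0 := by
    intro s g hg
    induction s using Finset.induction_on with
    | empty => simp
    | insert a s ha ih =>
      rw [Finset.prod_insert ha, Derivation.leibniz, hg a (by simp),
        ih fun b hb => hg b (Finset.mem_insert_of_mem hb)]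
      simp
  refine ⟨(∏ a ∈ Finset.Iio i, (-1)) * ∏ a ∈ Finset.univ.erase i, ∏ b ∈ (Finset.Ioi a).erase i,
    (X a - X b), ?_, ?_⟩
  · rw [Derivation.leibniz, hD, hD]
    · simp
    · intro a _; simp
    · intro a ha
      refine hD _ _ fun b hb => ?_
      rw [map_sub, pderiv_X_of_ne (Finset.ne_of_mem_erase ha),
        pderiv_X_of_ne (Finset.ne_of_mem_erase hb), sub_zero]
  · simp only [vand, add_sub_add_left_eq_sub]
    rw [← Finset.mul_prod_erase _ _ (Finset.mem_univ i)]
    have h1 : ∏ a ∈ Finset.univ.erase i, ∏ b ∈ Finset.Ioi a, (X a - X b) =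
        (∏ a ∈ Finset.Iio i, (X a - X i)) * ∏ a ∈ Finset.univ.erase i,
          ∏ b ∈ (Finset.Ioi a).erase i, (X a - X b : MvPowerSeries (Fin N) ℂ) := by
      have h2 : ∏ a ∈ Finset.Iio i, (X a - X i : MvPowerSeries (Fin N) ℂ) =
          ∏ a ∈ Finset.univ.erase i, if a < i then (X a - X i) else 1 := by
        rw [← Finset.prod_filter]
        refine Finset.prod_congr ?_ fun _ _ => rfl
        ext a
        simp only [Finset.mem_Iio, Finset.mem_filter, Finset.mem_erase, Finset.mem_univ]
        exact ⟨fun h => ⟨⟨h.ne, trivial⟩, h⟩, fun h => h.2⟩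
      rw [h2, ← Finset.prod_mul_distrib]
      refine Finset.prod_congr rfl fun a ha => ?_
      split_ifs with h
      · rw [Finset.mul_prod_erase _ (fun b => (X a - X b : MvPowerSeries (Fin N) ℂ))
          (Finset.mem_Ioi.mpr h)]
      · rw [one_mul, Finset.erase_eq_of_notMem (by simpa using h)]
    have h3 : ∏ j ∈ Finset.univ.erase i, (X i - X j : MvPowerSeries (Fin N) ℂ) =
        (∏ a ∈ Finset.Iio i, (X i - X a)) * ∏ j ∈ Finset.Ioi i, (X i - X j) := by
      rw [← Finset.prod_union]
      · refine Finset.prod_congr ?_ fun _ _ => rfl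
        ext a
        simp only [Finset.mem_erase, Finset.mem_univ, and_true, Finset.mem_union, Finset.mem_Iio,
          Finset.mem_Ioi, lt_or_lt_iff_ne]
      · rw [Finset.disjoint_left]
        intro a h1 h2
        exact lt_asymm (Finset.mem_Iio.mp h1) (Finset.mem_Ioi.mp h2)
    have h4 : ∏ a ∈ Finset.Iio i, (X a - X i : MvPowerSeries (Fin N) ℂ) =
        (∏ a ∈ Finset.Iio i, (-1)) * ∏ a ∈ Finset.Iio i, (X i - X a) := by
      rw [← Finset.prod_mul_distrib]
      exact Finset.prod_congr rfl fun a _ => by ring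
    rw [h1, h3, h4]; ring

open MvPowerSeries in
/-- The operator `h ↦ Δ⁻¹ ∑_i x_i^k ∂_i^k (Δ h)`, `Δ` the Vandermonde product and `x_i = 1 + X_i`,
on symmetric power series, written as a sum of divided differences. -/
def schurOp {N : ℕ} (k : ℕ) (h : MvPowerSeries (Fin N) ℂ) : MvPowerSeries (Fin N) ℂ :=
  ∑ r ∈ Finset.range (k + 1), (k.descFactorial r : ℂ) •
    ∑ I ∈ Finset.powersetCard (r + 1) Finset.univ,
      divDiff I fun i => (1 + X i) ^ k * (pderiv ℂ i)^[k - r] h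

theorem SymmSeries.equivariant_pderiv {N : ℕ} {h : MvPowerSeries (Fin N) ℂ} (hh : SymmSeries h)
    (k m : ℕ) : Equivariant fun i : Fin N =>
      (1 + MvPowerSeries.X i) ^ k * (MvPowerSeries.pderiv ℂ i)^[m] h :=
  (equivariant_one_add_X_pow N k).mul
    (Equivariant.iterate (A := fun i => MvPowerSeries.pderiv ℂ i) (fun _ hq => hq.pderiv) hh m)

open MvPowerSeries in
/-- The expression of `schurOp` by divided differences: in the Leibniz expansion of
`Δ⁻¹ ∂_i^k (Δ h)`, differentiating the factors `X_i - X_j` with `j ∈ J` leaves the term of index `i`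
of a divided difference over `J ∪ {i}`. -/
theorem vand_mul_schurOp {N : ℕ} (k : ℕ) {h : MvPowerSeries (Fin N) ℂ} (hh : SymmSeries h) :
    vand (fun i : Fin N => (1 + X i : MvPowerSeries (Fin N) ℂ)) * schurOp k h =
      ∑ i, (1 + X i) ^ k * (pderiv ℂ i)^[k]
        (vand (fun i : Fin N => (1 + X i : MvPowerSeries (Fin N) ℂ)) * h) := by
  set V := vand (fun i : Fin N => (1 + X i : MvPowerSeries (Fin N) ℂ)) with hV
  apply IsFractionRing.injective _ (FractionRing (MvPowerSeries (Fin N) ℂ))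
  set ι := algebraMap (MvPowerSeries (Fin N) ℂ) (FractionRing (MvPowerSeries (Fin N) ℂ)) with hι
  set G : Finset (Fin N) → Fin N → FractionRing (MvPowerSeries (Fin N) ℂ) := fun I i =>
    (k.descFactorial (I.card - 1) : FractionRing (MvPowerSeries (Fin N) ℂ)) *
      ((∏ j ∈ I.erase i, ι (X i - X j))⁻¹ *
        ι ((1 + X i) ^ k * (pderiv ℂ i)^[k - (I.card - 1)] h)) with hG
  have hleft : ι (schurOp k h) = ∑ I : Finset (Fin N), ∑ i ∈ I, G I i := by
    have h1 : ι (schurOp k h) = ∑ r ∈ Finset.range (k + 1),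
        ∑ I ∈ Finset.powersetCard (r + 1) Finset.univ, ∑ i ∈ I, G I i := by
      rw [schurOp, map_sum]
      refine Finset.sum_congr rfl fun r _ => ?_
      have h2 : ∀ x : MvPowerSeries (Fin N) ℂ, ι ((k.descFactorial r : ℂ) • x) =
          (k.descFactorial r : FractionRing (MvPowerSeries (Fin N) ℂ)) * ι x := by
        intro x
        rw [MvPowerSeries.smul_eq_C_mul, map_natCast, map_mul, map_natCast]
      rw [h2, map_sum, Finset.mul_sum]
      refine Finset.sum_congr rfl fun I hI => ?_
      have hcard := (Finset.mem_powersetCard.mp hI).2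
      rw [algebraMap_divDiff (Finset.card_pos.mp (by omega)) (hh.equivariant_pderiv k (k - r)),
        divDiffFrac, Finset.mul_sum]
      refine Finset.sum_congr rfl fun i _ => ?_
      simp only [hG, hcard, Nat.add_sub_cancel, hι]
    have h3 : ∀ r, ∑ I ∈ Finset.powersetCard (r + 1) Finset.univ, ∑ i ∈ I, G I i =
        ∑ I : Finset (Fin N), if I.card = r + 1 then ∑ i ∈ I, G I i else 0 := by
      intro r
      rw [← Finset.sum_filter]
      refine Finset.sum_congr ?_ fun _ _ => rfl
      ext I; simp [Finset.mem_powersetCard]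
    rw [h1]
    simp only [h3]
    rw [Finset.sum_comm]
    refine Finset.sum_congr rfl fun I _ => ?_
    rcases Nat.eq_zero_or_pos I.card with h0 | hpos
    · rw [Finset.card_eq_zero] at h0
      subst h0; simp
    · by_cases hle : I.card ≤ k + 1
      · rw [Finset.sum_eq_single (I.card - 1)]
        · rw [if_pos (by omega)]
        · intro r _ hr; rw [if_neg (by omega)]
        · intro hr; exact absurd (Finset.mem_range.mpr (by omega)) hr
      · rw [Finset.sum_eq_zero]
        · symm
          refine Finset.sum_eq_zero fun i _ => ?_
          simp only [hG]
          rw [Nat.descFactorial_of_lt (by omega)]; simp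
        · intro r hr; rw [if_neg (by have := Finset.mem_range.mp hr; omega)]
  have hright : ∀ i : Fin N, ι ((1 + X i) ^ k * (pderiv ℂ i)^[k] (V * h)) =
      ι V * ∑ J ∈ (Finset.univ.erase i).powerset, G (insert i J) i := by
    intro i
    obtain ⟨R, hR, hVR⟩ := exists_vand_eq i
    have h1 : ∀ (n : ℕ) (g : MvPowerSeries (Fin N) ℂ),
        (pderiv ℂ i)^[n] (R * g) = R * (pderiv ℂ i)^[n] g := by
      intro n g
      induction n with
      | zero => rfl
      | succ n ih =>
        rw [Function.iterate_succ_apply', ih, Derivation.leibniz, hR, smul_zero, add_zero,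
          smul_eq_mul, ← Function.iterate_succ_apply' (pderiv ℂ i)]
    rw [← hV] at hVR
    rw [hVR, mul_assoc, h1, iterate_pderiv_prod_mul i _ (Finset.notMem_erase i _), Finset.mul_sum,
      Finset.mul_sum, map_sum, Finset.mul_sum]
    refine Finset.sum_congr rfl fun J hJ => ?_
    have hJ' := Finset.mem_powerset.mp hJ
    have hiJ : i ∉ J := fun h => Finset.notMem_erase i _ (hJ' h)
    simp only [hG]
    rw [Finset.card_insert_of_notMem hiJ, Nat.add_sub_cancel, Finset.erase_insert hiJ,
      ← Finset.prod_sdiff hJ']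
    have h2 : (∏ j ∈ J, ι (X i - X j)) ≠ 0 := by
      refine Finset.prod_ne_zero_iff.mpr fun j hj => algebraMap_X_sub_X_ne_zero ?_
      rintro rfl; exact hiJ hj
    simp only [map_mul, map_prod, map_natCast]
    field_simp
  rw [map_mul, hleft, map_sum]
  simp only [hright]
  rw [← Finset.mul_sum]
  congr 1
  have h1 : ∀ I : Finset (Fin N), ∑ i ∈ I, G I i = ∑ i, if i ∈ I then G I i else 0 := by
    intro I; rw [← Finset.sum_filter]; simp
  simp only [h1]
  rw [Finset.sum_comm]
  refine Finset.sum_congr rfl fun i _ => ?_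
  rw [← Finset.sum_filter]
  symm
  refine Finset.sum_bij (fun J _ => insert i J) ?_ ?_ ?_ ?_
  · intro J _; simp
  · intro J hJ J' hJ' heq
    have h2 : i ∉ J := fun h => Finset.notMem_erase i _ (Finset.mem_powerset.mp hJ h)
    have h3 : i ∉ J' := fun h => Finset.notMem_erase i _ (Finset.mem_powerset.mp hJ' h)
    rw [← Finset.erase_insert h2, heq, Finset.erase_insert h3]
  · intro I hI
    refine ⟨I.erase i, ?_, Finset.insert_erase (by simpa using hI)⟩
    exact Finset.mem_powerset.mpr (Finset.erase_subset_erase _ (Finset.subset_univ _))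
  · intro J _; rfl

/-! ### Coefficient bounds which are uniform in the number of variables -/

theorem CoeffBound.nonneg {N n : ℕ} {B : ℝ} {P : MvPowerSeries (Fin N) ℂ} (h : CoeffBound n B P) :
    0 ≤ B := (norm_nonneg _).trans (h 0 (by simp))

theorem CoeffBound.mono {N n n' : ℕ} {B B' : ℝ} {P : MvPowerSeries (Fin N) ℂ}
    (h : CoeffBound n B P) (hn : n' ≤ n) (hB : B ≤ B') : CoeffBound n' B' P :=
  fun m hm => (h m (hm.trans hn)).trans hB

theorem CoeffBound.add {N n : ℕ} {B B' : ℝ} {P Q : MvPowerSeries (Fin N) ℂ}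
    (h : CoeffBound n B P) (h' : CoeffBound n B' Q) : CoeffBound n (B + B') (P + Q) :=
  fun m hm => by
    rw [map_add]; exact (norm_add_le _ _).trans (add_le_add (h m hm) (h' m hm))

theorem CoeffBound.smul {N n : ℕ} {B : ℝ} {P : MvPowerSeries (Fin N) ℂ}
    (h : CoeffBound n B P) (c : ℂ) : CoeffBound n (‖c‖ * B) (c • P) :=
  fun m hm => by
    rw [map_smul, smul_eq_mul, norm_mul]
    exact mul_le_mul_of_nonneg_left (h m hm) (norm_nonneg _)

theorem CoeffBound.sum {N n : ℕ} {ι : Type} {s : Finset ι} {B : ι → ℝ}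
    {P : ι → MvPowerSeries (Fin N) ℂ} (h : ∀ i ∈ s, CoeffBound n (B i) (P i)) :
    CoeffBound n (∑ i ∈ s, B i) (∑ i ∈ s, P i) :=
  fun m hm => by
    rw [map_sum]
    exact (norm_sum_le _ _).trans (Finset.sum_le_sum fun i hi => h i hi m hm)

theorem CoeffBound.pderiv {N n : ℕ} {B : ℝ} {P : MvPowerSeries (Fin N) ℂ}
    (h : CoeffBound (n + 1) B P) (i : Fin N) :
    CoeffBound n ((n + 1) * B) (MvPowerSeries.pderiv ℂ i P) := fun m hm => by
  rw [MvPowerSeries.coeff_pderiv, norm_mul, mul_comm]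
  have h1 : m i ≤ n := (Finsupp.le_degree i m).trans hm
  have h2 : ‖((m i : ℂ) + 1)‖ = (m i : ℝ) + 1 := by
    rw [← Nat.cast_add_one, Complex.norm_natCast]; push_cast; rfl
  rw [h2]
  have h3 := h (m + Finsupp.single i 1) (by
    rw [map_add, Finsupp.degree_single]; omega)
  gcongr

theorem card_antidiagonal_le {σ : Type} [DecidableEq σ] (m : σ →₀ ℕ) :
    (Finset.HasAntidiagonal.antidiagonal m).card ≤ 2 ^ m.degree := by
  have h1 : (Finset.HasAntidiagonal.antidiagonal m).card ≤ (Finset.Iic m).card := by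
    refine Finset.card_le_card_of_injOn Prod.fst ?_ ?_
    · intro p hp
      have hp' := Finset.HasAntidiagonal.mem_antidiagonal.mp (Finset.mem_coe.mp hp)
      exact Finset.mem_coe.mpr (Finset.mem_Iic.mpr (by rw [← hp']; exact le_self_add))
    · intro p hp p' hp' h
      have e1 := Finset.HasAntidiagonal.mem_antidiagonal.mp (Finset.mem_coe.mp hp)
      have e2 := Finset.HasAntidiagonal.mem_antidiagonal.mp (Finset.mem_coe.mp hp')
      refine Prod.ext h ?_
      rw [← e2, h] at e1
      exact add_left_cancel e1
  refine h1.trans ?_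
  rw [Finsupp.card_Iic, Finsupp.degree_apply, ← Finset.prod_pow_eq_pow_sum]
  refine Finset.prod_le_prod' fun i _ => ?_
  rw [Nat.card_Iic]
  exact Nat.lt_two_pow_self

theorem CoeffBound.mul {N n : ℕ} {B B' : ℝ} {P Q : MvPowerSeries (Fin N) ℂ}
    (h : CoeffBound n B P) (h' : CoeffBound n B' Q) : CoeffBound n (2 ^ n * (B * B')) (P * Q) :=
  fun m hm => by
    classical
    rw [MvPowerSeries.coeff_mul]
    have hB := h.nonneg
    have hB' := h'.nonneg
    calc _ ≤ ∑ p ∈ Finset.HasAntidiagonal.antidiagonal m, B * B' := by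
          refine (norm_sum_le _ _).trans (Finset.sum_le_sum fun p hp => ?_)
          have hd := congrArg Finsupp.degree (Finset.HasAntidiagonal.mem_antidiagonal.mp hp)
          rw [map_add] at hd
          rw [norm_mul]
          exact mul_le_mul (h _ (by omega)) (h' _ (by omega)) (norm_nonneg _) hB
      _ = (Finset.HasAntidiagonal.antidiagonal m).card * (B * B') := by simp
      _ ≤ 2 ^ n * (B * B') := by
          gcongr
          exact_mod_cast (card_antidiagonal_le m).trans (Nat.pow_le_pow_right (by norm_num) hm)

theorem coeffBound_inVar (φ : PowerSeries ℂ) (n : ℕ) :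
    ∃ B : ℝ, 0 ≤ B ∧ ∀ (N : ℕ) (i : Fin N), CoeffBound n B (inVar i φ) := by
  refine ⟨∑ j ∈ Finset.range (n + 1), ‖PowerSeries.coeff j φ‖,
    Finset.sum_nonneg fun _ _ => norm_nonneg _, fun N i m hm => ?_⟩
  by_cases h : ∃ j, j ≠ i ∧ m j ≠ 0
  · obtain ⟨j, hji, hj⟩ := h
    rw [coeff_inVar_eq_zero hji φ hj, norm_zero]
    exact Finset.sum_nonneg fun _ _ => norm_nonneg _
  · push Not at h
    have h1 : m = Finsupp.single i (m i) := by
      ext j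
      rw [Finsupp.single_apply]
      split_ifs with hij
      · rw [hij]
      · exact h j (Ne.symm hij)
    rw [h1, coeff_single_inVar]
    refine Finset.single_le_sum (f := fun j => ‖PowerSeries.coeff j φ‖)
      (fun _ _ => norm_nonneg _) (Finset.mem_range.mpr ?_)
    have := Finsupp.le_degree i m
    omega

/-- The families `a N` of power series, indexed by the variables, converge to the family `φ(X_i)`:
each coefficient converges, uniformly over the monomials of bounded degree. -/
def FamTendsto (a : ∀ N : ℕ, Fin N → MvPowerSeries (Fin N) ℂ) (φ : PowerSeries ℂ) : Prop :=
  ∀ n : ℕ, ∀ ε : ℝ, 0 < ε → ∀ᶠ N in atTop, ∀ i, CoeffBound n ε (a N i - inVar i φ)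

/-- The power series `h N` converge to the constant `c`, uniformly over the monomials of bounded
degree. -/
def ConstTendsto (h : ∀ N : ℕ, MvPowerSeries (Fin N) ℂ) (c : ℂ) : Prop :=
  ∀ n : ℕ, ∀ ε : ℝ, 0 < ε → ∀ᶠ N in atTop, CoeffBound n ε (h N - MvPowerSeries.C c)

theorem inVar_C {N : ℕ} (i : Fin N) (c : ℂ) : inVar i (PowerSeries.C c) = MvPowerSeries.C c :=
  MvPowerSeries.rename_C _ c

theorem ConstTendsto.famTendsto {h : ∀ N : ℕ, MvPowerSeries (Fin N) ℂ} {c : ℂ}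
    (hc : ConstTendsto h c) : FamTendsto (fun N _ => h N) (PowerSeries.C c) := by
  intro n ε hε
  filter_upwards [hc n ε hε] with N hN i
  rwa [inVar_C]

theorem FamTendsto.bounded {a : ∀ N : ℕ, Fin N → MvPowerSeries (Fin N) ℂ} {φ : PowerSeries ℂ}
    (ha : FamTendsto a φ) (n : ℕ) :
    ∃ B : ℝ, 0 ≤ B ∧ ∀ᶠ N in atTop, ∀ i, CoeffBound n B (a N i) := by
  obtain ⟨B, hB, hφ⟩ := coeffBound_inVar φ n
  refine ⟨1 + B, by positivity, ?_⟩
  filter_upwards [ha n 1 one_pos] with N hN i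
  simpa using (hN i).add (hφ N i)

theorem famTendsto_inVar (φ : PowerSeries ℂ) : FamTendsto (fun _ i => inVar i φ) φ := by
  intro n ε hε
  refine Eventually.of_forall fun N i m _ => ?_
  simp [hε.le]

theorem FamTendsto.add {a b : ∀ N : ℕ, Fin N → MvPowerSeries (Fin N) ℂ} {φ ψ : PowerSeries ℂ}
    (ha : FamTendsto a φ) (hb : FamTendsto b ψ) :
    FamTendsto (fun N i => a N i + b N i) (φ + ψ) := by
  intro n ε hε
  filter_upwards [ha n (ε / 2) (by positivity), hb n (ε / 2) (by positivity)] with N h1 h2 i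
  have := (h1 i).add (h2 i)
  rw [add_halves] at this
  convert this using 1
  rw [map_add]; ring

theorem FamTendsto.mul {a b : ∀ N : ℕ, Fin N → MvPowerSeries (Fin N) ℂ} {φ ψ : PowerSeries ℂ}
    (ha : FamTendsto a φ) (hb : FamTendsto b ψ) :
    FamTendsto (fun N i => a N i * b N i) (φ * ψ) := by
  intro n ε hε
  obtain ⟨B, hB, hbB⟩ := hb.bounded n
  obtain ⟨A, hA, hφ⟩ := coeffBound_inVar φ n
  have hK : (0 : ℝ) < 2 ^ n * (A + B + 1) := by positivity
  filter_upwards [ha n (ε / (2 ^ n * (A + B + 1))) (by positivity),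
    hb n (ε / (2 ^ n * (A + B + 1))) (by positivity), hbB] with N h1 h2 h3 i
  have h4 := ((h1 i).mul (h3 i)).add ((hφ N i).mul (h2 i))
  have h5 : a N i * b N i - inVar i (φ * ψ) =
      (a N i - inVar i φ) * b N i + inVar i φ * (b N i - inVar i ψ) := by
    rw [map_mul]; ring
  rw [h5]
  refine h4.mono le_rfl ?_
  have h6 : 2 ^ n * (ε / (2 ^ n * (A + B + 1)) * B) + 2 ^ n * (A * (ε / (2 ^ n * (A + B + 1)))) =
      ε * ((A + B) / (A + B + 1)) := by field_simp; ring
  rw [h6]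
  refine mul_le_of_le_one_right hε.le ?_
  rw [div_le_one (by positivity)]; linarith

theorem famTendsto_inv_smul_pderiv {a : ∀ N : ℕ, Fin N → MvPowerSeries (Fin N) ℂ}
    {φ : PowerSeries ℂ} (ha : FamTendsto a φ) :
    FamTendsto (fun N i => ((N : ℂ)⁻¹) • MvPowerSeries.pderiv ℂ i (a N i)) 0 := by
  intro n ε hε
  obtain ⟨B, hB, haB⟩ := ha.bounded (n + 1)
  have h1 : Tendsto (fun N : ℕ => ((n : ℝ) + 1) * B / N) atTop (𝓝 0) :=
    tendsto_const_div_atTop_nhds_zero_nat _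
  filter_upwards [haB, h1.eventually (gt_mem_nhds hε)] with N h2 h3 i
  have h4 := ((h2 i).pderiv i).smul ((N : ℂ)⁻¹)
  rw [map_zero, sub_zero]
  refine h4.mono le_rfl ?_
  rw [norm_inv, Complex.norm_natCast, inv_mul_eq_div]
  exact h3.le

/-! ### Averages of divided differences -/

theorem tendsto_choose_div_pow (r : ℕ) :
    Tendsto (fun N : ℕ => ((N.choose r : ℂ)) / (N : ℂ) ^ r) atTop (𝓝 (1 / (r.factorial : ℂ))) := by
  have h1 := isEquivalent_choose r
  have h2 : Tendsto (fun N : ℕ => ((N.choose r : ℝ)) / (N : ℝ) ^ r) atTop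
      (𝓝 (1 / (r.factorial : ℝ))) := by
    have h3 : ∀ᶠ n : ℕ in atTop, ((n : ℝ) ^ r / (r.factorial : ℝ)) ≠ 0 := by
      filter_upwards [eventually_gt_atTop 0] with n hn
      positivity
    have h4 := (Asymptotics.isEquivalent_iff_tendsto_one h3).mp h1
    have h5 := h4.mul_const (1 / (r.factorial : ℝ))
    rw [one_mul] at h5
    refine h5.congr' ?_
    filter_upwards [eventually_gt_atTop 0] with n hn
    have : (n : ℝ) ≠ 0 := by positivity
    simp only [Pi.div_apply]
    field_simp
  have h3 := (Complex.continuous_ofReal.tendsto _).comp h2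
  refine (h3.congr fun N => ?_).trans (le_of_eq ?_)
  · simp
  · simp

theorem card_filter_mem_powersetCard_le {N : ℕ} (i : Fin N) (r : ℕ) :
    ((Finset.powersetCard (r + 1) (Finset.univ : Finset (Fin N))).filter (i ∈ ·)).card ≤ N ^ r := by
  have h1 : ((Finset.powersetCard (r + 1) (Finset.univ : Finset (Fin N))).filter (i ∈ ·)).card ≤
      (Finset.powersetCard r (Finset.univ : Finset (Fin N))).card := by
    refine Finset.card_le_card_of_injOn (fun I => I.erase i) ?_ ?_
    · intro I hI
      have hI' := Finset.mem_filter.mp (Finset.mem_coe.mp hI)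
      refine Finset.mem_coe.mpr (Finset.mem_powersetCard.mpr ⟨Finset.subset_univ _, ?_⟩)
      rw [Finset.card_erase_of_mem hI'.2, (Finset.mem_powersetCard.mp hI'.1).2]; rfl
    · intro I hI I' hI' h
      have hI1 := (Finset.mem_filter.mp (Finset.mem_coe.mp hI)).2
      have hI2 := (Finset.mem_filter.mp (Finset.mem_coe.mp hI')).2
      rw [← Finset.insert_erase hI1, ← Finset.insert_erase hI2]
      exact congrArg (insert i) h
  refine h1.trans ?_
  rw [Finset.card_powersetCard, Finset.card_univ, Fintype.card_fin]
  exact Nat.choose_le_pow N r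

/-- The average of divided differences over all sets of `r + 1` variables: for functions of one
variable only the constant term survives, because a fixed variable belongs to few of the sets. -/
theorem constTendsto_avg_divDiff_inVar (φ : PowerSeries ℂ) (r : ℕ) :
    ConstTendsto (fun N => ((1 : ℂ) / (N : ℂ) ^ (r + 1)) •
      ∑ I ∈ Finset.powersetCard (r + 1) Finset.univ, divDiff I fun i : Fin N => inVar i φ)
      (PowerSeries.coeff r φ / ((r + 1).factorial : ℂ)) := by
  intro n ε hε
  obtain ⟨C, hC0, hC⟩ := divDiff_bound r n
  obtain ⟨B, hB0, hB⟩ := coeffBound_inVar φ (n + r)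
  have h1 : Tendsto (fun N : ℕ => C * B / N) atTop (𝓝 0) :=
    tendsto_const_div_atTop_nhds_zero_nat _
  have h2 := ((tendsto_choose_div_pow (r + 1)).mul_const (PowerSeries.coeff r φ))
  rw [Metric.tendsto_nhds] at h2
  filter_upwards [h1.eventually (gt_mem_nhds hε), h2 ε hε, eventually_gt_atTop 0]
    with N h3 h4 hN m hm
  have hN' : (0 : ℝ) < N := by exact_mod_cast hN
  rw [map_sub, map_smul, map_sum, smul_eq_mul, MvPowerSeries.coeff_C]
  rcases eq_or_ne m 0 with rfl | hm0
  · rw [if_pos rfl]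
    have h5 : ∑ I ∈ Finset.powersetCard (r + 1) (Finset.univ : Finset (Fin N)),
        MvPowerSeries.coeff 0 (divDiff I fun i : Fin N => inVar i φ) =
        (N.choose (r + 1) : ℂ) * PowerSeries.coeff r φ := by
      rw [Finset.sum_congr rfl (g := fun _ => PowerSeries.coeff r φ)]
      · simp
      · intro I hI
        have hcard := (Finset.mem_powersetCard.mp hI).2
        obtain ⟨a, ha⟩ := Finset.card_pos.mp (by omega : 0 < I.card)
        have := coeff_single_divDiff_inVar φ r I hcard a ha 0
        rwa [Finsupp.single_zero, zero_add] at this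
    rw [h5]
    rw [dist_eq_norm] at h4
    refine le_trans (le_of_eq ?_) h4.le
    congr 1; ring
  · rw [if_neg hm0, sub_zero]
    obtain ⟨i, hi⟩ := Finsupp.ne_iff.mp hm0
    have hi' : m i ≠ 0 := hi
    have h5 : ‖∑ I ∈ Finset.powersetCard (r + 1) (Finset.univ : Finset (Fin N)),
        MvPowerSeries.coeff m (divDiff I fun i : Fin N => inVar i φ)‖ ≤ (N : ℝ) ^ r * (C * B) := by
      calc _ ≤ ∑ I ∈ Finset.powersetCard (r + 1) (Finset.univ : Finset (Fin N)),
            if i ∈ I then C * B else 0 := by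
            refine (norm_sum_le _ _).trans (Finset.sum_le_sum fun I hI => ?_)
            have hcard := (Finset.mem_powersetCard.mp hI).2
            split_ifs with hiI
            · exact hC N _ (equivariant_inVar N φ) I hcard B (fun i => hB N i) m hm
            · rw [coeff_divDiff_inVar_eq_zero φ (Finset.card_pos.mp (by omega)) hiI hi', norm_zero]
        _ = (((Finset.powersetCard (r + 1) (Finset.univ : Finset (Fin N))).filter (i ∈ ·)).card
              : ℝ) * (C * B) := by
            rw [← Finset.sum_filter, Finset.sum_const, nsmul_eq_mul]
        _ ≤ (N : ℝ) ^ r * (C * B) := by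
            gcongr
            exact_mod_cast card_filter_mem_powersetCard_le i r
    rw [norm_mul, norm_div, norm_one, norm_pow, Complex.norm_natCast]
    calc _ ≤ 1 / (N : ℝ) ^ (r + 1) * ((N : ℝ) ^ r * (C * B)) := by gcongr
      _ = C * B / N := by rw [pow_succ]; field_simp
      _ ≤ ε := h3.le

/-- Divided differences are bounded uniformly in `N`, so the averages depend continuously on the
family and its limit may replace it. -/
theorem constTendsto_avg_divDiff {q : ∀ N : ℕ, Fin N → MvPowerSeries (Fin N) ℂ}
    {φ : PowerSeries ℂ} (hq : FamTendsto q φ) (he : ∀ᶠ N in atTop, Equivariant (q N)) (r : ℕ) :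
    ConstTendsto (fun N => ((1 : ℂ) / (N : ℂ) ^ (r + 1)) •
      ∑ I ∈ Finset.powersetCard (r + 1) Finset.univ, divDiff I (q N))
      (PowerSeries.coeff r φ / ((r + 1).factorial : ℂ)) := by
  intro n ε hε
  obtain ⟨C, hC0, hC⟩ := divDiff_bound r n
  filter_upwards [constTendsto_avg_divDiff_inVar φ r n (ε / 2) (by positivity),
    hq (n + r) (ε / 2 / (C + 1)) (by positivity), he, eventually_gt_atTop 0] with N h1 h2 h3 hN
  have hN' : (0 : ℝ) < N := by exact_mod_cast hN
  set S := Finset.powersetCard (r + 1) (Finset.univ : Finset (Fin N)) with hS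
  have hd : Equivariant (fun i : Fin N => q N i - inVar i φ) := fun σ i => by
    rw [map_sub, h3, equivariant_inVar N φ]
  have h4 : CoeffBound n (∑ I ∈ S, C * (ε / 2 / (C + 1)))
      (∑ I ∈ S, divDiff I fun i : Fin N => q N i - inVar i φ) :=
    CoeffBound.sum fun I hI => hC N _ hd I (Finset.mem_powersetCard.mp hI).2 _ h2
  have h5 := (h4.smul ((1 : ℂ) / (N : ℂ) ^ (r + 1))).add h1
  have h6 : ∑ I ∈ S, divDiff I (q N) = (∑ I ∈ S, divDiff I fun i : Fin N => q N i - inVar i φ) +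
      ∑ I ∈ S, divDiff I fun i : Fin N => inVar i φ := by
    rw [← Finset.sum_add_distrib]
    refine Finset.sum_congr rfl fun I hI => ?_
    rw [divDiff_sub (Finset.card_pos.mp (by
      have := (Finset.mem_powersetCard.mp hI).2; omega)) h3 (equivariant_inVar N φ)]
    ring
  rw [h6, smul_add, add_sub_assoc]
  refine h5.mono le_rfl ?_
  have h7 : ‖(1 : ℂ) / (N : ℂ) ^ (r + 1)‖ * ∑ I ∈ S, C * (ε / 2 / (C + 1)) ≤ ε / 2 := by
    rw [Finset.sum_const, nsmul_eq_mul, hS, Finset.card_powersetCard, Finset.card_univ,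
      Fintype.card_fin, norm_div, norm_one, norm_pow, Complex.norm_natCast]
    have h8 : ((N.choose (r + 1) : ℕ) : ℝ) ≤ (N : ℝ) ^ (r + 1) := by
      exact_mod_cast Nat.choose_le_pow N (r + 1)
    calc _ ≤ 1 / (N : ℝ) ^ (r + 1) * ((N : ℝ) ^ (r + 1) * (C * (ε / 2 / (C + 1)))) := by gcongr
      _ = ε / 2 * (C / (C + 1)) := by field_simp
      _ ≤ ε / 2 := by
          refine mul_le_of_le_one_right (by positivity) ?_
          rw [div_le_one (by positivity)]; linarith
  linarith

/-! ### The limit of the rescaled operators -/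

/-- The operator `h ↦ N⁻¹ ∂_i h + γ_i h`, which is `N⁻¹ P⁻¹ ∂_i P` acting on `h` when `N γ_i` is the
logarithmic derivative of `P`. -/
def logOp {N : ℕ} (γ : Fin N → MvPowerSeries (Fin N) ℂ) (i : Fin N)
    (h : MvPowerSeries (Fin N) ℂ) : MvPowerSeries (Fin N) ℂ :=
  (N : ℂ)⁻¹ • MvPowerSeries.pderiv ℂ i h + γ i * h

/-- The operator `h ↦ N^{-k-1} P⁻¹ schurOp k (P h)`, expressed through the logarithmic derivatives
`N γ_i` of `P`. -/
def scaledOp {N : ℕ} (k : ℕ) (γ : Fin N → MvPowerSeries (Fin N) ℂ)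
    (h : MvPowerSeries (Fin N) ℂ) : MvPowerSeries (Fin N) ℂ :=
  ∑ r ∈ Finset.range (k + 1), (k.descFactorial r : ℂ) • (((1 : ℂ) / (N : ℂ) ^ (r + 1)) •
    ∑ I ∈ Finset.powersetCard (r + 1) Finset.univ,
      divDiff I fun i => (1 + MvPowerSeries.X i) ^ k * (logOp γ i)^[k - r] h)

theorem Equivariant.logOp {N : ℕ} {γ : Fin N → MvPowerSeries (Fin N) ℂ} (hγ : Equivariant γ)
    {q : Fin N → MvPowerSeries (Fin N) ℂ} (hq : Equivariant q) :
    Equivariant (fun i => logOp γ i (q i)) :=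
  (hq.pderiv.smul _).add (hγ.mul hq)

theorem equivariant_iterate_logOp {N : ℕ} {γ : Fin N → MvPowerSeries (Fin N) ℂ}
    (hγ : Equivariant γ) {h : MvPowerSeries (Fin N) ℂ} (hh : SymmSeries h) (k m : ℕ) :
    Equivariant fun i : Fin N => (1 + MvPowerSeries.X i) ^ k * (logOp γ i)^[m] h :=
  (equivariant_one_add_X_pow N k).mul (Equivariant.iterate (fun _ hq => hγ.logOp hq) hh m)

/-- Conjugation by `P` turns `∂_i` into `N` times `logOp γ i`. -/
theorem iterate_pderiv_mul_eq {N : ℕ} (hN : N ≠ 0) {γ : Fin N → MvPowerSeries (Fin N) ℂ}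
    {P : MvPowerSeries (Fin N) ℂ} {i : Fin N}
    (hP : MvPowerSeries.pderiv ℂ i P = (N : ℂ) • (γ i * P)) (h : MvPowerSeries (Fin N) ℂ) (m : ℕ) :
    (MvPowerSeries.pderiv ℂ i)^[m] (P * h) = (N : ℂ) ^ m • (P * (logOp γ i)^[m] h) := by
  induction m with
  | zero => simp
  | succ m ih =>
    have hN' : (N : ℂ) ≠ 0 := Nat.cast_ne_zero.mpr hN
    rw [Function.iterate_succ_apply', ih, Derivation.map_smul, Derivation.leibniz, hP,
      Function.iterate_succ_apply' (logOp γ i)]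
    set g := (logOp γ i)^[m] h
    rw [logOp, pow_succ, mul_smul]
    congr 1
    rw [mul_add, smul_add, mul_smul_comm, smul_smul, mul_inv_cancel₀ hN', one_smul,
      smul_eq_mul, smul_eq_mul, mul_smul_comm]
    congr 2
    ring

/-- Since `P` is symmetric, it comes out of the divided differences, so that conjugation by `P` acts
on each derivative separately. -/
theorem schurOp_mul_eq {N : ℕ} (hN : N ≠ 0) {γ : Fin N → MvPowerSeries (Fin N) ℂ}
    (hγ : Equivariant γ) {P : MvPowerSeries (Fin N) ℂ} (hPs : SymmSeries P)
    (hP : ∀ i, MvPowerSeries.pderiv ℂ i P = (N : ℂ) • (γ i * P)) {h : MvPowerSeries (Fin N) ℂ}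
    (hh : SymmSeries h) (k : ℕ) :
    schurOp k (P * h) = (N : ℂ) ^ (k + 1) • (P * scaledOp k γ h) := by
  have hN' : (N : ℂ) ≠ 0 := Nat.cast_ne_zero.mpr hN
  rw [schurOp, scaledOp, Finset.mul_sum, Finset.smul_sum]
  refine Finset.sum_congr rfl fun r hr => ?_
  have hr' : r ≤ k := by have := Finset.mem_range.mp hr; omega
  rw [mul_smul_comm, smul_comm]
  congr 1
  rw [mul_smul_comm, smul_smul, Finset.mul_sum, Finset.smul_sum]
  refine Finset.sum_congr rfl fun I hI => ?_
  have hI' : I.Nonempty := Finset.card_pos.mp (by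
    have := (Finset.mem_powersetCard.mp hI).2; omega)
  have he := equivariant_iterate_logOp hγ hh k (k - r)
  rw [← divDiff_mul_left hI' he hPs]
  have h1 : ∀ c : ℂ, SymmSeries (MvPowerSeries.C (σ := Fin N) c) := fun c σ =>
    MvPowerSeries.rename_C _ c
  rw [MvPowerSeries.smul_eq_C_mul, ← divDiff_mul_left hI' (hPs.equivariant.mul he) (h1 _)]
  congr 1
  ext1 i
  rw [iterate_pderiv_mul_eq hN (hP i), ← MvPowerSeries.smul_eq_C_mul, mul_smul_comm]
  have h2 : (N : ℂ) ^ (k + 1) * (1 / (N : ℂ) ^ (r + 1)) = (N : ℂ) ^ (k - r) := by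
    rw [mul_one_div, div_eq_iff (pow_ne_zero _ hN'), ← pow_add]
    congr 1; omega
  rw [h2]
  congr 1; ring

/-- The limiting moment `∑_r k!/(k-r)! · 1/(r+1)! · [X^r] (1+X)^k ψ^{k-r}`. -/
def limitMoment (ψ : PowerSeries ℂ) (k : ℕ) : ℂ :=
  ∑ r ∈ Finset.range (k + 1), (k.descFactorial r : ℂ) *
    (PowerSeries.coeff r ((1 + PowerSeries.X) ^ k * ψ ^ (k - r)) / ((r + 1).factorial : ℂ))

theorem ConstTendsto.sum {ι : Type} (s : Finset ι) {h : ι → ∀ N : ℕ, MvPowerSeries (Fin N) ℂ}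
    {c : ι → ℂ} (hc : ∀ i ∈ s, ConstTendsto (h i) (c i)) :
    ConstTendsto (fun N => ∑ i ∈ s, h i N) (∑ i ∈ s, c i) := by
  intro n ε hε
  have h1 : ∀ i ∈ s, ∀ᶠ N in atTop, CoeffBound n (ε / (s.card + 1))
      (h i N - MvPowerSeries.C (c i)) := fun i hi => hc i hi n _ (by positivity)
  filter_upwards [(Filter.eventually_all_finset s).mpr h1] with N hN
  rw [map_sum, ← Finset.sum_sub_distrib]
  refine (CoeffBound.sum hN).mono le_rfl ?_
  rw [Finset.sum_const, nsmul_eq_mul, mul_div_assoc', div_le_iff₀ (by positivity)]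
  nlinarith

theorem ConstTendsto.smul {h : ∀ N : ℕ, MvPowerSeries (Fin N) ℂ} {c : ℂ}
    (hc : ConstTendsto h c) (z : ℂ) : ConstTendsto (fun N => z • h N) (z * c) := by
  intro n ε hε
  filter_upwards [hc n (ε / (‖z‖ + 1)) (by positivity)] with N hN
  have h1 := hN.smul z
  rw [smul_sub] at h1
  rw [map_mul, ← MvPowerSeries.smul_eq_C_mul]
  refine h1.mono le_rfl ?_
  rw [mul_div_assoc', div_le_iff₀ (by positivity)]
  nlinarith [norm_nonneg z]

theorem FamTendsto.iterate_logOp {γ : ∀ N : ℕ, Fin N → MvPowerSeries (Fin N) ℂ}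
    {ψ : PowerSeries ℂ} (hγ : FamTendsto γ ψ) {h : ∀ N : ℕ, MvPowerSeries (Fin N) ℂ} {c : ℂ}
    (hc : ConstTendsto h c) (m : ℕ) :
    FamTendsto (fun N i => (logOp (γ N) i)^[m] (h N)) (ψ ^ m * PowerSeries.C c) := by
  induction m with
  | zero => simpa using hc.famTendsto
  | succ m ih =>
    simp only [Function.iterate_succ_apply']
    have h1 := (famTendsto_inv_smul_pderiv ih).add (hγ.mul ih)
    rw [zero_add, ← mul_assoc, ← pow_succ'] at h1
    exact h1

theorem inVar_X {N : ℕ} (i : Fin N) : inVar i PowerSeries.X = MvPowerSeries.X i :=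
  MvPowerSeries.rename_X _ _

/-- The key limit: the rescaled operators act on asymptotically constant symmetric power series as
multiplication by the limiting moment. -/
theorem constTendsto_scaledOp {γ : ∀ N : ℕ, Fin N → MvPowerSeries (Fin N) ℂ}
    {ψ : PowerSeries ℂ} (hγ : FamTendsto γ ψ) (he : ∀ᶠ N in atTop, Equivariant (γ N))
    {h : ∀ N : ℕ, MvPowerSeries (Fin N) ℂ} {c : ℂ} (hc : ConstTendsto h c)
    (hs : ∀ᶠ N in atTop, SymmSeries (h N)) (k : ℕ) :
    ConstTendsto (fun N => scaledOp k (γ N) (h N)) (limitMoment ψ k * c) := by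
  have h1 : limitMoment ψ k * c = ∑ r ∈ Finset.range (k + 1), (k.descFactorial r : ℂ) *
      (PowerSeries.coeff r ((1 + PowerSeries.X) ^ k * (ψ ^ (k - r) * PowerSeries.C c)) /
        ((r + 1).factorial : ℂ)) := by
    rw [limitMoment, Finset.sum_mul]
    refine Finset.sum_congr rfl fun r _ => ?_
    rw [← mul_assoc, mul_comm _ (PowerSeries.C c), PowerSeries.coeff_C_mul]
    ring
  rw [h1]
  refine ConstTendsto.sum _ fun r _ => ConstTendsto.smul ?_ _
  refine constTendsto_avg_divDiff (q := fun N i => (1 + MvPowerSeries.X i) ^ k *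
    (logOp (γ N) i)^[k - r] (h N)) ?_ ?_ r
  · refine FamTendsto.mul ?_ (hγ.iterate_logOp hc (k - r))
    have h2 := famTendsto_inVar ((1 + PowerSeries.X) ^ k)
    simpa [map_pow, map_add, inVar_X] using h2
  · filter_upwards [he, hs] with N h2 h3
    exact equivariant_iterate_logOp h2 h3 k (k - r)

/-! ### Schur functions as power series at the point `1^N` -/

theorem Signature.strictAnti_coord {N : ℕ} (lam : Signature N) : StrictAnti lam.coord := by
  intro i j hij
  have h1 := lam.2 hij.le
  have h2 : ((i : ℕ) : ℤ) < ((j : ℕ) : ℤ) := by exact_mod_cast hij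
  simp only [Signature.coord]
  linarith

/-- The exponents of the Laurent monomials of the Schur function `s_λ`, with multiplicity. -/
def Signature.exponents {N : ℕ} (lam : Signature N) : Multiset (Fin N → ℤ) :=
  (exists_schur_exponents N lam.coord lam.strictAnti_coord).choose

theorem Signature.exponents_ne_zero {N : ℕ} (lam : Signature N) : lam.exponents ≠ 0 :=
  (exists_schur_exponents N lam.coord lam.strictAnti_coord).choose_spec.1

theorem Signature.det_eq {N : ℕ} (lam : Signature N) {R : Type} [CommRing R] (x : Fin N → Rˣ) :
    Matrix.det (Matrix.of fun i j : Fin N => ((x i ^ lam.coord j : Rˣ) : R)) =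
      vand (fun i => (x i : R)) *
        (lam.exponents.map fun m => ((∏ i, x i ^ m i : Rˣ) : R)).sum :=
  (exists_schur_exponents N lam.coord lam.strictAnti_coord).choose_spec.2 R x

/-- The unit `1 + X_i`, which is the coordinate `x_i` expanded around the point `1^N`. -/
def oneAddX {N : ℕ} (i : Fin N) : (MvPowerSeries (Fin N) ℂ)ˣ :=
  (MvPowerSeries.isUnit_iff_constantCoeff (φ := (1 + MvPowerSeries.X i)).mpr (by simp)).unit

@[simp] theorem val_oneAddX {N : ℕ} (i : Fin N) :
    (oneAddX i : MvPowerSeries (Fin N) ℂ) = 1 + MvPowerSeries.X i := rfl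

/-- The Taylor series at `1^N` of the normalised Schur function `s_λ / s_λ(1^N)`. -/
def Signature.series {N : ℕ} (lam : Signature N) : MvPowerSeries (Fin N) ℂ :=
  ((lam.exponents.card : ℂ)⁻¹) •
    (lam.exponents.map fun m =>
      ((∏ i, oneAddX i ^ m i : (MvPowerSeries (Fin N) ℂ)ˣ) : MvPowerSeries (Fin N) ℂ)).sum

/-- The alternant `det [x_i ^ (λ_j + N - j)]` expanded around `1^N`. -/
def Signature.altSeries {N : ℕ} (lam : Signature N) : MvPowerSeries (Fin N) ℂ :=
  Matrix.det (Matrix.of fun i j : Fin N =>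
    ((oneAddX i ^ lam.coord j : (MvPowerSeries (Fin N) ℂ)ˣ) : MvPowerSeries (Fin N) ℂ))

/-- The Vandermonde product as a power series. -/
def vandSeries (N : ℕ) : MvPowerSeries (Fin N) ℂ :=
  vand (fun i : Fin N => (1 + MvPowerSeries.X i : MvPowerSeries (Fin N) ℂ))

theorem vandSeries_ne_zero (N : ℕ) : vandSeries N ≠ 0 := by
  rw [vandSeries, vand, Finset.prod_ne_zero_iff]
  intro i _
  rw [Finset.prod_ne_zero_iff]
  intro j hj
  rw [add_sub_add_left_eq_sub]
  exact X_sub_X_ne_zero (Finset.mem_Ioi.mp hj).ne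

theorem Signature.vandSeries_mul_series {N : ℕ} (lam : Signature N) :
    vandSeries N * lam.series = ((lam.exponents.card : ℂ)⁻¹) • lam.altSeries := by
  rw [Signature.series, mul_smul_comm, Signature.altSeries, lam.det_eq]
  rfl

theorem constantCoeff_oneAddX_prod {N : ℕ} (m : Fin N → ℤ) : MvPowerSeries.constantCoeff
    ((∏ i, oneAddX i ^ m i : (MvPowerSeries (Fin N) ℂ)ˣ) : MvPowerSeries (Fin N) ℂ) = 1 := by
  have h : Units.map (MvPowerSeries.constantCoeff (σ := Fin N) (R := ℂ)).toMonoidHom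
      (∏ i, oneAddX i ^ m i) = 1 := by
    rw [map_prod]
    refine Finset.prod_eq_one fun i _ => ?_
    rw [map_zpow]
    have : Units.map (MvPowerSeries.constantCoeff (σ := Fin N) (R := ℂ)).toMonoidHom
        (oneAddX i) = 1 := by
      ext; simp
    rw [this, one_zpow]
  exact congrArg Units.val h

theorem Signature.constantCoeff_series {N : ℕ} (lam : Signature N) :
    MvPowerSeries.constantCoeff lam.series = 1 := by
  have h0 : (lam.exponents.card : ℂ) ≠ 0 := by
    rw [Nat.cast_ne_zero, Ne, Multiset.card_eq_zero]
    exact lam.exponents_ne_zero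
  rw [Signature.series, MvPowerSeries.smul_eq_C_mul, map_mul, MvPowerSeries.constantCoeff_C,
    map_multiset_sum, Multiset.map_map]
  simp only [Function.comp_def, constantCoeff_oneAddX_prod]
  simp [h0]

theorem vand_comp_perm {R : Type} [CommRing R] {N : ℕ} (x : Fin N → R)
    (σ : Equiv.Perm (Fin N)) :
    vand (fun i => x (σ i)) = (Equiv.Perm.sign σ : ℤ) * vand x := by
  have h : ∀ y : Fin N → R, vand y = (Matrix.vandermonde fun i => - y i).det := by
    intro y
    rw [Matrix.det_vandermonde, vand]
    exact Finset.prod_congr rfl fun i _ => Finset.prod_congr rfl fun j _ => by ring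
  rw [h, h, ← Matrix.det_permute]
  rfl

theorem map_oneAddX {N : ℕ} (σ : Equiv.Perm (Fin N)) (i : Fin N) (n : ℤ) :
    MvPowerSeries.rename σ
      ((oneAddX i ^ n : (MvPowerSeries (Fin N) ℂ)ˣ) : MvPowerSeries (Fin N) ℂ) =
    ((oneAddX (σ i) ^ n : (MvPowerSeries (Fin N) ℂ)ˣ) : MvPowerSeries (Fin N) ℂ) := by
  have h : Units.map (MvPowerSeries.rename (R := ℂ) σ).toRingHom.toMonoidHom (oneAddX i) =
      oneAddX (σ i) := by
    ext1
    simp [MvPowerSeries.rename_X]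
  have h2 := congrArg (fun u => ((u ^ n : (MvPowerSeries (Fin N) ℂ)ˣ) :
    MvPowerSeries (Fin N) ℂ)) h
  simp only [← map_zpow] at h2
  exact h2

theorem rename_vandSeries {N : ℕ} (σ : Equiv.Perm (Fin N)) :
    MvPowerSeries.rename σ (vandSeries N) = (Equiv.Perm.sign σ : ℤ) * vandSeries N := by
  rw [vandSeries, ← vand_comp_perm, vand, vand]
  simp [MvPowerSeries.rename_X]

theorem Signature.symmSeries_series {N : ℕ} (lam : Signature N) : SymmSeries lam.series := by
  intro σ
  have h1 := congrArg (MvPowerSeries.rename (R := ℂ) σ) lam.vandSeries_mul_series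
  have h2 : MvPowerSeries.rename σ lam.altSeries = (Equiv.Perm.sign σ : ℤ) * lam.altSeries := by
    rw [Signature.altSeries, ← Matrix.det_permute, AlgHom.map_det]
    exact congrArg Matrix.det (Matrix.ext fun i j => map_oneAddX σ i _)
  rw [map_mul, map_smul, h2, rename_vandSeries, ← mul_smul_comm, ← lam.vandSeries_mul_series,
    ← mul_assoc] at h1
  refine mul_left_cancel₀ ?_ h1
  refine mul_ne_zero ?_ (vandSeries_ne_zero N)
  rcases Int.units_eq_one_or (Equiv.Perm.sign σ) with h | h <;> simp [h]

open MvPowerSeries in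
theorem pderiv_oneAddX_zpow_mul {N : ℕ} (i : Fin N) (n : ℤ) :
    (1 + X i) * pderiv ℂ i ((oneAddX i ^ n : (MvPowerSeries (Fin N) ℂ)ˣ) :
      MvPowerSeries (Fin N) ℂ) = (n : ℂ) • ((oneAddX i ^ n : (MvPowerSeries (Fin N) ℂ)ˣ) :
        MvPowerSeries (Fin N) ℂ) := by
  have hD1 : pderiv ℂ i (1 + X i : MvPowerSeries (Fin N) ℂ) = 1 := by
    rw [map_add, pderiv_one, pderiv_X_self, zero_add]
  have hadd : ∀ a : ℤ, pderiv ℂ i ((oneAddX i ^ (a + 1) : (MvPowerSeries (Fin N) ℂ)ˣ) :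
      MvPowerSeries (Fin N) ℂ) = ((oneAddX i ^ a : (MvPowerSeries (Fin N) ℂ)ˣ) :
      MvPowerSeries (Fin N) ℂ) + (1 + X i) * pderiv ℂ i
        ((oneAddX i ^ a : (MvPowerSeries (Fin N) ℂ)ˣ) : MvPowerSeries (Fin N) ℂ) := by
    intro a
    rw [zpow_add_one, Units.val_mul, Derivation.leibniz, val_oneAddX, hD1, smul_eq_mul,
      smul_eq_mul, mul_one]
  have hval : ∀ a : ℤ, ((oneAddX i ^ (a + 1) : (MvPowerSeries (Fin N) ℂ)ˣ) :
      MvPowerSeries (Fin N) ℂ) = (1 + X i) * ((oneAddX i ^ a : (MvPowerSeries (Fin N) ℂ)ˣ) :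
      MvPowerSeries (Fin N) ℂ) := by
    intro a; rw [zpow_add_one, Units.val_mul, mul_comm]; rfl
  induction n using Int.induction_on with
  | zero => simp
  | succ a ih =>
    rw [hadd, hval, ih, mul_add, mul_smul_comm, Int.cast_add, add_smul, Int.cast_one, one_smul]
    ring
  | pred a ih =>
    have h1 := hadd (-(a : ℤ) - 1)
    have h2 := hval (-(a : ℤ) - 1)
    rw [sub_add_cancel] at h1 h2
    rw [h1, h2, ← mul_smul_comm] at ih
    have hne : (1 + X i : MvPowerSeries (Fin N) ℂ) ≠ 0 := (oneAddX i).ne_zero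
    have h3 := mul_left_cancel₀ hne ih
    rw [Int.cast_sub, Int.cast_one, sub_smul, one_smul, ← h3]
    ring

open MvPowerSeries in
theorem iterate_pderiv_eigen {N : ℕ} (i : Fin N) (n : ℤ) {g : MvPowerSeries (Fin N) ℂ}
    (hg : (1 + X i) * pderiv ℂ i g = (n : ℂ) • g) (k : ℕ) :
    (1 + X i) ^ k * (pderiv ℂ i)^[k] g = (((descPochhammer ℤ k).eval n : ℤ) : ℂ) • g := by
  induction k with
  | zero => simp
  | succ k ih =>
    have h1 := congrArg (fun f => (1 + X i) * pderiv ℂ i f) ih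
    simp only [Derivation.map_smul, mul_smul_comm, hg] at h1
    have h0 : pderiv ℂ i (1 + X i : MvPowerSeries (Fin N) ℂ) = 1 := by
      rw [map_add, pderiv_one, pderiv_X_self, zero_add]
    rw [Derivation.leibniz, pderiv_pow, h0, ← Function.iterate_succ_apply' (pderiv ℂ i),
      smul_eq_mul, smul_eq_mul] at h1
    have h2 : (1 + X i) * ((pderiv ℂ i)^[k] g * ((k : MvPowerSeries (Fin N) ℂ) *
        (1 + X i) ^ (k - 1) * 1)) = (k : ℂ) • ((1 + X i) ^ k * (pderiv ℂ i)^[k] g) := by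
      have h3 : (k : ℂ) • ((1 + X i) ^ k * (pderiv ℂ i)^[k] g) =
          (k : MvPowerSeries (Fin N) ℂ) * ((1 + X i) ^ k * (pderiv ℂ i)^[k] g) := by
        rw [smul_eq_C_mul, map_natCast]
      rw [h3]
      rcases Nat.eq_zero_or_pos k with rfl | hk
      · simp
      · obtain ⟨j, rfl⟩ : ∃ j, k = j + 1 := ⟨k - 1, by omega⟩
        rw [Nat.add_sub_cancel]; ring
    rw [mul_add, h2, ih] at h1
    rw [descPochhammer_succ_eval]
    rw [Int.cast_mul, Int.cast_sub, Int.cast_natCast, pow_succ', mul_assoc,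
      eq_sub_of_add_eq h1, smul_smul, smul_smul, ← sub_smul]
    congr 1; ring

/-- The factorial power sum `∑_i (l_i)(l_i - 1)⋯(l_i - k + 1)` in the shifted coordinates
`l_i = λ_i + N - i`. -/
def Signature.factorialSum {N : ℕ} (k : ℕ) (lam : Signature N) : ℤ :=
  ∑ i, (descPochhammer ℤ k).eval (lam.coord i)

open MvPowerSeries in
theorem Signature.sum_pderiv_altSeries {N : ℕ} (lam : Signature N) (k : ℕ) :
    ∑ i, (1 + X i) ^ k * (pderiv ℂ i)^[k] lam.altSeries =
      (lam.factorialSum k : ℂ) • lam.altSeries := by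
  have hlin : ∀ (i : Fin N) (m : ℕ) (s : Finset (Equiv.Perm (Fin N)))
      (c : Equiv.Perm (Fin N) → ℂ) (g : Equiv.Perm (Fin N) → MvPowerSeries (Fin N) ℂ),
      (pderiv ℂ i)^[m] (∑ σ ∈ s, c σ • g σ) = ∑ σ ∈ s, c σ • (pderiv ℂ i)^[m] (g σ) := by
    intro i m s c g
    induction m with
    | zero => rfl
    | succ m ih =>
      rw [Function.iterate_succ_apply', ih, map_sum]
      refine Finset.sum_congr rfl fun σ _ => ?_
      rw [Derivation.map_smul, Function.iterate_succ_apply']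
  set g : Equiv.Perm (Fin N) → MvPowerSeries (Fin N) ℂ := fun σ =>
    ∏ j, ((oneAddX (σ j) ^ lam.coord j : (MvPowerSeries (Fin N) ℂ)ˣ) :
      MvPowerSeries (Fin N) ℂ) with hg
  have hdet : lam.altSeries = ∑ σ : Equiv.Perm (Fin N), ((Equiv.Perm.sign σ : ℤ) : ℂ) • g σ := by
    rw [Signature.altSeries, Matrix.det_apply]
    refine Finset.sum_congr rfl fun σ _ => ?_
    rw [Units.smul_def, Int.cast_smul_eq_zsmul]
    rfl
  have heig : ∀ (σ : Equiv.Perm (Fin N)) (i : Fin N), (1 + X i) * pderiv ℂ i (g σ) =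
      (lam.coord (σ.symm i) : ℂ) • g σ := by
    intro σ i
    have h1 : g σ = ((oneAddX i ^ lam.coord (σ.symm i) : (MvPowerSeries (Fin N) ℂ)ˣ) :
        MvPowerSeries (Fin N) ℂ) * ∏ j ∈ Finset.univ.erase (σ.symm i),
        ((oneAddX (σ j) ^ lam.coord j : (MvPowerSeries (Fin N) ℂ)ˣ) :
          MvPowerSeries (Fin N) ℂ) := by
      rw [hg]
      simp only
      rw [← Finset.mul_prod_erase _ _ (Finset.mem_univ (σ.symm i)), Equiv.apply_symm_apply]
    have h2 : ∀ (j : Fin N) (n : ℤ), j ≠ i → pderiv ℂ i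
        ((oneAddX j ^ n : (MvPowerSeries (Fin N) ℂ)ˣ) : MvPowerSeries (Fin N) ℂ) = 0 := by
      intro j n hj
      have h3 : ∀ m : ℕ, pderiv ℂ i (((oneAddX j) ^ m : (MvPowerSeries (Fin N) ℂ)ˣ) :
          MvPowerSeries (Fin N) ℂ) = 0 := by
        intro m
        rw [Units.val_pow_eq_pow_val, pderiv_pow, val_oneAddX, map_add, pderiv_one,
          pderiv_X_of_ne hj, add_zero, mul_zero]
      obtain ⟨m, rfl | rfl⟩ := n.eq_nat_or_neg
      · rw [zpow_natCast]; exact h3 m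
      · rw [zpow_neg, zpow_natCast, pderiv_inv, h3 m, mul_zero]
    have h3 : pderiv ℂ i (∏ j ∈ Finset.univ.erase (σ.symm i),
        ((oneAddX (σ j) ^ lam.coord j : (MvPowerSeries (Fin N) ℂ)ˣ) :
          MvPowerSeries (Fin N) ℂ)) = 0 := by
      have : ∀ s : Finset (Fin N), (∀ j ∈ s, j ≠ σ.symm i) → pderiv ℂ i (∏ j ∈ s,
        ((oneAddX (σ j) ^ lam.coord j : (MvPowerSeries (Fin N) ℂ)ˣ) :
          MvPowerSeries (Fin N) ℂ)) = 0 := by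
        intro s hs
        induction s using Finset.induction_on with
        | empty => simp
        | insert a s ha ih =>
          rw [Finset.prod_insert ha, Derivation.leibniz, h2 _ _ (fun h => hs a (by simp)
            (by rw [← h, Equiv.symm_apply_apply])),
            ih fun b hb => hs b (Finset.mem_insert_of_mem hb)]
          simp
      exact this _ fun j hj => Finset.ne_of_mem_erase hj
    rw [h1, Derivation.leibniz, h3, smul_zero, zero_add, smul_eq_mul, mul_left_comm,
      pderiv_oneAddX_zpow_mul, mul_smul_comm, mul_comm]
  rw [hdet]
  simp only [hlin, Finset.mul_sum, Finset.smul_sum, mul_smul_comm]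
  rw [Finset.sum_comm]
  refine Finset.sum_congr rfl fun σ _ => ?_
  simp only [iterate_pderiv_eigen _ _ (heig σ _)]
  rw [← Finset.smul_sum, ← Finset.sum_smul, smul_smul, smul_smul, mul_comm]
  congr 2
  rw [Signature.factorialSum, Int.cast_sum]
  exact Equiv.sum_comp σ.symm fun i => (((descPochhammer ℤ k).eval (lam.coord i) : ℤ) : ℂ)

open MvPowerSeries in
/-- Schur functions are eigenfunctions of `schurOp`. -/
theorem Signature.schurOp_series {N : ℕ} (lam : Signature N) (k : ℕ) :
    schurOp k lam.series = (lam.factorialSum k : ℂ) • lam.series := by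
  refine mul_left_cancel₀ (vandSeries_ne_zero N) ?_
  have hlin : ∀ (i : Fin N) (m : ℕ) (c : ℂ) (g : MvPowerSeries (Fin N) ℂ),
      (pderiv ℂ i)^[m] (c • g) = c • (pderiv ℂ i)^[m] g := by
    intro i m c g
    induction m with
    | zero => rfl
    | succ m ih =>
      rw [Function.iterate_succ_apply', ih, Derivation.map_smul, Function.iterate_succ_apply']
  rw [mul_smul_comm, vandSeries, vand_mul_schurOp k lam.symmSeries_series, ← vandSeries,
    lam.vandSeries_mul_series]
  simp only [hlin, mul_smul_comm]
  rw [← Finset.smul_sum, lam.sum_pderiv_altSeries, smul_comm]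

/-! ### Averages of Schur functions -/

theorem CoeffBound.iterate_pderiv (n j : ℕ) : ∃ C : ℝ, 0 ≤ C ∧ ∀ (N : ℕ) (B : ℝ)
    (h : MvPowerSeries (Fin N) ℂ), CoeffBound (n + j) B h → ∀ i,
      CoeffBound n (C * B) ((MvPowerSeries.pderiv ℂ i)^[j] h) := by
  induction j generalizing n with
  | zero => exact ⟨1, zero_le_one, fun N B h hB i => by simpa using hB⟩
  | succ j ih =>
    obtain ⟨C, hC0, hC⟩ := ih (n + 1)
    refine ⟨(n + 1) * C, by positivity, fun N B h hB i => ?_⟩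
    rw [Function.iterate_succ_apply', mul_assoc]
    exact (hC N B h (by rwa [show n + 1 + j = n + (j + 1) by ring]) i).pderiv i

theorem schurOp_bound (N k n : ℕ) : ∃ (n' : ℕ) (C : ℝ), ∀ (B : ℝ) (h : MvPowerSeries (Fin N) ℂ),
    SymmSeries h → CoeffBound n' B h → CoeffBound n (C * B) (schurOp k h) := by
  have h1 : ∀ r ∈ Finset.range (k + 1), ∃ C : ℝ, ∀ (B : ℝ) (h : MvPowerSeries (Fin N) ℂ),
      SymmSeries h → CoeffBound (n + k + k) B h → CoeffBound n (C * B)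
        ((k.descFactorial r : ℂ) • ∑ I ∈ Finset.powersetCard (r + 1) Finset.univ,
          divDiff I fun i : Fin N => (1 + MvPowerSeries.X i) ^ k *
            (MvPowerSeries.pderiv ℂ i)^[k - r] h) := by
    intro r hr
    have hr' : r ≤ k := by have := Finset.mem_range.mp hr; omega
    obtain ⟨C₁, hC₁, H₁⟩ := CoeffBound.iterate_pderiv (n + r) (k - r)
    obtain ⟨A, hA, HA⟩ := coeffBound_inVar ((1 + PowerSeries.X) ^ k) (n + r)
    obtain ⟨C₂, hC₂, H₂⟩ := divDiff_bound r n
    refine ⟨‖(k.descFactorial r : ℂ)‖ *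
      ((Finset.powersetCard (r + 1) (Finset.univ : Finset (Fin N))).card *
        (C₂ * (2 ^ (n + r) * (A * C₁)))), fun B h hs hB => ?_⟩
    have h2 : ∀ i : Fin N, CoeffBound (n + r) (2 ^ (n + r) * (A * (C₁ * B)))
        ((1 + MvPowerSeries.X i) ^ k * (MvPowerSeries.pderiv ℂ i)^[k - r] h) := by
      intro i
      have h3 := HA N i
      rw [map_pow, map_add, map_one, inVar_X] at h3
      exact h3.mul (H₁ N B h (hB.mono (by omega) le_rfl) i)
    have h3 := (CoeffBound.sum fun I hI => H₂ N _ (hs.equivariant_pderiv k (k - r)) I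
      (Finset.mem_powersetCard.mp hI).2 _ h2 : CoeffBound n
        (∑ _I ∈ Finset.powersetCard (r + 1) (Finset.univ : Finset (Fin N)), _) _).smul
        (k.descFactorial r : ℂ)
    refine h3.mono le_rfl (le_of_eq ?_)
    rw [Finset.sum_const, nsmul_eq_mul]
    ring
  choose! C hC using h1
  refine ⟨n + k + k, ∑ r ∈ Finset.range (k + 1), C r, fun B h hs hB => ?_⟩
  rw [Finset.sum_mul]
  exact CoeffBound.sum fun r hr => hC r hr B h hs hB

theorem finite_degree_le (N n : ℕ) : {m : Fin N →₀ ℕ | m.degree ≤ n}.Finite := by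
  refine Set.Finite.subset (Set.finite_Iic (Finsupp.equivFunOnFinite.symm fun _ : Fin N => n)) ?_
  intro m hm i
  exact (Finsupp.le_degree i m).trans hm

/-- The weights `w` on signatures for which the weighted sum of normalised Schur functions
converges coefficientwise. -/
def CoeffSummable {N : ℕ} (w : Signature N → ℂ) : Prop :=
  ∀ m, Summable fun lam => w lam * MvPowerSeries.coeff m lam.series

/-- The weighted sum `∑_λ w(λ) s_λ / s_λ(1^N)` as a power series at `1^N`. -/
def weightedSeries {N : ℕ} (w : Signature N → ℂ) : MvPowerSeries (Fin N) ℂ :=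
  fun m => ∑' lam, w lam * MvPowerSeries.coeff m lam.series

theorem coeff_weightedSeries {N : ℕ} (w : Signature N → ℂ) (m : Fin N →₀ ℕ) :
    MvPowerSeries.coeff m (weightedSeries w) = ∑' lam, w lam * MvPowerSeries.coeff m lam.series :=
  rfl

theorem symmSeries_weightedSeries {N : ℕ} (w : Signature N → ℂ) :
    SymmSeries (weightedSeries w) := by
  intro σ
  ext m
  rw [coeff_rename_perm, coeff_weightedSeries, coeff_weightedSeries]
  congr 1
  ext1 lam
  rw [← coeff_rename_perm, lam.symmSeries_series σ]

theorem CoeffSummable.mul_factorialSum {N : ℕ} {w : Signature N → ℂ} (hw : CoeffSummable w)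
    (k : ℕ) : CoeffSummable fun lam => w lam * (lam.factorialSum k : ℂ) := by
  intro m
  obtain ⟨n', C, hC⟩ := schurOp_bound N k m.degree
  set S := (finite_degree_le N n').toFinset with hS
  have h1 : Summable fun lam : Signature N => C * ∑ m' ∈ S,
      ‖w lam * MvPowerSeries.coeff m' lam.series‖ :=
    (summable_sum fun m' _ => (hw m').norm).mul_left C
  refine Summable.of_norm_bounded h1 fun lam => ?_
  have h2 : CoeffBound n' (∑ m' ∈ S, ‖MvPowerSeries.coeff m' lam.series‖) lam.series := by
    intro m' hm'
    exact Finset.single_le_sum (f := fun m' => ‖MvPowerSeries.coeff m' lam.series‖)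
      (fun _ _ => norm_nonneg _) (by rw [hS, Set.Finite.mem_toFinset]; exact hm')
  have h3 := hC _ _ lam.symmSeries_series h2 m le_rfl
  rw [lam.schurOp_series, map_smul, smul_eq_mul] at h3
  rw [mul_assoc, norm_mul]
  calc _ ≤ ‖w lam‖ * (C * ∑ m' ∈ S, ‖MvPowerSeries.coeff m' lam.series‖) :=
        mul_le_mul_of_nonneg_left h3 (norm_nonneg _)
    _ = _ := by
        simp only [norm_mul, Finset.mul_sum]
        exact Finset.sum_congr rfl fun _ _ => by ring

section Topology

open scoped MvPowerSeries.WithPiTopology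

theorem CoeffSummable.hasSum {N : ℕ} {w : Signature N → ℂ} (hw : CoeffSummable w) :
    HasSum (fun lam => w lam • lam.series) (weightedSeries w) := by
  rw [MvPowerSeries.WithPiTopology.hasSum_iff_hasSum_coeff]
  intro m
  simp only [map_smul, smul_eq_mul]
  exact (hw m).hasSum

theorem continuous_pderiv {N : ℕ} (i : Fin N) :
    Continuous (MvPowerSeries.pderiv ℂ i : MvPowerSeries (Fin N) ℂ → MvPowerSeries (Fin N) ℂ) := by
  refine continuous_pi fun m => ?_
  have : (fun f : MvPowerSeries (Fin N) ℂ => MvPowerSeries.pderiv ℂ i f m) =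
      fun f => MvPowerSeries.coeff (m + Finsupp.single i 1) f * ((m i : ℂ) + 1) := by
    ext f; exact MvPowerSeries.coeff_pderiv f m
  rw [this]
  exact (MvPowerSeries.WithPiTopology.continuous_coeff ℂ _).mul continuous_const

open MvPowerSeries in
/-- `schurOp k` acts termwise on absolutely convergent sums of Schur functions, and multiplies each
of them by its eigenvalue. -/
theorem CoeffSummable.schurOp_weightedSeries {N : ℕ} {w : Signature N → ℂ} (hw : CoeffSummable w)
    (k : ℕ) : schurOp k (weightedSeries w) =
      weightedSeries fun lam => w lam * (lam.factorialSum k : ℂ) := by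
  -- After multiplication by the Vandermonde series the operator is a combination of derivatives,
  -- which are continuous for coefficientwise convergence.
  refine mul_left_cancel₀ (vandSeries_ne_zero N) ?_
  have h1 := (hw.mul_factorialSum k).hasSum.mul_left (vandSeries N)
  refine HasSum.unique ?_ h1
  rw [vandSeries, vand_mul_schurOp k (symmSeries_weightedSeries w), ← vandSeries]
  have hit : ∀ (i : Fin N) (m : ℕ) (f : Signature N → MvPowerSeries (Fin N) ℂ)
      (a : MvPowerSeries (Fin N) ℂ), HasSum f a →
      HasSum (fun lam => (pderiv ℂ i)^[m] (f lam)) ((pderiv ℂ i)^[m] a) := by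
    intro i m f a hf
    induction m with
    | zero => exact hf
    | succ m ih =>
      simp only [Function.iterate_succ_apply']
      exact ih.map (pderiv ℂ i) (continuous_pderiv i)
  have h2 : HasSum (fun lam : Signature N => ∑ i, (1 + X i) ^ k *
      (pderiv ℂ i)^[k] (vandSeries N * (w lam • lam.series)))
      (∑ i, (1 + X i) ^ k * (pderiv ℂ i)^[k] (vandSeries N * weightedSeries w)) :=
    hasSum_sum fun i _ => (hit i k _ _ (hw.hasSum.mul_left _)).mul_left _
  suffices h3 : (fun lam : Signature N => vandSeries N *
      ((w lam * (lam.factorialSum k : ℂ)) • lam.series)) = fun lam => ∑ i, (1 + X i) ^ k *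
        (pderiv ℂ i)^[k] (vandSeries N * (w lam • lam.series)) by
    rw [h3]; exact h2
  funext lam
  have hs : SymmSeries (w lam • lam.series) := fun σ => by
    rw [map_smul, lam.symmSeries_series σ]
  have hlin : ∀ (i : Fin N) (m : ℕ) (c : ℂ) (g : MvPowerSeries (Fin N) ℂ),
      (pderiv ℂ i)^[m] (c • g) = c • (pderiv ℂ i)^[m] g := by
    intro i m c g
    induction m with
    | zero => rfl
    | succ m ih =>
      rw [Function.iterate_succ_apply', ih, Derivation.map_smul, Function.iterate_succ_apply']
  simp only [mul_smul_comm, hlin]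
  symm
  rw [← Finset.smul_sum, vandSeries, ← vand_mul_schurOp k lam.symmSeries_series, ← vandSeries,
    lam.schurOp_series, mul_smul_comm, smul_smul]

end Topology

/-! ### Taylor series of functions of several complex variables -/

/-- The partial derivative of `f` with respect to the `i`-th variable. -/
def pdir {K : ℕ} (i : Fin K) (f : (Fin K → ℂ) → ℂ) : (Fin K → ℂ) → ℂ :=
  fun u => lineDeriv ℂ f u (Pi.single i 1)

theorem AnalyticAt.pdir_eq {K : ℕ} {f : (Fin K → ℂ) → ℂ} {x : Fin K → ℂ}
    (hf : AnalyticAt ℂ f x) (i : Fin K) : pdir i f x = fderiv ℂ f x (Pi.single i 1) :=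
  hf.differentiableAt.lineDeriv_eq_fderiv

theorem AnalyticAt.pdir_eventuallyEq {K : ℕ} {f : (Fin K → ℂ) → ℂ} {x : Fin K → ℂ}
    (hf : AnalyticAt ℂ f x) (i : Fin K) :
    pdir i f =ᶠ[𝓝 x] fun u => fderiv ℂ f u (Pi.single i 1) := by
  filter_upwards [hf.eventually_analyticAt] with u hu
  exact hu.pdir_eq i

theorem AnalyticAt.pdir {K : ℕ} {f : (Fin K → ℂ) → ℂ} {x : Fin K → ℂ}
    (hf : AnalyticAt ℂ f x) (i : Fin K) : AnalyticAt ℂ (pdir i f) x := by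
  refine AnalyticAt.congr ?_ (hf.pdir_eventuallyEq i).symm
  exact ((ContinuousLinearMap.apply ℂ ℂ (Pi.single i (1 : ℂ) : Fin K → ℂ)).analyticAt _).comp
    hf.fderiv

theorem Filter.EventuallyEq.pdir {K : ℕ} {f g : (Fin K → ℂ) → ℂ} {x : Fin K → ℂ}
    (h : f =ᶠ[𝓝 x] g) (i : Fin K) : pdir i f =ᶠ[𝓝 x] pdir i g := by
  filter_upwards [eventually_eventually_nhds.mpr h] with u hu
  exact Filter.EventuallyEq.lineDeriv_eq hu

theorem AnalyticAt.pdir_comm {K : ℕ} {f : (Fin K → ℂ) → ℂ} {x : Fin K → ℂ}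
    (hf : AnalyticAt ℂ f x) (i j : Fin K) :
    _root_.pdir i (_root_.pdir j f) =ᶠ[𝓝 x] _root_.pdir j (_root_.pdir i f) := by
  have key : ∀ i j : Fin K, ∀ u, AnalyticAt ℂ f u → _root_.pdir i (_root_.pdir j f) u =
      fderiv ℂ (fderiv ℂ f) u (Pi.single i 1) (Pi.single j 1) := by
    intro i j u hu
    have h1 := ((hu.pdir_eventuallyEq j).pdir i).eq_of_nhds
    have h2 : AnalyticAt ℂ (fun v => fderiv ℂ f v (Pi.single j 1)) u :=
      ((ContinuousLinearMap.apply ℂ ℂ (Pi.single j (1 : ℂ) : Fin K → ℂ)).analyticAt _).comp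
        hu.fderiv
    rw [h1, h2.pdir_eq]
    have h3 := hu.fderiv.differentiableAt
    rw [fderiv_clm_apply h3 (differentiableAt_const _)]
    simp
  filter_upwards [hf.eventually_analyticAt] with u hu
  rw [key i j u hu, key j i u hu]
  exact (hu.contDiffAt (n := ⊤)).isSymmSndFDerivAt (by simp) _ _

theorem AnalyticAt.pdir_mul {K : ℕ} {f g : (Fin K → ℂ) → ℂ} {x : Fin K → ℂ}
    (hf : AnalyticAt ℂ f x) (hg : AnalyticAt ℂ g x) (i : Fin K) :
    _root_.pdir i (fun u => f u * g u) =ᶠ[𝓝 x]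
      fun u => f u * _root_.pdir i g u + g u * _root_.pdir i f u := by
  filter_upwards [hf.eventually_analyticAt, hg.eventually_analyticAt] with u hu hu'
  rw [(hu.fun_mul hu').pdir_eq, hu.pdir_eq, hu'.pdir_eq,
    fderiv_fun_mul hu.differentiableAt hu'.differentiableAt]
  simp

theorem AnalyticAt.pdir_add {K : ℕ} {f g : (Fin K → ℂ) → ℂ} {x : Fin K → ℂ}
    (hf : AnalyticAt ℂ f x) (hg : AnalyticAt ℂ g x) (i : Fin K) :
    _root_.pdir i (fun u => f u + g u) =ᶠ[𝓝 x]
      fun u => _root_.pdir i f u + _root_.pdir i g u := by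
  filter_upwards [hf.eventually_analyticAt, hg.eventually_analyticAt] with u hu hu'
  rw [(hu.fun_add hu').pdir_eq, hu.pdir_eq, hu'.pdir_eq,
    fderiv_fun_add hu.differentiableAt hu'.differentiableAt]
  simp

/-- The iterated partial derivative along a list of variables. -/
def iterPdir {K : ℕ} (L : List (Fin K)) (f : (Fin K → ℂ) → ℂ) : (Fin K → ℂ) → ℂ :=
  L.foldr (fun i g => pdir i g) f

theorem AnalyticAt.iterPdir {K : ℕ} {f : (Fin K → ℂ) → ℂ} {x : Fin K → ℂ}
    (hf : AnalyticAt ℂ f x) (L : List (Fin K)) : AnalyticAt ℂ (iterPdir L f) x := by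
  induction L with
  | nil => exact hf
  | cons i L ih => exact ih.pdir i

theorem Filter.EventuallyEq.iterPdir {K : ℕ} {f g : (Fin K → ℂ) → ℂ} {x : Fin K → ℂ}
    (h : f =ᶠ[𝓝 x] g) (L : List (Fin K)) : iterPdir L f =ᶠ[𝓝 x] iterPdir L g := by
  induction L with
  | nil => exact h
  | cons i L ih => exact ih.pdir i

theorem AnalyticAt.iterPdir_perm {K : ℕ} {f : (Fin K → ℂ) → ℂ} {x : Fin K → ℂ}
    (hf : AnalyticAt ℂ f x) {L L' : List (Fin K)} (h : L.Perm L') :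
    _root_.iterPdir L f =ᶠ[𝓝 x] _root_.iterPdir L' f := by
  induction h with
  | nil => exact EventuallyEq.rfl
  | cons i _ ih => exact ih.pdir i
  | swap i j L => exact (hf.iterPdir L).pdir_comm j i
  | trans _ _ ih1 ih2 => exact ih1.trans ih2

theorem AnalyticAt.iterPdir_add {K : ℕ} {f g : (Fin K → ℂ) → ℂ} {x : Fin K → ℂ}
    (hf : AnalyticAt ℂ f x) (hg : AnalyticAt ℂ g x) (L : List (Fin K)) :
    _root_.iterPdir L (fun u => f u + g u) =ᶠ[𝓝 x]
      fun u => _root_.iterPdir L f u + _root_.iterPdir L g u := by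
  induction L with
  | nil => exact EventuallyEq.rfl
  | cons i L ih => exact (ih.pdir i).trans ((hf.iterPdir L).pdir_add (hg.iterPdir L) i)

/-- The Taylor series at `1` of a function of several variables, as a formal power series. -/
def taylor {K : ℕ} (f : (Fin K → ℂ) → ℂ) : MvPowerSeries (Fin K) ℂ :=
  fun m => (∏ i, ((m i).factorial : ℂ))⁻¹ * iterPdir (Finsupp.toMultiset m).toList f 1

theorem coeff_taylor {K : ℕ} (f : (Fin K → ℂ) → ℂ) (m : Fin K →₀ ℕ) :
    MvPowerSeries.coeff m (taylor f) =
      (∏ i, ((m i).factorial : ℂ))⁻¹ * iterPdir (Finsupp.toMultiset m).toList f 1 := rfl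

theorem constantCoeff_taylor {K : ℕ} (f : (Fin K → ℂ) → ℂ) :
    MvPowerSeries.constantCoeff (taylor f) = f 1 := by
  rw [← MvPowerSeries.coeff_zero_eq_constantCoeff_apply, coeff_taylor]
  simp [iterPdir]

theorem taylor_congr {K : ℕ} {f g : (Fin K → ℂ) → ℂ} (h : f =ᶠ[𝓝 1] g) : taylor f = taylor g := by
  ext m
  rw [coeff_taylor, coeff_taylor, (h.iterPdir _).eq_of_nhds]

theorem pderiv_taylor {K : ℕ} {f : (Fin K → ℂ) → ℂ} (hf : AnalyticAt ℂ f 1) (i : Fin K) :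
    MvPowerSeries.pderiv ℂ i (taylor f) = taylor (pdir i f) := by
  ext m
  rw [MvPowerSeries.coeff_pderiv, coeff_taylor, coeff_taylor]
  have h1 : (Finsupp.toMultiset (m + Finsupp.single i 1)).toList.Perm
      ((Finsupp.toMultiset m).toList ++ [i]) := by
    rw [← Multiset.coe_eq_coe, Multiset.coe_toList, ← Multiset.coe_add, Multiset.coe_toList,
      map_add, Finsupp.toMultiset_single]
    simp
  have h2 : iterPdir ((Finsupp.toMultiset m).toList ++ [i]) f =
      iterPdir (Finsupp.toMultiset m).toList (pdir i f) := by
    simp [iterPdir]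
  have h3 : ∏ j, (((m + Finsupp.single i 1 : Fin K →₀ ℕ) j).factorial : ℂ) =
      (m i + 1) * ∏ j, ((m j).factorial : ℂ) := by
    rw [← Finset.mul_prod_erase _ _ (Finset.mem_univ i),
      ← Finset.mul_prod_erase _ (fun j => ((m j).factorial : ℂ)) (Finset.mem_univ i), ← mul_assoc]
    congr 1
    · simp [Nat.factorial_succ]
    · refine Finset.prod_congr rfl fun j hj => ?_
      simp [Finset.ne_of_mem_erase hj]
  rw [(hf.iterPdir_perm h1).eq_of_nhds, h2, h3, mul_inv]
  have h4 : (m i : ℂ) + 1 ≠ 0 := Nat.cast_add_one_ne_zero _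
  field_simp

theorem taylor_add {K : ℕ} {f g : (Fin K → ℂ) → ℂ} (hf : AnalyticAt ℂ f 1)
    (hg : AnalyticAt ℂ g 1) : taylor (fun u => f u + g u) = taylor f + taylor g := by
  ext m
  rw [map_add, coeff_taylor, coeff_taylor, coeff_taylor, (hf.iterPdir_add hg _).eq_of_nhds]
  ring

theorem taylor_const {K : ℕ} (c : ℂ) : taylor (fun _ : Fin K → ℂ => c) = MvPowerSeries.C c := by
  have h0 : ∀ (m : Fin K →₀ ℕ), m ≠ 0 → iterPdir (Finsupp.toMultiset m).toList
      (fun _ : Fin K → ℂ => c) = fun _ => 0 := by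
    intro m hm
    have hz : ∀ L : List (Fin K), L ≠ [] → iterPdir L (fun _ : Fin K → ℂ => c) = fun _ => 0 := by
      intro L hL
      induction L with
      | nil => exact absurd rfl hL
      | cons i L ih =>
        by_cases hL' : L = []
        · subst hL'; ext u; simp [iterPdir, pdir, lineDeriv]
        · have := ih hL'
          ext u
          change pdir i (iterPdir L _) u = 0
          rw [this]; simp [pdir, lineDeriv]
    refine hz _ ?_
    rw [Ne, Multiset.toList_eq_nil]
    exact fun h => hm (by
      rw [← Finsupp.toMultiset_toFinsupp m, h, map_zero])
  ext m
  rw [coeff_taylor, MvPowerSeries.coeff_C]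
  split_ifs with h
  · subst h; simp [iterPdir]
  · rw [h0 m h, mul_zero]

theorem taylor_mul {K : ℕ} {f g : (Fin K → ℂ) → ℂ} (hf : AnalyticAt ℂ f 1)
    (hg : AnalyticAt ℂ g 1) : taylor (fun u => f u * g u) = taylor f * taylor g := by
  have key : ∀ (n : ℕ) (m : Fin K →₀ ℕ), m.degree = n → ∀ f g : (Fin K → ℂ) → ℂ,
      AnalyticAt ℂ f 1 → AnalyticAt ℂ g 1 →
      MvPowerSeries.coeff m (taylor fun u => f u * g u) =
        MvPowerSeries.coeff m (taylor f * taylor g) := by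
    intro n
    induction n with
    | zero =>
      intro m hm f g _ _
      rw [Finsupp.degree_eq_zero_iff] at hm
      subst hm
      simp [constantCoeff_taylor]
    | succ n ih =>
      intro m hm f g hf hg
      have hm0 : m ≠ 0 := by rintro rfl; simp at hm
      obtain ⟨i, hi⟩ := Finsupp.ne_iff.mp hm0
      have hi' : m i ≠ 0 := hi
      obtain ⟨m', rfl⟩ : ∃ m', m = m' + Finsupp.single i 1 := by
        refine ⟨m - Finsupp.single i 1, (tsub_add_cancel_of_le ?_).symm⟩
        rw [Finsupp.single_le_iff]; omega
      have hm' : m'.degree = n := by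
        rw [map_add, Finsupp.degree_single] at hm; omega
      have h4 : (m' i : ℂ) + 1 ≠ 0 := Nat.cast_add_one_ne_zero _
      refine mul_right_cancel₀ h4 ?_
      rw [← MvPowerSeries.coeff_pderiv, ← MvPowerSeries.coeff_pderiv,
        pderiv_taylor (hf.fun_mul hg), Derivation.leibniz, pderiv_taylor hf, pderiv_taylor hg,
        taylor_congr (hf.pdir_mul hg i), taylor_add (hf.fun_mul (hg.pdir i))
          (hg.fun_mul (hf.pdir i)), map_add, map_add, ih m' hm' f _ hf (hg.pdir i),
        ih m' hm' g _ hg (hf.pdir i)]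
      rfl
  ext m
  exact key _ m rfl f g hf hg

theorem taylor_proj {K : ℕ} (i : Fin K) :
    taylor (fun u : Fin K → ℂ => u i) = 1 + MvPowerSeries.X i := by
  have ha : AnalyticAt ℂ (fun u : Fin K → ℂ => u i) 1 :=
    (ContinuousLinearMap.proj (R := ℂ) (φ := fun _ : Fin K => ℂ) i).analyticAt 1
  refine MvPowerSeries.pderiv.ext (fun j => ?_) ?_
  · rw [pderiv_taylor ha]
    have h1 : pdir j (fun u : Fin K → ℂ => u i) = fun _ => (Pi.single j (1 : ℂ) : Fin K → ℂ) i := by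
      ext u
      simp only [pdir, lineDeriv, Pi.add_apply, Pi.smul_apply, smul_eq_mul]
      rw [deriv_const_add, deriv_mul_const differentiableAt_id]
      simp
    rw [h1, taylor_const, map_add, MvPowerSeries.pderiv_one, zero_add]
    rcases eq_or_ne j i with rfl | hij
    · simp
    · rw [MvPowerSeries.pderiv_X_of_ne hij.symm, Pi.single_eq_of_ne hij.symm, map_zero]
  · rw [constantCoeff_taylor]; simp

theorem taylor_zpow {K : ℕ} {f : (Fin K → ℂ) → ℂ} (hf : AnalyticAt ℂ f 1) (h1 : f 1 ≠ 0)
    (v : (MvPowerSeries (Fin K) ℂ)ˣ) (hv : taylor f = v) (n : ℤ) :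
    taylor (fun u => f u ^ n) = ((v ^ n : (MvPowerSeries (Fin K) ℂ)ˣ) :
      MvPowerSeries (Fin K) ℂ) := by
  have hnat : ∀ n : ℕ, taylor (fun u => f u ^ n) = ((v ^ n : (MvPowerSeries (Fin K) ℂ)ˣ) :
      MvPowerSeries (Fin K) ℂ) := by
    intro n
    induction n with
    | zero => simpa using taylor_const (K := K) 1
    | succ n ih =>
      simp only [pow_succ]
      rw [taylor_mul (hf.fun_pow n) hf, ih, hv]; simp
  obtain ⟨m, rfl | rfl⟩ := n.eq_nat_or_neg
  · simpa using hnat m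
  · have h2 : taylor (fun u => f u ^ (-(m : ℤ))) * taylor (fun u => f u ^ m) = 1 := by
      rw [← taylor_mul (hf.fun_zpow h1) (hf.fun_pow m)]
      have h3 : (fun u => f u ^ (-(m : ℤ)) * f u ^ m) =ᶠ[𝓝 1] fun _ => 1 := by
        filter_upwards [hf.continuousAt.eventually_ne h1] with u hu
        rw [zpow_neg, zpow_natCast, inv_mul_cancel₀ (pow_ne_zero _ hu)]
      rw [taylor_congr h3, taylor_const]; simp
    rw [hnat m] at h2
    rw [zpow_neg, zpow_natCast]
    exact (Units.mul_eq_one_iff_eq_inv (u := v ^ m)).mp h2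

/-! ### Cauchy estimates -/

theorem norm_pdir_le {K : ℕ} {f : (Fin K → ℂ) → ℂ} {r B : ℝ} (hr : 0 < r)
    (hf : AnalyticOnNhd ℂ f (Metric.ball 1 r)) (hB : ∀ u ∈ Metric.ball (1 : Fin K → ℂ) r, ‖f u‖ ≤ B)
    (i : Fin K) : ∀ u ∈ Metric.ball (1 : Fin K → ℂ) (r / 2), ‖pdir i f u‖ ≤ B / (r / 2) := by
  intro u hu
  have hmem : ∀ t ∈ Metric.closedBall (0 : ℂ) (r / 2),
      u + t • (Pi.single i (1 : ℂ) : Fin K → ℂ) ∈ Metric.ball (1 : Fin K → ℂ) r := by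
    intro t ht
    rw [Metric.mem_ball, dist_eq_norm] at hu ⊢
    rw [mem_closedBall_zero_iff] at ht
    have h1 : ‖t • (Pi.single i (1 : ℂ) : Fin K → ℂ)‖ ≤ ‖t‖ := by
      rw [norm_smul, Pi.norm_single]; simp
    calc ‖u + t • (Pi.single i (1 : ℂ) : Fin K → ℂ) - 1‖
        = ‖(u - 1) + t • (Pi.single i (1 : ℂ) : Fin K → ℂ)‖ := by congr 1; abel
      _ ≤ ‖u - 1‖ + ‖t • (Pi.single i (1 : ℂ) : Fin K → ℂ)‖ := norm_add_le _ _
      _ < r := by linarith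
  refine Complex.norm_deriv_le_of_forall_mem_sphere_norm_le (by positivity) ?_ ?_
  · refine DifferentiableOn.diffContOnCl ?_
    rw [closure_ball _ (by positivity)]
    intro t ht
    have h2 : DifferentiableAt ℂ (fun t : ℂ => u + t • (Pi.single i (1 : ℂ) : Fin K → ℂ)) t := by
      fun_prop
    exact ((hf _ (hmem t ht)).differentiableAt.comp t h2).differentiableWithinAt
  · intro t ht
    exact hB _ (hmem t (Metric.sphere_subset_closedBall ht))

theorem iterPdir_bound {K : ℕ} (L : List (Fin K)) : ∀ r : ℝ, 0 < r → ∃ C : ℝ, ∃ r' : ℝ,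
    0 < r' ∧ r' ≤ r ∧ ∀ (f : (Fin K → ℂ) → ℂ) (B : ℝ), AnalyticOnNhd ℂ f (Metric.ball 1 r) →
      (∀ u ∈ Metric.ball (1 : Fin K → ℂ) r, ‖f u‖ ≤ B) →
      ∀ u ∈ Metric.ball (1 : Fin K → ℂ) r', ‖iterPdir L f u‖ ≤ C * B := by
  induction L with
  | nil => exact fun r hr => ⟨1, r, hr, le_rfl, fun f B _ hB u hu => by
      rw [one_mul]; exact hB u hu⟩
  | cons i L ih =>
    intro r hr
    obtain ⟨C, r', hr', hrr', h⟩ := ih r hr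
    refine ⟨C / (r' / 2), r' / 2, by positivity, by linarith, fun f B hf hB u hu => ?_⟩
    have h1 : AnalyticOnNhd ℂ (iterPdir L f) (Metric.ball 1 r') := fun v hv =>
      (hf v (Metric.ball_subset_ball hrr' hv)).iterPdir L
    have h2 := norm_pdir_le hr' h1 (h f B hf hB) i u hu
    rw [div_mul_eq_mul_div]
    exact h2

/-- Cauchy's estimate: Taylor coefficients are controlled by the supremum on a polydisc. -/
theorem norm_coeff_taylor_le {K : ℕ} (m : Fin K →₀ ℕ) {r : ℝ} (hr : 0 < r) : ∃ C : ℝ,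
    ∀ (f : (Fin K → ℂ) → ℂ) (B : ℝ), AnalyticOnNhd ℂ f (Metric.ball 1 r) →
      (∀ u ∈ Metric.ball (1 : Fin K → ℂ) r, ‖f u‖ ≤ B) →
      ‖MvPowerSeries.coeff m (taylor f)‖ ≤ C * B := by
  obtain ⟨C, r', hr', -, h⟩ := iterPdir_bound (Finsupp.toMultiset m).toList r hr
  refine ⟨‖(∏ i, ((m i).factorial : ℂ))⁻¹‖ * C, fun f B hf hB => ?_⟩
  rw [coeff_taylor, norm_mul, mul_assoc]
  exact mul_le_mul_of_nonneg_left (h f B hf hB 1 (Metric.mem_ball_self hr')) (norm_nonneg _)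

theorem taylor_sub {K : ℕ} {f g : (Fin K → ℂ) → ℂ} (hf : AnalyticAt ℂ f 1)
    (hg : AnalyticAt ℂ g 1) : taylor (fun u => f u - g u) = taylor f - taylor g := by
  rw [eq_sub_iff_add_eq, ← taylor_add (hf.fun_sub hg) hg]
  simp

theorem tendsto_coeff_taylor {K : ℕ} {ι : Type} {l : Filter ι} {g : ι → (Fin K → ℂ) → ℂ}
    {f : (Fin K → ℂ) → ℂ} {r : ℝ} (hr : 0 < r)
    (hg : ∀ᶠ n in l, AnalyticOnNhd ℂ (g n) (Metric.ball 1 r))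
    (hf : AnalyticOnNhd ℂ f (Metric.ball 1 r)) (h : TendstoUniformlyOn g f l (Metric.ball 1 r))
    (m : Fin K →₀ ℕ) :
    Tendsto (fun n => MvPowerSeries.coeff m (taylor (g n))) l
      (𝓝 (MvPowerSeries.coeff m (taylor f))) := by
  obtain ⟨C, hC⟩ := norm_coeff_taylor_le m hr
  rw [Metric.tendsto_nhds]
  intro ε hε
  rw [Metric.tendstoUniformlyOn_iff] at h
  filter_upwards [hg, h (ε / (|C| + 1)) (by positivity)] with n h1 h2
  have h3 := hC (fun u => g n u - f u) (ε / (|C| + 1)) (fun u hu => (h1 u hu).fun_sub (hf u hu))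
    fun u hu => by
      have := (h2 u hu).le
      rwa [dist_comm, dist_eq_norm] at this
  rw [taylor_sub (h1 1 (Metric.mem_ball_self hr)) (hf 1 (Metric.mem_ball_self hr)), map_sub] at h3
  rw [dist_eq_norm]
  refine h3.trans_lt ?_
  rw [mul_div_assoc', div_lt_iff₀ (by positivity)]
  nlinarith [le_abs_self C]

/-! ### Schur functions as Laurent polynomials -/

/-- The Laurent polynomial with the given multiset of exponents, evaluated at `x`. -/
def laurentSum {𝕜 : Type} [Field 𝕜] {N : ℕ} (T : Multiset (Fin N → ℤ)) (x : Fin N → 𝕜) : 𝕜 :=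
  (T.map fun m => ∏ i, x i ^ m i).sum

theorem laurentSum_one {𝕜 : Type} [Field 𝕜] {N : ℕ} (T : Multiset (Fin N → ℤ)) :
    laurentSum T (1 : Fin N → 𝕜) = T.card := by
  simp [laurentSum]

theorem laurentSum_zero {𝕜 : Type} [Field 𝕜] {N : ℕ} (x : Fin N → 𝕜) :
    laurentSum 0 x = 0 := by
  simp [laurentSum]

theorem laurentSum_cons {𝕜 : Type} [Field 𝕜] {N : ℕ} (m : Fin N → ℤ)
    (T : Multiset (Fin N → ℤ)) (x : Fin N → 𝕜) :
    laurentSum (m ::ₘ T) x = ∏ i, x i ^ m i + laurentSum T x := by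
  simp [laurentSum]

theorem continuousAt_laurentSum {N : ℕ} (T : Multiset (Fin N → ℤ)) {x : Fin N → ℂ}
    (hx : ∀ i, x i ≠ 0) : ContinuousAt (laurentSum T) x := by
  induction T using Multiset.induction_on with
  | empty =>
    have : laurentSum (0 : Multiset (Fin N → ℤ)) = fun _ : Fin N → ℂ => (0 : ℂ) :=
      funext laurentSum_zero
    rw [this]; exact continuousAt_const
  | cons m T ih =>
    rw [show laurentSum (m ::ₘ T) = fun x : Fin N → ℂ => ∏ i, x i ^ m i + laurentSum T x from
      funext (laurentSum_cons m T)]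
    exact (tendsto_finsetProd _ fun i _ =>
      ((continuous_apply i).continuousAt.zpow₀ (m i) (Or.inl (hx i)))).add ih

theorem schurRatio_eq_laurentSum {N : ℕ} (lam : Signature N) {x : Fin N → ℂ}
    (hx : ∀ i, x i ≠ 0) (hinj : Function.Injective x) :
    schurRatio lam x = laurentSum lam.exponents x := by
  have h1 := lam.det_eq fun i => Units.mk0 (x i) (hx i)
  have h2 : vand x ≠ 0 := by
    rw [vand, Finset.prod_ne_zero_iff]
    intro i _
    rw [Finset.prod_ne_zero_iff]
    intro j hj
    exact sub_ne_zero.mpr (hinj.ne (Finset.mem_Ioi.mp hj).ne)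
  rw [schurRatio, ← vand, div_eq_iff h2, mul_comm, laurentSum]
  simpa [Units.val_zpow_eq_zpow_val] using h1

theorem mem_closure_injective {N : ℕ} (x : Fin N → ℂ) :
    x ∈ closure {x : Fin N → ℂ | Function.Injective x} := by
  have h1 : Tendsto (fun t : ℂ => fun i : Fin N => x i + t * ((i : ℕ) : ℂ)) (𝓝[≠] 0) (𝓝 x) := by
    refine Tendsto.mono_left ?_ nhdsWithin_le_nhds
    have hc : Continuous fun t : ℂ => fun i : Fin N => x i + t * ((i : ℕ) : ℂ) := by fun_prop
    convert hc.tendsto 0 using 2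
    ext i; simp
  refine mem_closure_of_tendsto h1 ?_
  have h2 : ∀ c : ℂ, ∀ᶠ t in 𝓝[≠] (0 : ℂ), t ≠ c := by
    intro c
    by_cases hc : c = 0
    · subst hc; exact eventually_mem_nhdsWithin
    · exact (eventually_ne_nhds (Ne.symm hc)).filter_mono nhdsWithin_le_nhds
  have h3 : ∀ᶠ t in 𝓝[≠] (0 : ℂ), ∀ i j : Fin N,
      t ≠ (x j - x i) / (((i : ℕ) : ℂ) - ((j : ℕ) : ℂ)) := by
    rw [eventually_all]; intro i
    rw [eventually_all]; intro j
    exact h2 _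
  filter_upwards [h3] with t ht i j hij
  by_contra hne
  have h4 : ((i : ℕ) : ℂ) - ((j : ℕ) : ℂ) ≠ 0 := by
    rw [sub_ne_zero, Ne, Nat.cast_inj, Fin.val_inj]; exact hne
  refine ht i j ?_
  rw [eq_div_iff h4]
  simp only at hij
  linear_combination hij

theorem schur_eq_laurentSum {N : ℕ} (lam : Signature N) {x : Fin N → ℂ} (hx : ∀ i, x i ≠ 0) :
    schur lam x = laurentSum lam.exponents x := by
  refine extendFrom_eq (mem_closure_injective x) ?_
  refine ((continuousAt_laurentSum lam.exponents hx).tendsto.mono_left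
    nhdsWithin_le_nhds).congr' ?_
  have h1 : ∀ᶠ y in 𝓝 x, ∀ i, y i ≠ 0 := by
    rw [eventually_all]
    exact fun i => (continuous_apply i).continuousAt.eventually_ne (hx i)
  filter_upwards [h1.filter_mono nhdsWithin_le_nhds, eventually_mem_nhdsWithin] with y hy hinj
  exact (schurRatio_eq_laurentSum lam hy hinj).symm

theorem schur_one {N : ℕ} (lam : Signature N) : schur lam 1 = lam.exponents.card := by
  rw [schur_eq_laurentSum lam (x := 1) (fun i => one_ne_zero), laurentSum_one]

theorem schurGFTerm_eq {N : ℕ} (ρ : PMF (Signature N)) {x : Fin N → ℂ} (hx : ∀ i, x i ≠ 0)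
    (lam : Signature N) : schurGFTerm ρ x lam =
      ((ρ lam).toReal : ℂ) * ((lam.exponents.card : ℂ)⁻¹ * laurentSum lam.exponents x) := by
  rw [schurGFTerm, schur_eq_laurentSum lam hx, schur_one]
  ring

/-! ### Normal convergence of the Schur generating function -/

theorem norm_laurentSum_le {N : ℕ} (T : Multiset (Fin N → ℤ)) {x : Fin N → ℂ} {δ : ℝ}
    (hδ : δ < 1) (h0 : 0 < δ) (hx : ∀ i, 1 - δ ≤ ‖x i‖ ∧ ‖x i‖ ≤ 1 + δ) :
    ‖laurentSum T x‖ ≤ ∑ t : Finset (Fin N),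
      laurentSum T (fun i => if i ∈ t then 1 + δ else 1 - δ) := by
  induction T using Multiset.induction_on with
  | empty => simp [laurentSum_zero]
  | cons m T ih =>
    simp only [laurentSum_cons]
    rw [Finset.sum_add_distrib]
    refine (norm_add_le _ _).trans (add_le_add ?_ ih)
    rw [norm_prod]
    have h1 : ∀ i, ‖x i ^ m i‖ ≤ (1 + δ) ^ m i + (1 - δ) ^ m i := by
      intro i
      have hpos : 0 < ‖x i‖ := lt_of_lt_of_le (by linarith) (hx i).1
      have ha : 0 ≤ (1 + δ) ^ m i := zpow_nonneg (by linarith) _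
      have hb : 0 ≤ (1 - δ) ^ m i := zpow_nonneg (by linarith) _
      rw [norm_zpow]
      obtain ⟨n, hn | hn⟩ := (m i).eq_nat_or_neg
      · rw [hn] at ha hb ⊢
        have : ‖x i‖ ^ (n : ℤ) ≤ (1 + δ) ^ (n : ℤ) := by
          rw [zpow_natCast, zpow_natCast]
          exact pow_le_pow_left₀ (norm_nonneg _) (hx i).2 n
        linarith
      · rw [hn] at ha hb ⊢
        have : ‖x i‖ ^ (-(n : ℤ)) ≤ (1 - δ) ^ (-(n : ℤ)) := by
          rw [zpow_neg, zpow_neg, zpow_natCast, zpow_natCast]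
          exact inv_anti₀ (pow_pos (by linarith) n)
            (pow_le_pow_left₀ (by linarith) (hx i).1 n)
        linarith
    refine (Finset.prod_le_prod (fun i _ => norm_nonneg _) fun i _ => h1 i).trans (le_of_eq ?_)
    rw [Finset.prod_add, Finset.powerset_univ]
    refine Finset.sum_congr rfl fun t _ => ?_
    rw [← Finset.prod_mul_prod_compl t, Finset.compl_eq_univ_sdiff]
    congr 1
    · exact Finset.prod_congr rfl fun i hi => by rw [if_pos hi]
    · exact Finset.prod_congr rfl fun i hi => by rw [if_neg (Finset.mem_sdiff.mp hi).2]

theorem ofReal_laurentSum {N : ℕ} (T : Multiset (Fin N → ℤ)) (y : Fin N → ℝ) :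
    laurentSum T (fun i => (y i : ℂ)) = ((laurentSum T y : ℝ) : ℂ) := by
  induction T using Multiset.induction_on with
  | empty => simp [laurentSum_zero]
  | cons m T ih => simp [laurentSum_cons, ih]

/-- The series defining a Schur generating function converges normally near `1^N`: on a polyannulus
a Schur function is bounded by the sum of its values at the corners, because its coefficients are
nonnegative. -/
theorem HasSchurGF.exists_bound {N : ℕ} {ρ : PMF (Signature N)} (h : HasSchurGF ρ) :
    ∃ δ : ℝ, 0 < δ ∧ δ < 1 ∧ ∃ b : Signature N → ℝ, Summable b ∧
      ∀ x ∈ Metric.ball (1 : Fin N → ℂ) δ, ∀ lam, ‖schurGFTerm ρ x lam‖ ≤ b lam := by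
  obtain ⟨ε, hε, hs⟩ := Metric.eventually_nhds_iff_ball.mp h
  set δ := min (ε / 2) (1 / 2) with hδ
  have h0 : 0 < δ := by positivity
  have h1 : δ < 1 := (min_le_right _ _).trans_lt (by norm_num)
  have hlt : δ < ε := (min_le_left _ _).trans_lt (by linarith)
  set c : Finset (Fin N) → Fin N → ℝ := fun t i => if i ∈ t then 1 + δ else 1 - δ with hc
  have hcpos : ∀ t i, c t i ≠ 0 := by
    intro t i; simp only [hc]; split_ifs <;> linarith
  refine ⟨δ, h0, h1, fun lam => ∑ t, ‖schurGFTerm ρ (fun i => (c t i : ℂ)) lam‖, ?_, ?_⟩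
  · refine summable_sum fun t _ => (hs _ ?_).norm
    rw [Metric.mem_ball, dist_pi_lt_iff hε]
    intro i
    rw [Complex.dist_eq]
    have : (c t i : ℂ) - (1 : Fin N → ℂ) i = ((c t i - 1 : ℝ) : ℂ) := by simp
    rw [this, Complex.norm_real, Real.norm_eq_abs]
    refine lt_of_le_of_lt (le_of_eq ?_) hlt
    simp only [hc]
    split_ifs
    · rw [add_sub_cancel_left, abs_of_pos h0]
    · rw [abs_sub_comm, sub_sub_cancel, abs_of_pos h0]
  · intro x hx lam
    rw [Metric.mem_ball, dist_pi_lt_iff h0] at hx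
    have hx' : ∀ i, 1 - δ ≤ ‖x i‖ ∧ ‖x i‖ ≤ 1 + δ := by
      intro i
      have h2 := hx i
      rw [Pi.one_apply, dist_eq_norm] at h2
      have h3 := norm_sub_norm_le (x i) 1
      have h4 := norm_sub_norm_le 1 (x i)
      rw [norm_sub_rev] at h4
      rw [norm_one] at h3 h4
      constructor <;> linarith
    have hx0 : ∀ i, x i ≠ 0 := fun i => norm_pos_iff.mp (by linarith [(hx' i).1])
    rw [schurGFTerm_eq ρ hx0]
    have h5 := norm_laurentSum_le lam.exponents h1 h0 hx'
    have h6 : ∀ t, ‖schurGFTerm ρ (fun i => (c t i : ℂ)) lam‖ =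
        ‖((ρ lam).toReal : ℂ)‖ * (‖(lam.exponents.card : ℂ)⁻¹‖ *
          |laurentSum lam.exponents (c t)|) := by
      intro t
      rw [schurGFTerm_eq ρ fun i => Complex.ofReal_ne_zero.mpr (hcpos t i), norm_mul, norm_mul,
        ofReal_laurentSum, Complex.norm_real (laurentSum _ _), Real.norm_eq_abs (laurentSum _ _)]
    simp only
    rw [Finset.sum_congr rfl fun t _ => h6 t, ← Finset.mul_sum, ← Finset.mul_sum, norm_mul,
      norm_mul]
    gcongr
    exact h5.trans (Finset.sum_le_sum fun t _ => le_abs_self _)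

/-! ### Taylor series of the Schur generating function -/

theorem padOnes_mem_ball {K N : ℕ} {δ : ℝ} (h0 : 0 < δ) {u : Fin K → ℂ}
    (hu : u ∈ Metric.ball 1 δ) : padOnes N u ∈ Metric.ball (1 : Fin N → ℂ) δ := by
  rw [Metric.mem_ball, dist_pi_lt_iff h0] at hu ⊢
  intro i
  rw [padOnes]
  split_ifs with h
  · exact hu ⟨i, h⟩
  · simpa using h0

theorem padOnes_one {K : ℕ} (N : ℕ) : padOnes N (1 : Fin K → ℂ) = 1 := by
  ext i; simp [padOnes]

theorem ne_zero_of_mem_ball {N : ℕ} {δ : ℝ} (h1 : δ ≤ 1) {x : Fin N → ℂ}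
    (hx : x ∈ Metric.ball 1 δ) (i : Fin N) : x i ≠ 0 := by
  intro h
  have h2 : dist (x i) ((1 : Fin N → ℂ) i) < δ := (dist_le_pi_dist x 1 i).trans_lt hx
  rw [h, Pi.one_apply, dist_eq_norm, zero_sub, norm_neg, norm_one] at h2
  linarith

theorem analyticAt_padOnes {K : ℕ} (N : ℕ) (i : Fin N) (u : Fin K → ℂ) :
    AnalyticAt ℂ (fun u : Fin K → ℂ => padOnes N u i) u := by
  by_cases h : (i : ℕ) < K
  · simp only [padOnes, dif_pos h]
    exact (ContinuousLinearMap.proj (R := ℂ) (φ := fun _ : Fin K => ℂ) ⟨i, h⟩).analyticAt u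
  · simp only [padOnes, dif_neg h]
    exact analyticAt_const

/-- The coordinate `x_i` at the point `(u_1, …, u_K, 1^{N-K})` expanded around `1^K`. -/
def padUnit {K N : ℕ} (hK : K ≤ N) (i : Fin N) : (MvPowerSeries (Fin K) ℂ)ˣ :=
  Units.map (MvPowerSeries.killCompl (R := ℂ) (Fin.castLEEmb hK)).toRingHom.toMonoidHom (oneAddX i)

theorem taylor_padOnes {K N : ℕ} (hK : K ≤ N) (i : Fin N) :
    taylor (fun u : Fin K → ℂ => padOnes N u i) = (padUnit hK i : MvPowerSeries (Fin K) ℂ) := by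
  have h1 : (padUnit hK i : MvPowerSeries (Fin K) ℂ) =
      1 + MvPowerSeries.killCompl (R := ℂ) (Fin.castLEEmb hK) (MvPowerSeries.X i) := by
    change MvPowerSeries.killCompl (R := ℂ) (Fin.castLEEmb hK) (1 + MvPowerSeries.X i) = _
    rw [map_add, map_one]
  rw [h1]
  by_cases h : (i : ℕ) < K
  · simp only [padOnes, dif_pos h]
    rw [taylor_proj]
    have : i = Fin.castLEEmb hK ⟨i, h⟩ := rfl
    conv_rhs => rw [this, MvPowerSeries.killCompl_X]
  · simp only [padOnes, dif_neg h]
    rw [taylor_const, MvPowerSeries.killCompl_X_eq_zero, add_zero, map_one]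
    rintro ⟨j, rfl⟩
    exact h j.2

theorem analyticAt_prod_zpow {K N : ℕ} (m : Fin N → ℤ) {u : Fin K → ℂ}
    (hu : ∀ i, padOnes N u i ≠ 0) (s : Finset (Fin N)) :
    AnalyticAt ℂ (fun u : Fin K → ℂ => ∏ i ∈ s, padOnes N u i ^ m i) u :=
  Finset.analyticAt_fun_prod s fun i _ => (analyticAt_padOnes N i u).fun_zpow (hu i)

theorem analyticAt_laurentSum_padOnes {K N : ℕ} (T : Multiset (Fin N → ℤ)) {u : Fin K → ℂ}
    (hu : ∀ i, padOnes N u i ≠ 0) :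
    AnalyticAt ℂ (fun u : Fin K → ℂ => laurentSum T (padOnes N u)) u := by
  induction T using Multiset.induction_on with
  | empty => simp only [laurentSum_zero]; exact analyticAt_const
  | cons m T ih =>
    simp only [laurentSum_cons]
    exact (analyticAt_prod_zpow m hu _).fun_add ih

theorem taylor_prod_zpow {K N : ℕ} (hK : K ≤ N) (m : Fin N → ℤ) (s : Finset (Fin N)) :
    taylor (fun u : Fin K → ℂ => ∏ i ∈ s, padOnes N u i ^ m i) =
      ((∏ i ∈ s, padUnit hK i ^ m i : (MvPowerSeries (Fin K) ℂ)ˣ) :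
        MvPowerSeries (Fin K) ℂ) := by
  have h1 : ∀ i, padOnes N (1 : Fin K → ℂ) i ≠ 0 := by simp [padOnes_one]
  induction s using Finset.induction_on with
  | empty => simp [taylor_const]
  | insert a s ha ih =>
    simp only [Finset.prod_insert ha, Units.val_mul]
    rw [taylor_mul ((analyticAt_padOnes N a 1).fun_zpow (h1 a)) (analyticAt_prod_zpow m h1 s), ih,
      taylor_zpow (analyticAt_padOnes N a 1) (h1 a) _ (taylor_padOnes hK a)]

theorem taylor_laurentSum {K N : ℕ} (hK : K ≤ N) (T : Multiset (Fin N → ℤ)) :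
    taylor (fun u : Fin K → ℂ => laurentSum T (padOnes N u)) =
      MvPowerSeries.killCompl (R := ℂ) (Fin.castLEEmb hK) (T.map fun m =>
      ((∏ i, oneAddX i ^ m i : (MvPowerSeries (Fin N) ℂ)ˣ) : MvPowerSeries (Fin N) ℂ)).sum := by
  have h1 : ∀ i, padOnes N (1 : Fin K → ℂ) i ≠ 0 := by simp [padOnes_one]
  induction T using Multiset.induction_on with
  | empty => simp [laurentSum_zero, taylor_const]
  | cons m T ih =>
    simp only [laurentSum_cons, Multiset.map_cons, Multiset.sum_cons]
    rw [taylor_add (analyticAt_prod_zpow m h1 _) (analyticAt_laurentSum_padOnes T h1), ih, map_add,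
      taylor_prod_zpow hK]
    congr 1
    have h2 : (∏ i, padUnit hK i ^ m i : (MvPowerSeries (Fin K) ℂ)ˣ) =
        Units.map (MvPowerSeries.killCompl (R := ℂ) (Fin.castLEEmb hK)).toRingHom.toMonoidHom
          (∏ i, oneAddX i ^ m i) := by
      rw [map_prod]
      exact Finset.prod_congr rfl fun i _ => by rw [map_zpow, padUnit]
    rw [h2]; rfl

theorem schurGFTerm_padOnes_eqOn {K N : ℕ} (ρ : PMF (Signature N)) (lam : Signature N) :
    Set.EqOn (fun u : Fin K → ℂ => schurGFTerm ρ (padOnes N u) lam)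
      (fun u => (((ρ lam).toReal : ℂ) * (lam.exponents.card : ℂ)⁻¹) *
        laurentSum lam.exponents (padOnes N u)) (Metric.ball 1 1) := by
  intro u hu
  have := schurGFTerm_eq ρ (ne_zero_of_mem_ball le_rfl (padOnes_mem_ball (N := N) one_pos hu)) lam
  simp only [this, mul_assoc]

theorem analyticOnNhd_schurGFTerm {K N : ℕ} (ρ : PMF (Signature N)) (lam : Signature N) :
    AnalyticOnNhd ℂ (fun u : Fin K → ℂ => schurGFTerm ρ (padOnes N u) lam) (Metric.ball 1 1) := by
  refine AnalyticOnNhd.congr Metric.isOpen_ball ?_ (schurGFTerm_padOnes_eqOn ρ lam).symm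
  intro u hu
  exact analyticAt_const.fun_mul (analyticAt_laurentSum_padOnes _
    (ne_zero_of_mem_ball le_rfl (padOnes_mem_ball one_pos hu)))

theorem taylor_schurGFTerm {K N : ℕ} (hK : K ≤ N) (ρ : PMF (Signature N)) (lam : Signature N) :
    taylor (fun u : Fin K → ℂ => schurGFTerm ρ (padOnes N u) lam) =
      ((ρ lam).toReal : ℂ) • MvPowerSeries.killCompl (R := ℂ) (Fin.castLEEmb hK) lam.series := by
  have h1 : ∀ i, padOnes N (1 : Fin K → ℂ) i ≠ 0 := by simp [padOnes_one]
  rw [taylor_congr ((schurGFTerm_padOnes_eqOn ρ lam).eventuallyEq_of_mem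
    (Metric.ball_mem_nhds _ one_pos)), taylor_mul analyticAt_const
    (analyticAt_laurentSum_padOnes _ h1), taylor_const, taylor_laurentSum hK, Signature.series,
    map_smul, smul_smul, MvPowerSeries.smul_eq_C_mul]

/-- The weights of a probability measure on signatures, as complex numbers. -/
def PMF.weight {N : ℕ} (ρ : PMF (Signature N)) (lam : Signature N) : ℂ := ((ρ lam).toReal : ℂ)

theorem coeff_taylor_schurGFTerm {K N : ℕ} (hK : K ≤ N) (ρ : PMF (Signature N))
    (lam : Signature N) (m : Fin K →₀ ℕ) :
    MvPowerSeries.coeff m (taylor fun u : Fin K → ℂ => schurGFTerm ρ (padOnes N u) lam) =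
      ρ.weight lam * MvPowerSeries.coeff (m.embDomain (Fin.castLEEmb hK)) lam.series := by
  rw [taylor_schurGFTerm hK, map_smul, MvPowerSeries.coeff_killCompl, smul_eq_mul]
  rfl

theorem HasSchurGF.coeffSummable {N : ℕ} {ρ : PMF (Signature N)} (h : HasSchurGF ρ) :
    CoeffSummable ρ.weight := by
  obtain ⟨δ, h0, h1, b, hb, hle⟩ := h.exists_bound
  intro m
  obtain ⟨C, hC⟩ := norm_coeff_taylor_le m h0
  refine Summable.of_norm_bounded (hb.mul_left C) fun lam => ?_
  have h2 := hC (fun u => schurGFTerm ρ (padOnes N u) lam) (b lam)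
    ((analyticOnNhd_schurGFTerm ρ lam).mono (Metric.ball_subset_ball h1.le))
    fun u hu => hle _ (padOnes_mem_ball h0 hu) lam
  rw [coeff_taylor_schurGFTerm le_rfl] at h2
  have h3 : m.embDomain (Fin.castLEEmb (le_refl N)) = m := by
    have : Fin.castLEEmb (le_refl N) = Function.Embedding.refl _ := rfl
    rw [this, Finsupp.embDomain_refl, id]
  rwa [h3] at h2

theorem HasSchurGF.taylor_schurGF {K N : ℕ} (hK : K ≤ N) {ρ : PMF (Signature N)}
    (h : HasSchurGF ρ) (ha : AnalyticAt ℂ (fun u : Fin K → ℂ => schurGF ρ (padOnes N u)) 1) :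
    taylor (fun u : Fin K → ℂ => schurGF ρ (padOnes N u)) =
      MvPowerSeries.killCompl (R := ℂ) (Fin.castLEEmb hK) (weightedSeries ρ.weight) := by
  obtain ⟨δ, h0, h1, b, hb, hle⟩ := h.exists_bound
  obtain ⟨ε, hε, hball⟩ := Metric.eventually_nhds_iff_ball.mp ha.eventually_analyticAt
  set r := min δ ε with hr
  have hr0 : 0 < r := lt_min h0 hε
  have hunif : TendstoUniformlyOn
      (fun (t : Finset (Signature N)) (u : Fin K → ℂ) =>
        ∑ lam ∈ t, schurGFTerm ρ (padOnes N u) lam)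
      (fun u => schurGF ρ (padOnes N u)) atTop (Metric.ball 1 r) :=
    tendstoUniformlyOn_tsum hb fun lam u hu => hle _ (padOnes_mem_ball h0
      (Metric.ball_subset_ball (min_le_left _ _) hu)) lam
  have han : ∀ (t : Finset (Signature N)), AnalyticOnNhd ℂ (fun u : Fin K → ℂ =>
      ∑ lam ∈ t, schurGFTerm ρ (padOnes N u) lam) (Metric.ball 1 1) :=
    fun t => Finset.analyticOnNhd_fun_sum t fun lam _ => analyticOnNhd_schurGFTerm ρ lam
  have hsum : ∀ t : Finset (Signature N), taylor (fun u : Fin K → ℂ =>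
      ∑ lam ∈ t, schurGFTerm ρ (padOnes N u) lam) =
      ∑ lam ∈ t, taylor (fun u : Fin K → ℂ => schurGFTerm ρ (padOnes N u) lam) := by
    classical
    intro t
    induction t using Finset.induction_on with
    | empty => simp [taylor_const]
    | insert a t hat ih =>
      simp only [Finset.sum_insert hat]
      rw [taylor_add (analyticOnNhd_schurGFTerm ρ a _ (Metric.mem_ball_self one_pos))
        (han t _ (Metric.mem_ball_self one_pos)), ih]
  ext m
  have h3 := tendsto_coeff_taylor hr0 (Eventually.of_forall fun t => (han t).mono
    (Metric.ball_subset_ball ((min_le_left _ _).trans h1.le)))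
    (fun u hu => hball u (Metric.ball_subset_ball (min_le_right _ _) hu)) hunif m
  simp only [hsum, map_sum, coeff_taylor_schurGFTerm hK] at h3
  rw [MvPowerSeries.coeff_killCompl, coeff_weightedSeries]
  exact tendsto_nhds_unique h3 (h.coeffSummable _).hasSum

/-! ### Logarithmic derivatives and restriction to finitely many variables -/

theorem exists_perm_castLE {n N : ℕ} (hN : n + 1 ≤ N) (i : Fin N) (s : Finset (Fin N))
    (hs : s.card ≤ n) : ∃ σ : Equiv.Perm (Fin N), σ (Fin.castLEEmb hN 0) = i ∧
      ∀ j ∈ s, ∃ t, σ (Fin.castLEEmb hN t) = j := by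
  classical
  obtain ⟨J, hJ, -, hcard⟩ := Finset.exists_subsuperset_card_eq (n := n + 1)
    (Finset.subset_univ (insert i s)) ((Finset.card_insert_le i s).trans (by omega)) (by simpa)
  have hi : i ∈ J := hJ (Finset.mem_insert_self i s)
  set e := Finset.equivFinOfCardEq hcard with he
  set y : Fin (n + 1) ↪ Fin N := ((Equiv.swap 0 (e ⟨i, hi⟩)).trans e.symm).toEmbedding.trans
    (Function.Embedding.subtype _) with hy
  obtain ⟨σ, hσ'⟩ := Equiv.Perm.exists_extending_pair (Fin.castLEEmb hN) y
    (Fin.castLEEmb hN).injective y.injective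
  refine ⟨σ, ?_, fun j hj => ?_⟩
  · rw [hσ', hy]; simp
  · refine ⟨Equiv.swap 0 (e ⟨i, hi⟩) (e ⟨j, hJ (Finset.mem_insert_of_mem hj)⟩), ?_⟩
    rw [hσ', hy]; simp

theorem card_support_le_degree {α : Type} (m : α →₀ ℕ) : m.support.card ≤ m.degree := by
  rw [Finset.card_eq_sum_ones, Finsupp.degree_apply]
  exact Finset.sum_le_sum fun i hi => Nat.one_le_iff_ne_zero.mpr (Finsupp.mem_support_iff.mp hi)

/-- The coefficients of degree at most `n` of an equivariant family are those of the first member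
restricted to the first `n + 1` variables. -/
theorem Equivariant.coeffBound {n N : ℕ} (hN : n + 1 ≤ N) {q : Fin N → MvPowerSeries (Fin N) ℂ}
    (hq : Equivariant q) {B : ℝ}
    (h : CoeffBound n B (MvPowerSeries.killCompl (Fin.castLEEmb hN) (q (Fin.castLEEmb hN 0))))
    (i : Fin N) : CoeffBound n B (q i) := by
  intro m hm
  obtain ⟨σ, h0, hσ⟩ := exists_perm_castLE hN i m.support ((card_support_le_degree m).trans hm)
  set m₁ := m.embDomain σ.symm.toEmbedding with hm₁
  have hm₁a : ∀ j, m₁ j = m (σ j) := by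
    intro j; rw [hm₁, embDomain_perm_apply]; simp
  have hsub : (m₁.support : Set (Fin N)) ⊆ Set.range (Fin.castLEEmb hN) := by
    intro j hj
    have hj' : σ j ∈ m.support := by
      rw [Finsupp.mem_support_iff, ← hm₁a]
      exact Finsupp.mem_support_iff.mp hj
    obtain ⟨t, ht⟩ := hσ _ hj'
    exact ⟨t, σ.injective ht⟩
  set m₂ := m₁.comapDomain (Fin.castLEEmb hN) (Fin.castLEEmb hN).injective.injOn with hm₂
  have h1 : m₂.embDomain (Fin.castLEEmb hN) = m₁ := Finsupp.embDomain_comapDomain hsub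
  have hdeg : m₂.degree = m.degree := by
    have h2 : m₁.degree = m.degree := by
      rw [Finsupp.degree_eq_sum, Finsupp.degree_eq_sum]
      simp only [hm₁a]
      exact Equiv.sum_comp σ m
    rw [← h2, ← h1, Finsupp.degree_apply, Finsupp.degree_apply, Finsupp.support_embDomain,
      Finset.sum_map]
    simp only [Finsupp.embDomain_apply_self]
  have h3 := h m₂ (hdeg.le.trans hm)
  rw [MvPowerSeries.coeff_killCompl, h1, hm₁, ← coeff_rename_perm, hq, h0] at h3
  exact h3

theorem killCompl_pderiv {n N : ℕ} (e : Fin n ↪ Fin N) (j : Fin n)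
    (P : MvPowerSeries (Fin N) ℂ) :
    MvPowerSeries.killCompl e (MvPowerSeries.pderiv ℂ (e j) P) =
      MvPowerSeries.pderiv ℂ j (MvPowerSeries.killCompl e P) := by
  ext m
  rw [MvPowerSeries.coeff_killCompl, MvPowerSeries.coeff_pderiv, MvPowerSeries.coeff_pderiv,
    MvPowerSeries.coeff_killCompl, Finsupp.embDomain_apply_self, Finsupp.embDomain_add,
    Finsupp.embDomain_single]

theorem killCompl_inVar {n N : ℕ} (e : Fin n ↪ Fin N) (j : Fin n) (φ : PowerSeries ℂ) :
    MvPowerSeries.killCompl e (inVar (e j) φ) = inVar j φ := by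
  have h : inVar (e j) φ = MvPowerSeries.rename e (inVar j φ) :=
    (MvPowerSeries.rename_rename (fun _ : Unit => j) e φ).symm
  rw [h, MvPowerSeries.killCompl_rename_app]

/-- The logarithmic derivatives `N⁻¹ P⁻¹ ∂_i P`. -/
def logDerivSeries {N : ℕ} (P : MvPowerSeries (Fin N) ℂ) (i : Fin N) : MvPowerSeries (Fin N) ℂ :=
  (N : ℂ)⁻¹ • (P⁻¹ * MvPowerSeries.pderiv ℂ i P)

theorem pderiv_eq_logDerivSeries {N : ℕ} (hN : N ≠ 0) {P : MvPowerSeries (Fin N) ℂ}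
    (h1 : MvPowerSeries.constantCoeff P = 1) (i : Fin N) :
    MvPowerSeries.pderiv ℂ i P = (N : ℂ) • (logDerivSeries P i * P) := by
  rw [logDerivSeries, smul_mul_assoc, smul_smul, mul_inv_cancel₀ (Nat.cast_ne_zero.mpr hN),
    one_smul, mul_right_comm, MvPowerSeries.inv_mul_cancel _ (by rw [h1]; exact one_ne_zero),
    one_mul]

theorem SymmSeries.equivariant_logDerivSeries {N : ℕ} {P : MvPowerSeries (Fin N) ℂ}
    (hP : SymmSeries P) (h1 : MvPowerSeries.constantCoeff P = 1) :
    Equivariant (logDerivSeries P) := by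
  intro σ i
  have hc : MvPowerSeries.constantCoeff P ≠ 0 := by rw [h1]; exact one_ne_zero
  have hP0 : P ≠ 0 := by rintro rfl; simp at hc
  have h2 : MvPowerSeries.rename σ P⁻¹ = P⁻¹ := by
    refine mul_left_cancel₀ hP0 ?_
    have h3 := congrArg (MvPowerSeries.rename (R := ℂ) σ) (MvPowerSeries.mul_inv_cancel P hc)
    rw [map_mul, map_one, hP σ] at h3
    rw [h3, MvPowerSeries.mul_inv_cancel P hc]
  rw [logDerivSeries, map_smul, map_mul, h2, rename_perm_pderiv, hP σ, logDerivSeries]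

theorem constantCoeff_weightedSeries {N : ℕ} (ρ : PMF (Signature N)) :
    MvPowerSeries.constantCoeff (weightedSeries ρ.weight) = 1 := by
  rw [← MvPowerSeries.coeff_zero_eq_constantCoeff_apply, coeff_weightedSeries]
  simp only [MvPowerSeries.coeff_zero_eq_constantCoeff_apply, Signature.constantCoeff_series,
    mul_one, PMF.weight]
  rw [← Complex.ofReal_tsum, ← ENNReal.tsum_toReal_eq fun lam => ρ.apply_ne_top lam, ρ.tsum_coe]
  simp

/-- The logarithmic derivatives of the Schur generating functions, restricted to any fixed number
of variables, converge to `ψ` as formal power series. -/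
def LogDerivTendsto (ρ : ∀ N : ℕ, PMF (Signature N)) (ψ : PowerSeries ℂ) : Prop :=
  ∀ n : ℕ, ∃ Γ : ℕ → MvPowerSeries (Fin (n + 1)) ℂ,
    (∀ᶠ N in atTop, AnalyticAt ℂ (fun u : Fin (n + 1) → ℂ => schurGF (ρ N) (padOnes N u)) 1 ∧
      MvPowerSeries.pderiv ℂ 0 (taylor fun u : Fin (n + 1) → ℂ => schurGF (ρ N) (padOnes N u)) =
        (N : ℂ) • (Γ N * taylor fun u : Fin (n + 1) → ℂ => schurGF (ρ N) (padOnes N u))) ∧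
    ∀ m, Tendsto (fun N => MvPowerSeries.coeff m (Γ N)) atTop
      (𝓝 (MvPowerSeries.coeff m (inVar 0 ψ)))

/-- A coefficient of degree at most `n` of the `i`-th logarithmic derivative concerns, besides
`X_i`, at most `n` variables. By equivariance these may be taken among the first `n + 1`, with `X_i`
replaced by `X_0`, so that only the restriction to `u_0, …, u_n, 1, …, 1` matters. This makes the
convergence uniform over all `i` and all monomials of degree at most `n`. -/
theorem LogDerivTendsto.famTendsto {ρ : ∀ N : ℕ, PMF (Signature N)} {ψ : PowerSeries ℂ}
    (h : LogDerivTendsto ρ ψ) (hS : ∀ N : ℕ, 1 ≤ N → HasSchurGF (ρ N)) :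
    FamTendsto (fun N => logDerivSeries (weightedSeries (ρ N).weight)) ψ := by
  intro n ε hε
  obtain ⟨Γ, hΓ, hlim⟩ := h n
  have h1 : ∀ᶠ N in atTop, ∀ m ∈ (finite_degree_le (n + 1) n).toFinset,
      ‖MvPowerSeries.coeff m (Γ N - inVar 0 ψ)‖ < ε := by
    rw [Filter.eventually_all_finset]
    intro m _
    have h2 := (Metric.tendsto_nhds.mp (hlim m)) ε hε
    simpa only [dist_eq_norm, ← map_sub] using h2
  filter_upwards [hΓ, h1, eventually_ge_atTop (n + 1)] with N h2 h3 hN i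
  set P := weightedSeries (ρ N).weight with hP
  have hN0 : N ≠ 0 := by omega
  have hc : MvPowerSeries.constantCoeff P = 1 := constantCoeff_weightedSeries _
  have hsym : SymmSeries P := symmSeries_weightedSeries _
  have hT := (hS N (by omega)).taylor_schurGF hN h2.1
  rw [hT, ← hP] at h2
  have hQ0 : MvPowerSeries.killCompl (Fin.castLEEmb hN) P ≠ 0 := by
    intro h0
    have h4 := congrArg (MvPowerSeries.coeff 0) h0
    rw [MvPowerSeries.coeff_killCompl, Finsupp.embDomain_zero,
      MvPowerSeries.coeff_zero_eq_constantCoeff_apply, hc] at h4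
    simp at h4
  have h4 : MvPowerSeries.killCompl (Fin.castLEEmb hN)
      (logDerivSeries P (Fin.castLEEmb hN 0)) = Γ N := by
    refine mul_right_cancel₀ hQ0 ?_
    refine smul_right_injective _ (Nat.cast_ne_zero.mpr hN0 : (N : ℂ) ≠ 0) ?_
    simp only
    rw [← h2.2, ← killCompl_pderiv, pderiv_eq_logDerivSeries hN0 hc, map_smul, map_mul]
  refine Equivariant.coeffBound (q := fun i => logDerivSeries P i - inVar i ψ) hN ?_ ?_ i
  · intro σ i
    rw [map_sub, hsym.equivariant_logDerivSeries hc, equivariant_inVar N ψ]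
  · rw [map_sub, h4, killCompl_inVar]
    intro m hm
    exact (h3 m ((Set.Finite.mem_toFinset _).mpr hm)).le

/-! ### Convergence of the logarithmic derivatives -/

/-- Division by power series with constant term `1` is continuous for coefficientwise convergence,
because the coefficients of the quotient are determined by recursion on the degree. -/
theorem tendsto_coeff_of_mul {K : ℕ} {Γ G H : ℕ → MvPowerSeries (Fin K) ℂ}
    {Γ' G' H' : MvPowerSeries (Fin K) ℂ} (hmul : ∀ᶠ N in atTop, Γ N * G N = H N)
    (hmul' : Γ' * G' = H') (h1 : ∀ᶠ N in atTop, MvPowerSeries.constantCoeff (G N) = 1)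
    (hG : ∀ m, Tendsto (fun N => MvPowerSeries.coeff m (G N)) atTop
      (𝓝 (MvPowerSeries.coeff m G')))
    (hH : ∀ m, Tendsto (fun N => MvPowerSeries.coeff m (H N)) atTop
      (𝓝 (MvPowerSeries.coeff m H'))) (m : Fin K →₀ ℕ) :
    Tendsto (fun N => MvPowerSeries.coeff m (Γ N)) atTop (𝓝 (MvPowerSeries.coeff m Γ')) := by
  have h1' : MvPowerSeries.constantCoeff G' = 1 := by
    have h2 := hG 0
    simp only [MvPowerSeries.coeff_zero_eq_constantCoeff_apply] at h2
    exact tendsto_nhds_unique h2 (Tendsto.congr' (h1.mono fun N h => h.symm) tendsto_const_nhds)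
  have hexp : ∀ (Γ G : MvPowerSeries (Fin K) ℂ), MvPowerSeries.constantCoeff G = 1 → ∀ m,
      MvPowerSeries.coeff m Γ = MvPowerSeries.coeff m (Γ * G) -
        ∑ p ∈ (Finset.HasAntidiagonal.antidiagonal m).erase (m, 0),
          MvPowerSeries.coeff p.1 Γ * MvPowerSeries.coeff p.2 G := by
    intro Γ G hG1 m
    rw [MvPowerSeries.coeff_mul, ← Finset.add_sum_erase _ _
      (Finset.HasAntidiagonal.mem_antidiagonal.mpr (add_zero m) :
        (m, 0) ∈ Finset.HasAntidiagonal.antidiagonal m),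
      MvPowerSeries.coeff_zero_eq_constantCoeff_apply, hG1]
    ring
  obtain ⟨n, hn⟩ : ∃ n, m.degree = n := ⟨_, rfl⟩
  induction n using Nat.strong_induction_on generalizing m with
  | _ n ih =>
    rw [hexp Γ' G' h1' m, hmul']
    refine Tendsto.congr' ?_ ((hH m).sub (tendsto_finsetSum _ fun p hp => (ih p.1.degree ?_ p.1
      rfl).mul (hG p.2)))
    · filter_upwards [hmul, h1] with N h2 h3
      rw [hexp (Γ N) (G N) h3 m, h2]
    · obtain ⟨hne, hp⟩ := Finset.mem_erase.mp hp
      have hp' := Finset.HasAntidiagonal.mem_antidiagonal.mp hp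
      have h2 : p.2.degree ≠ 0 := by
        intro h0
        rw [Finsupp.degree_eq_zero_iff] at h0
        rw [h0, add_zero] at hp'
        exact hne (Prod.ext hp' h0)
      rw [← hn, ← hp', map_add]
      omega

/-- The Taylor series at `1` of a function of one variable. -/
def taylorSeries (φ : ℂ → ℂ) : PowerSeries ℂ :=
  PowerSeries.mk fun n => iteratedDeriv n φ 1 / (n.factorial : ℂ)

theorem analyticAt_comp_proj {K : ℕ} {φ : ℂ → ℂ} {u : Fin K → ℂ} (i : Fin K)
    (hφ : AnalyticAt ℂ φ (u i)) : AnalyticAt ℂ (fun u : Fin K → ℂ => φ (u i)) u :=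
  AnalyticAt.fun_comp (f := fun u : Fin K → ℂ => u i) hφ
    ((ContinuousLinearMap.proj (R := ℂ) (φ := fun _ : Fin K => ℂ) i).analyticAt u)

theorem pdir_comp_proj {K : ℕ} {φ : ℂ → ℂ} (i j : Fin K) {u : Fin K → ℂ}
    (hφ : AnalyticAt ℂ φ (u i)) : pdir j (fun u : Fin K → ℂ => φ (u i)) u =
      if j = i then deriv φ (u i) else 0 := by
  rw [(analyticAt_comp_proj i hφ).pdir_eq]
  have h1 : HasFDerivAt (fun u : Fin K → ℂ => u i)
      (ContinuousLinearMap.proj (R := ℂ) (φ := fun _ : Fin K => ℂ) i) u :=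
    (ContinuousLinearMap.proj (R := ℂ) (φ := fun _ : Fin K => ℂ) i).hasFDerivAt
  have h2 := (hφ.differentiableAt.hasDerivAt).comp_hasFDerivAt u h1
  rw [show fderiv ℂ (fun u : Fin K → ℂ => φ (u i)) u = _ from h2.fderiv]
  by_cases h : j = i
  · subst h; simp
  · simp [h, Ne.symm h]

theorem pdir_comp_proj_eventuallyEq {K : ℕ} {φ : ℂ → ℂ} (i j : Fin K)
    (hφ : AnalyticAt ℂ φ 1) : pdir j (fun u : Fin K → ℂ => φ (u i)) =ᶠ[𝓝 1]
      fun u => if j = i then deriv φ (u i) else 0 := by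
  have h1 : ∀ᶠ u in 𝓝 (1 : Fin K → ℂ), AnalyticAt ℂ φ (u i) :=
    ((continuous_apply i).tendsto (1 : Fin K → ℂ)).eventually hφ.eventually_analyticAt
  filter_upwards [h1] with u hu
  exact pdir_comp_proj i j hu

theorem taylor_comp_proj {K : ℕ} (i : Fin K) {φ : ℂ → ℂ} (hφ : AnalyticAt ℂ φ 1) :
    taylor (fun u : Fin K → ℂ => φ (u i)) = inVar i (taylorSeries φ) := by
  have key : ∀ (n : ℕ) (m : Fin K →₀ ℕ), m.degree = n → ∀ φ : ℂ → ℂ, AnalyticAt ℂ φ 1 →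
      MvPowerSeries.coeff m (taylor fun u : Fin K → ℂ => φ (u i)) =
        MvPowerSeries.coeff m (inVar i (taylorSeries φ)) := by
    intro n
    induction n with
    | zero =>
      intro m hm φ _
      rw [Finsupp.degree_eq_zero_iff] at hm
      subst hm
      rw [← Finsupp.single_zero i, coeff_single_inVar, taylorSeries, PowerSeries.coeff_mk,
        Finsupp.single_zero, MvPowerSeries.coeff_zero_eq_constantCoeff_apply, constantCoeff_taylor]
      simp
    | succ n ih =>
      intro m hm φ hφ
      have ha : AnalyticAt ℂ (fun u : Fin K → ℂ => φ (u i)) 1 := analyticAt_comp_proj i hφ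
      have hsub : ∀ j, m j ≠ 0 → m - Finsupp.single j 1 + Finsupp.single j 1 = m := by
        intro j hj
        rw [tsub_add_cancel_of_le]; rw [Finsupp.single_le_iff]; omega
      by_cases h : ∃ j, j ≠ i ∧ m j ≠ 0
      · obtain ⟨j, hji, hj⟩ := h
        rw [coeff_inVar_eq_zero hji _ hj]
        have h1 := MvPowerSeries.coeff_pderiv (i := j) (taylor fun u : Fin K → ℂ => φ (u i))
          (m - Finsupp.single j 1)
        rw [pderiv_taylor ha, taylor_congr (pdir_comp_proj_eventuallyEq i j hφ), hsub j hj] at h1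
        simp only [if_neg hji, taylor_const, map_zero] at h1
        exact (mul_eq_zero.mp h1.symm).resolve_right (Nat.cast_add_one_ne_zero _)
      · push Not at h
        obtain ⟨a, rfl⟩ : ∃ a, m = Finsupp.single i a := by
          refine ⟨m i, ?_⟩
          ext j
          by_cases hj : j = i
          · subst hj; simp
          · rw [h j hj, Finsupp.single_eq_of_ne hj]
        rw [Finsupp.degree_single] at hm
        subst hm
        have h1 := MvPowerSeries.coeff_pderiv (i := i) (taylor fun u : Fin K → ℂ => φ (u i))
          (Finsupp.single i n)
        rw [pderiv_taylor ha, taylor_congr (pdir_comp_proj_eventuallyEq i i hφ),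
          ← Finsupp.single_add] at h1
        simp only [if_true] at h1
        rw [ih _ (Finsupp.degree_single i n) _ hφ.deriv, coeff_single_inVar] at h1
        rw [coeff_single_inVar]
        have hne : ((Finsupp.single i n i : ℕ) : ℂ) + 1 ≠ 0 := Nat.cast_add_one_ne_zero _
        refine mul_right_cancel₀ hne (h1.symm.trans ?_)
        rw [taylorSeries, taylorSeries, PowerSeries.coeff_mk, PowerSeries.coeff_mk,
          iteratedDeriv_succ', Finsupp.single_eq_same, Nat.factorial_succ]
        rw [Finsupp.single_eq_same] at hne
        have hf : (n.factorial : ℂ) ≠ 0 := Nat.cast_ne_zero.mpr n.factorial_ne_zero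
        push_cast
        field_simp
  ext m
  exact key _ m rfl φ hφ

theorem AnalyticAt.fun_cexp {K : ℕ} {g : (Fin K → ℂ) → ℂ} {u : Fin K → ℂ}
    (hg : AnalyticAt ℂ g u) : AnalyticAt ℂ (fun u => Complex.exp (g u)) u := hg.cexp

theorem pdir_exp {K : ℕ} {g : (Fin K → ℂ) → ℂ} (hg : AnalyticAt ℂ g 1) (i : Fin K) :
    pdir i (fun u => Complex.exp (g u)) =ᶠ[𝓝 1] fun u => pdir i g u * Complex.exp (g u) := by
  filter_upwards [hg.eventually_analyticAt] with u hu
  rw [hu.fun_cexp.pdir_eq, hu.pdir_eq, (hu.differentiableAt.hasFDerivAt.cexp).fderiv]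
  simp [mul_comm]

theorem pderiv_taylor_exp {K : ℕ} {g : (Fin K → ℂ) → ℂ} (hg : AnalyticAt ℂ g 1) (i : Fin K) :
    MvPowerSeries.pderiv ℂ i (taylor fun u => Complex.exp (g u)) =
      MvPowerSeries.pderiv ℂ i (taylor g) * taylor fun u => Complex.exp (g u) := by
  rw [pderiv_taylor hg.fun_cexp, taylor_congr (pdir_exp hg i), taylor_mul (hg.pdir i) hg.fun_cexp,
    pderiv_taylor hg]

theorem taylor_pow {K : ℕ} {f : (Fin K → ℂ) → ℂ} (hf : AnalyticAt ℂ f 1) (n : ℕ) :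
    taylor (fun u => f u ^ n) = taylor f ^ n := by
  induction n with
  | zero => simp [taylor_const]
  | succ n ih =>
    simp only [pow_succ]
    rw [taylor_mul (hf.fun_pow n) hf, ih]

theorem analyticAt_sum_comp_proj {K : ℕ} {f : ℂ → ℂ} {u : Fin K → ℂ}
    (hf : ∀ i, AnalyticAt ℂ f (u i)) : AnalyticAt ℂ (fun u : Fin K → ℂ => ∑ i, f (u i)) u :=
  Finset.analyticAt_fun_sum _ fun i _ => analyticAt_comp_proj i (hf i)

theorem pderiv_taylor_sum {K : ℕ} {f : ℂ → ℂ} (hf : AnalyticAt ℂ f 1) (i : Fin K) :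
    MvPowerSeries.pderiv ℂ i (taylor fun u : Fin K → ℂ => ∑ j, f (u j)) =
      inVar i (taylorSeries (deriv f)) := by
  rw [pderiv_taylor (analyticAt_sum_comp_proj fun _ => hf), ← taylor_comp_proj i hf.deriv]
  refine taylor_congr ?_
  have h1 : ∀ᶠ u in 𝓝 (1 : Fin K → ℂ), ∀ j, AnalyticAt ℂ f (u j) := by
    rw [eventually_all]
    exact fun j => ((continuous_apply j).tendsto (1 : Fin K → ℂ)).eventually
      hf.eventually_analyticAt
  filter_upwards [h1] with u hu
  rw [(analyticAt_sum_comp_proj hu).pdir_eq,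
    fderiv_fun_sum fun j _ => (analyticAt_comp_proj j (hu j)).differentiableAt,
    sum_apply]
  rw [Finset.sum_congr rfl fun j _ => ((analyticAt_comp_proj j (hu j)).pdir_eq i).symm.trans
    (pdir_comp_proj j i (hu j))]
  simp

theorem tendsto_coeff_pderiv {K : ℕ} {G : ℕ → MvPowerSeries (Fin K) ℂ}
    {G' : MvPowerSeries (Fin K) ℂ} (hG : ∀ m, Tendsto (fun N => MvPowerSeries.coeff m (G N)) atTop
      (𝓝 (MvPowerSeries.coeff m G'))) (i : Fin K) (m : Fin K →₀ ℕ) :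
    Tendsto (fun N => MvPowerSeries.coeff m (MvPowerSeries.pderiv ℂ i (G N))) atTop
      (𝓝 (MvPowerSeries.coeff m (MvPowerSeries.pderiv ℂ i G'))) := by
  simp only [MvPowerSeries.coeff_pderiv]
  exact (hG _).mul_const _

theorem exists_ball_analyticOnNhd {K : ℕ} {f : (Fin K → ℂ) → ℂ} (hf : AnalyticAt ℂ f 1) {r : ℝ}
    (hr : 0 < r) : ∃ r', 0 < r' ∧ r' ≤ r ∧ AnalyticOnNhd ℂ f (Metric.ball 1 r') := by
  obtain ⟨ε, hε, h⟩ := Metric.eventually_nhds_iff_ball.mp hf.eventually_analyticAt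
  exact ⟨min ε r, lt_min hε hr, min_le_right _ _,
    fun u hu => h u (Metric.ball_subset_ball (min_le_left _ _) hu)⟩

/-- With `S = exp (N g)`, the logarithmic derivative `N⁻¹ ∂ log S` is `∂ g`. -/
theorem logDerivTendsto_of_log {ρ : ∀ N : ℕ, PMF (Signature N)} {f : ℂ → ℂ}
    (hf : AnalyticAt ℂ f 1)
    (h : ∀ k : ℕ, 1 ≤ k → LogTendsto ρ k (fun u => ∑ i : Fin k, f (u i))) :
    LogDerivTendsto ρ (taylorSeries (deriv f)) := by
  intro n
  obtain ⟨r, hr, g, hg, hlim⟩ := h (n + 1) (by omega)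
  obtain ⟨r', hr', hle, hfa⟩ := exists_ball_analyticOnNhd
    (analyticAt_sum_comp_proj (K := n + 1) (u := 1) fun _ => hf) hr
  have hconv := tendsto_coeff_taylor hr' (hg.mono fun N hN => (show AnalyticOnNhd ℂ
    (fun u => (1 / (N : ℂ)) * g N u) (Metric.ball 1 r') from fun u hu =>
      analyticAt_const.fun_mul (hN.1 u (Metric.ball_subset_ball hle hu)))) hfa
    (hlim.mono (Metric.ball_subset_ball hle))
  refine ⟨fun N => MvPowerSeries.pderiv ℂ 0 (taylor fun u => (1 / (N : ℂ)) * g N u), ?_, ?_⟩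
  · filter_upwards [hg, eventually_ge_atTop 1] with N hN hN1
    have ha : AnalyticAt ℂ (g N) 1 := hN.1 1 (Metric.mem_ball_self hr)
    have hN0 : (N : ℂ) ≠ 0 := Nat.cast_ne_zero.mpr (by omega)
    refine ⟨ha.cexp.congr hN.2.2, ?_⟩
    rw [← taylor_congr hN.2.2, pderiv_taylor_exp ha, taylor_mul analyticAt_const ha, taylor_const,
      ← MvPowerSeries.smul_eq_C_mul, Derivation.map_smul, smul_mul_assoc, smul_smul,
      mul_one_div_cancel hN0, one_smul]
  · intro m
    rw [← pderiv_taylor_sum hf]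
    exact tendsto_coeff_pderiv hconv 0 m

/-- With `S = g^N`, the logarithmic derivative `N⁻¹ ∂ log S` is `∂ g / g`. -/
theorem logDerivTendsto_of_root {ρ : ∀ N : ℕ, PMF (Signature N)} {f : ℂ → ℂ}
    (hf : AnalyticAt ℂ f 1) {F : ∀ k : ℕ, (Fin k → ℂ) → ℂ}
    (h : ∀ k : ℕ, 1 ≤ k → RootTendsto ρ k (F k))
    (hF : ∀ k : ℕ, 1 ≤ k →
      ∀ᶠ u in 𝓝 (1 : Fin k → ℂ), F k u = Complex.exp (∑ i : Fin k, f (u i))) :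
    LogDerivTendsto ρ (taylorSeries (deriv f)) := by
  intro n
  have hsa := analyticAt_sum_comp_proj (K := n + 1) (u := 1) fun _ => hf
  have hF1 : F (n + 1) =ᶠ[𝓝 1] fun u => Complex.exp (∑ i, f (u i)) := hF (n + 1) (by omega)
  obtain ⟨r, hr, g, hg, hlim⟩ := h (n + 1) (by omega)
  obtain ⟨r', hr', hle, hfa⟩ := exists_ball_analyticOnNhd (hsa.cexp.congr hF1.symm) hr
  have hconv := tendsto_coeff_taylor hr' (hg.mono fun N hN =>
    hN.1.mono (Metric.ball_subset_ball hle)) hfa (hlim.mono (Metric.ball_subset_ball hle))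
  rw [taylor_congr hF1] at hconv
  have hga : ∀ᶠ N in atTop, AnalyticAt ℂ (g N) 1 :=
    hg.mono fun N hN => hN.1 1 (Metric.mem_ball_self hr)
  have hc1 : ∀ᶠ N in atTop, MvPowerSeries.constantCoeff (taylor (g N)) = 1 :=
    hg.mono fun N hN => by rw [constantCoeff_taylor, hN.2.1]
  have hmul : ∀ᶠ N in atTop, ((taylor (g N))⁻¹ * MvPowerSeries.pderiv ℂ 0 (taylor (g N))) *
      taylor (g N) = MvPowerSeries.pderiv ℂ 0 (taylor (g N)) := by
    filter_upwards [hc1] with N h1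
    rw [mul_right_comm, MvPowerSeries.inv_mul_cancel _ (by rw [h1]; exact one_ne_zero), one_mul]
  refine ⟨fun N => (taylor (g N))⁻¹ * MvPowerSeries.pderiv ℂ 0 (taylor (g N)), ?_, ?_⟩
  · filter_upwards [hg, hga, hmul, eventually_ge_atTop 1] with N hN ha hm hN1
    refine ⟨(ha.fun_pow N).congr hN.2.2, ?_⟩
    obtain ⟨M, rfl⟩ : ∃ M, N = M + 1 := ⟨N - 1, by omega⟩
    rw [← taylor_congr hN.2.2, taylor_pow ha, MvPowerSeries.pderiv_pow, pow_succ' _ M, ← mul_assoc,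
      hm, MvPowerSeries.smul_eq_C_mul, map_natCast, Nat.add_sub_cancel]
    ring
  · refine tendsto_coeff_of_mul hmul ?_ hc1 hconv (tendsto_coeff_pderiv hconv 0)
    rw [pderiv_taylor_exp hsa, pderiv_taylor_sum hf]

/-! ### First and second moments of the factorial power sums -/

theorem CoeffSummable.const_mul {N : ℕ} {w : Signature N → ℂ} (hw : CoeffSummable w) (c : ℂ) :
    CoeffSummable fun lam => c * w lam := by
  intro m
  simp only [mul_assoc]
  exact (hw m).mul_left c

theorem weightedSeries_const_mul {N : ℕ} (w : Signature N → ℂ) (c : ℂ) :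
    weightedSeries (fun lam => c * w lam) = c • weightedSeries w := by
  ext m
  rw [map_smul, coeff_weightedSeries, coeff_weightedSeries, smul_eq_mul, ← tsum_mul_left]
  simp only [mul_assoc]

theorem constantCoeff_weightedSeries_eq_tsum {N : ℕ} (w : Signature N → ℂ) :
    MvPowerSeries.constantCoeff (weightedSeries w) = ∑' lam, w lam := by
  rw [← MvPowerSeries.coeff_zero_eq_constantCoeff_apply, coeff_weightedSeries]
  simp [MvPowerSeries.coeff_zero_eq_constantCoeff_apply, Signature.constantCoeff_series]

theorem CoeffSummable.summable {N : ℕ} {w : Signature N → ℂ} (hw : CoeffSummable w) :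
    Summable w := by
  have h := hw 0
  simpa [MvPowerSeries.coeff_zero_eq_constantCoeff_apply, Signature.constantCoeff_series] using h

/-- The normalised factorial power sum `N^{-k-1} ∑_i l_i (l_i - 1) ⋯ (l_i - k + 1)`. -/
def Signature.factorialMoment {N : ℕ} (k : ℕ) (lam : Signature N) : ℝ :=
  (lam.factorialSum k : ℝ) / (N : ℝ) ^ (k + 1)

theorem CoeffSummable.mul_factorialMoment {N : ℕ} {w : Signature N → ℂ} (hw : CoeffSummable w)
    (k : ℕ) : CoeffSummable fun lam => w lam * (lam.factorialMoment k : ℂ) := by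
  have h := (hw.mul_factorialSum k).const_mul (((N : ℂ) ^ (k + 1))⁻¹)
  have h1 : (fun lam : Signature N => w lam * (lam.factorialMoment k : ℂ)) =
      fun lam => ((N : ℂ) ^ (k + 1))⁻¹ * (w lam * (lam.factorialSum k : ℂ)) := by
    funext lam
    rw [Signature.factorialMoment]; push_cast; ring
  rwa [h1]

/-- Weighting by a factorial moment, seen through the factor `P`, is the operator `scaledOp`. -/
theorem weightedSeries_mul_factorialMoment {N : ℕ} (hN : N ≠ 0) {w : Signature N → ℂ}
    (hw : CoeffSummable w) {P h : MvPowerSeries (Fin N) ℂ} (hP : SymmSeries P)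
    (hc : MvPowerSeries.constantCoeff P = 1) (hh : SymmSeries h) (hPh : weightedSeries w = P * h)
    (k : ℕ) : weightedSeries (fun lam => w lam * (lam.factorialMoment k : ℂ)) =
      P * scaledOp k (logDerivSeries P) h := by
  have h1 := hw.schurOp_weightedSeries k
  rw [hPh, schurOp_mul_eq hN (hP.equivariant_logDerivSeries hc) hP
    (fun i => pderiv_eq_logDerivSeries hN hc i) hh k] at h1
  have h2 : (fun lam : Signature N => w lam * (lam.factorialMoment k : ℂ)) =
      fun lam => ((N : ℂ) ^ (k + 1))⁻¹ * (w lam * (lam.factorialSum k : ℂ)) := by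
    funext lam
    rw [Signature.factorialMoment]; push_cast; ring
  have hN' : (N : ℂ) ^ (k + 1) ≠ 0 := pow_ne_zero _ (Nat.cast_ne_zero.mpr hN)
  rw [h2, weightedSeries_const_mul, ← h1, smul_smul, inv_mul_cancel₀ hN', one_smul]

theorem SymmSeries.of_mul {N : ℕ} {P h : MvPowerSeries (Fin N) ℂ} (hP : SymmSeries P)
    (hP0 : P ≠ 0) (hPh : SymmSeries (P * h)) : SymmSeries h := by
  intro σ
  have h1 := hPh σ
  rw [map_mul, hP σ] at h1
  exact mul_left_cancel₀ hP0 h1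

theorem ConstTendsto.constantCoeff {h : ∀ N : ℕ, MvPowerSeries (Fin N) ℂ} {c : ℂ}
    (hc : ConstTendsto h c) :
    Tendsto (fun N => MvPowerSeries.constantCoeff (h N)) atTop (𝓝 c) := by
  rw [Metric.tendsto_nhds]
  intro ε hε
  filter_upwards [hc 0 (ε / 2) (by positivity)] with N hN
  have h1 := hN 0 (by simp)
  rw [MvPowerSeries.coeff_zero_eq_constantCoeff_apply, map_sub, MvPowerSeries.constantCoeff_C]
    at h1
  rw [dist_eq_norm]
  linarith

/-- The first two moments of the factorial power sums, obtained by applying the differential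
operators to the Schur generating function once and twice. -/
theorem tendsto_factorialMoment {ρ : ∀ N : ℕ, PMF (Signature N)}
    (hS : ∀ N : ℕ, 1 ≤ N → HasSchurGF (ρ N)) {ψ : PowerSeries ℂ} (hψ : LogDerivTendsto ρ ψ)
    (k : ℕ) :
    Tendsto (fun N => ∑' lam, (ρ N).weight lam * (lam.factorialMoment k : ℂ)) atTop
      (𝓝 (limitMoment ψ k)) ∧
    Tendsto (fun N => ∑' lam, (ρ N).weight lam * (lam.factorialMoment k : ℂ) *
      (lam.factorialMoment k : ℂ)) atTop (𝓝 (limitMoment ψ k ^ 2)) := by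
  set P : ∀ N, MvPowerSeries (Fin N) ℂ := fun N => weightedSeries (ρ N).weight with hP
  have hc : ∀ N, MvPowerSeries.constantCoeff (P N) = 1 := fun N => constantCoeff_weightedSeries _
  have hs : ∀ N, SymmSeries (P N) := fun N => symmSeries_weightedSeries _
  have hP0 : ∀ N, P N ≠ 0 := fun N h0 => by
    have := hc N; rw [h0, map_zero] at this; exact zero_ne_one this
  have hγ : FamTendsto (fun N => logDerivSeries (P N)) ψ := hψ.famTendsto hS
  have he : ∀ᶠ N in atTop, Equivariant (logDerivSeries (P N)) :=
    Eventually.of_forall fun N => (hs N).equivariant_logDerivSeries (hc N)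
  have hone : ∀ N, SymmSeries (1 : MvPowerSeries (Fin N) ℂ) := fun N σ => map_one _
  have hone' : ConstTendsto (fun N => (1 : MvPowerSeries (Fin N) ℂ)) 1 := by
    intro n ε hε
    refine Eventually.of_forall fun N m _ => ?_
    rw [map_one, sub_self, map_zero, norm_zero]
    exact hε.le
  have h1 := constTendsto_scaledOp hγ he hone' (Eventually.of_forall hone) k
  have e1 : ∀ N, 1 ≤ N → weightedSeries (fun lam => (ρ N).weight lam *
      (lam.factorialMoment k : ℂ)) = P N * scaledOp k (logDerivSeries (P N)) 1 := fun N hN =>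
    weightedSeries_mul_factorialMoment (by omega) (hS N hN).coeffSummable (hs N) (hc N) (hone N)
      (mul_one _).symm k
  have hs1 : ∀ N, 1 ≤ N → SymmSeries (scaledOp k (logDerivSeries (P N)) 1) := fun N hN =>
    (hs N).of_mul (hP0 N) (by rw [← e1 N hN]; exact symmSeries_weightedSeries _)
  have h2 := constTendsto_scaledOp hγ he h1 ((eventually_ge_atTop 1).mono hs1) k
  have e2 : ∀ N, 1 ≤ N → weightedSeries (fun lam => (ρ N).weight lam *
      (lam.factorialMoment k : ℂ) * (lam.factorialMoment k : ℂ)) =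
      P N * scaledOp k (logDerivSeries (P N)) (scaledOp k (logDerivSeries (P N)) 1) :=
    fun N hN => weightedSeries_mul_factorialMoment (by omega)
      ((hS N hN).coeffSummable.mul_factorialMoment k) (hs N) (hc N) (hs1 N hN) (e1 N hN) k
  rw [mul_one] at h1 h2
  constructor
  · refine h1.constantCoeff.congr' ?_
    filter_upwards [eventually_ge_atTop 1] with N hN
    rw [← constantCoeff_weightedSeries_eq_tsum, e1 N hN, map_mul, hc, one_mul]
  · rw [pow_two]
    refine h2.constantCoeff.congr' ?_
    filter_upwards [eventually_ge_atTop 1] with N hN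
    rw [← constantCoeff_weightedSeries_eq_tsum, e2 N hN, map_mul, hc, one_mul]

/-! ### Mean square convergence -/

/-- The random variables `X N`, defined on the signatures of length `N`, converge to the constant
`c` in mean square. -/
def MeanSquareTendsto (ρ : ∀ N : ℕ, PMF (Signature N)) (X : ∀ N : ℕ, Signature N → ℝ) (c : ℝ) :
    Prop :=
  Tendsto (fun N => ∑' lam, ρ N lam * ENNReal.ofReal ((X N lam - c) ^ 2)) atTop (𝓝 0)

theorem MeanSquareTendsto.congr {ρ : ∀ N : ℕ, PMF (Signature N)} {X Y : ∀ N : ℕ, Signature N → ℝ}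
    {c : ℝ} (hX : MeanSquareTendsto ρ X c) (h : ∀ᶠ N in atTop, X N = Y N) :
    MeanSquareTendsto ρ Y c :=
  Tendsto.congr' (h.mono fun N hN => by simp only [hN]) hX

theorem MeanSquareTendsto.add {ρ : ∀ N : ℕ, PMF (Signature N)} {X Y : ∀ N : ℕ, Signature N → ℝ}
    {c d : ℝ} (hX : MeanSquareTendsto ρ X c) (hY : MeanSquareTendsto ρ Y d) :
    MeanSquareTendsto ρ (fun N lam => X N lam + Y N lam) (c + d) := by
  have h1 : Tendsto (fun N => 2 * ∑' lam, ρ N lam * ENNReal.ofReal ((X N lam - c) ^ 2) +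
      2 * ∑' lam, ρ N lam * ENNReal.ofReal ((Y N lam - d) ^ 2)) atTop (𝓝 0) := by
    have := (ENNReal.Tendsto.const_mul (a := 2) hX (Or.inr ENNReal.ofNat_ne_top)).add
      (ENNReal.Tendsto.const_mul (a := 2) hY (Or.inr ENNReal.ofNat_ne_top))
    simpa using this
  refine tendsto_of_tendsto_of_tendsto_of_le_of_le tendsto_const_nhds h1 (fun _ => zero_le)
    fun N => ?_
  simp only
  rw [← ENNReal.tsum_mul_left, ← ENNReal.tsum_mul_left, ← ENNReal.tsum_add]
  refine ENNReal.tsum_le_tsum fun lam => ?_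
  have h2 : ENNReal.ofReal ((X N lam + Y N lam - (c + d)) ^ 2) ≤
      2 * ENNReal.ofReal ((X N lam - c) ^ 2) + 2 * ENNReal.ofReal ((Y N lam - d) ^ 2) := by
    have h3 : (2 : ENNReal) = ENNReal.ofReal 2 := by simp
    rw [h3, ← ENNReal.ofReal_mul zero_le_two, ← ENNReal.ofReal_mul zero_le_two,
      ← ENNReal.ofReal_add (by positivity) (by positivity)]
    refine ENNReal.ofReal_le_ofReal ?_
    nlinarith [sq_nonneg ((X N lam - c) - (Y N lam - d))]
  refine (mul_le_mul_right h2 (ρ N lam)).trans (le_of_eq ?_)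
  ring

theorem MeanSquareTendsto.smul_of_tendsto_zero {ρ : ∀ N : ℕ, PMF (Signature N)}
    {X : ∀ N : ℕ, Signature N → ℝ} {c : ℝ} (hX : MeanSquareTendsto ρ X c) {t : ℕ → ℝ}
    (ht : Tendsto t atTop (𝓝 0)) : MeanSquareTendsto ρ (fun N lam => t N * X N lam) 0 := by
  have ht' : Tendsto (fun N => ENNReal.ofReal (2 * t N ^ 2)) atTop (𝓝 0) := by
    have := ENNReal.tendsto_ofReal ((ht.pow 2).const_mul 2)
    simpa using this
  have h1 : Tendsto (fun N => ENNReal.ofReal (2 * t N ^ 2) *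
      ((∑' lam, ρ N lam * ENNReal.ofReal ((X N lam - c) ^ 2)) + ENNReal.ofReal (c ^ 2))) atTop
      (𝓝 0) := by
    have := ENNReal.Tendsto.mul ht' (Or.inr (by simp)) (hX.add_const (ENNReal.ofReal (c ^ 2)))
      (Or.inr ENNReal.zero_ne_top)
    simpa using this
  refine tendsto_of_tendsto_of_tendsto_of_le_of_le tendsto_const_nhds h1 (fun _ => zero_le)
    fun N => ?_
  simp only
  have h2 : ENNReal.ofReal (c ^ 2) = ∑' lam, ρ N lam * ENNReal.ofReal (c ^ 2) := by
    rw [ENNReal.tsum_mul_right, (ρ N).tsum_coe, one_mul]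
  rw [h2, ← ENNReal.tsum_add, ← ENNReal.tsum_mul_left]
  refine ENNReal.tsum_le_tsum fun lam => ?_
  have h3 : ENNReal.ofReal ((t N * X N lam - 0) ^ 2) ≤ ENNReal.ofReal (2 * t N ^ 2) *
      (ENNReal.ofReal ((X N lam - c) ^ 2) + ENNReal.ofReal (c ^ 2)) := by
    rw [← ENNReal.ofReal_add (by positivity) (by positivity),
      ← ENNReal.ofReal_mul (by positivity)]
    refine ENNReal.ofReal_le_ofReal ?_
    nlinarith [mul_nonneg (sq_nonneg (t N)) (sq_nonneg (X N lam - c - c))]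
  refine (mul_le_mul_right h3 (ρ N lam)).trans (le_of_eq ?_)
  ring

/-- Chebyshev's inequality. -/
theorem MeanSquareTendsto.tendsto_toMeasure {ρ : ∀ N : ℕ, PMF (Signature N)}
    {X : ∀ N : ℕ, Signature N → ℝ} {c : ℝ} (hX : MeanSquareTendsto ρ X c) {ε : ℝ} (hε : 0 < ε) :
    Tendsto (fun N => (ρ N).toMeasure {lam | ε ≤ |X N lam - c|}) atTop (𝓝 0) := by
  have h1 : Tendsto (fun N => ENNReal.ofReal ((ε ^ 2)⁻¹) *
      ∑' lam, ρ N lam * ENNReal.ofReal ((X N lam - c) ^ 2)) atTop (𝓝 0) := by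
    have := ENNReal.Tendsto.const_mul hX (Or.inr (ENNReal.ofReal_ne_top (r := (ε ^ 2)⁻¹)))
    simpa using this
  refine tendsto_of_tendsto_of_tendsto_of_le_of_le tendsto_const_nhds h1 (fun _ => zero_le)
    fun N => ?_
  simp only
  rw [PMF.toMeasure_apply _ MeasurableSpace.measurableSet_top, ← ENNReal.tsum_mul_left]
  refine ENNReal.tsum_le_tsum fun lam => ?_
  by_cases h : ε ≤ |X N lam - c|
  · rw [Set.indicator_of_mem (by exact h), mul_left_comm, ← ENNReal.ofReal_mul (by positivity)]
    have h2 : 1 ≤ (ε ^ 2)⁻¹ * (X N lam - c) ^ 2 := by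
      rw [inv_mul_eq_div, one_le_div (by positivity), ← sq_abs (X N lam - c)]
      exact pow_le_pow_left₀ hε.le h 2
    calc ρ N lam = ρ N lam * 1 := (mul_one _).symm
      _ ≤ _ := mul_le_mul_right (by rw [← ENNReal.ofReal_one]; exact ENNReal.ofReal_le_ofReal h2) _
  · rw [Set.indicator_of_notMem (by exact h)]
    exact zero_le

/-- The first two moments of the factorial moment converge to `c` and `c ^ 2`, so its mean square
deviation from `c` tends to `0`. The limit is real because the expectations are. -/
theorem meanSquareTendsto_factorialMoment {ρ : ∀ N : ℕ, PMF (Signature N)}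
    (hS : ∀ N : ℕ, 1 ≤ N → HasSchurGF (ρ N)) {ψ : PowerSeries ℂ} (hψ : LogDerivTendsto ρ ψ)
    (k : ℕ) : (limitMoment ψ k).im = 0 ∧
      MeanSquareTendsto ρ (fun _ lam => lam.factorialMoment k) (limitMoment ψ k).re := by
  obtain ⟨h1, h2⟩ := tendsto_factorialMoment hS hψ k
  have e1 : ∀ N, ∑' lam, (ρ N).weight lam * (lam.factorialMoment k : ℂ) =
      ((∑' lam, ((ρ N) lam).toReal * lam.factorialMoment k : ℝ) : ℂ) := fun N => by
    rw [Complex.ofReal_tsum]; simp [PMF.weight]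
  have e2 : ∀ N, ∑' lam, (ρ N).weight lam * (lam.factorialMoment k : ℂ) *
      (lam.factorialMoment k : ℂ) =
      ((∑' lam, ((ρ N) lam).toReal * lam.factorialMoment k * lam.factorialMoment k : ℝ) : ℂ) :=
    fun N => by rw [Complex.ofReal_tsum]; simp [PMF.weight]
  simp only [e1] at h1
  simp only [e2] at h2
  have him : (limitMoment ψ k).im = 0 := by
    have := (Complex.continuous_im.tendsto _).comp h1
    simp only [Function.comp_def, Complex.ofReal_im] at this
    exact (tendsto_nhds_unique tendsto_const_nhds this).symm
  set c := (limitMoment ψ k).re with hc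
  have hcc : limitMoment ψ k = (c : ℂ) := Complex.ext (by simp [hc]) (by simp [him])
  refine ⟨him, ?_⟩
  have h1' := (Complex.continuous_re.tendsto _).comp h1
  have h2' := (Complex.continuous_re.tendsto _).comp h2
  rw [hcc] at h1' h2'
  simp only [Function.comp_def, Complex.ofReal_re, ← Complex.ofReal_pow] at h1' h2'
  have h3 : Tendsto (fun N => ENNReal.ofReal
      ((∑' lam, ((ρ N) lam).toReal * lam.factorialMoment k * lam.factorialMoment k) -
        2 * c * (∑' lam, ((ρ N) lam).toReal * lam.factorialMoment k) + c ^ 2)) atTop (𝓝 0) := by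
    have := ENNReal.tendsto_ofReal ((h2'.sub (h1'.const_mul (2 * c))).add_const (c ^ 2))
    convert this using 2
    rw [← ENNReal.ofReal_zero]; congr 1; ring
  refine h3.congr' ?_
  filter_upwards [eventually_ge_atTop 1] with N hN
  have hw := (hS N hN).coeffSummable
  have s0 : HasSum (fun lam => ((ρ N) lam).toReal) 1 := by
    have := (ρ N).tsum_coe
    have h4 := ENNReal.hasSum_toReal (f := fun lam => ρ N lam) (by rw [this]; simp)
    rwa [← ENNReal.tsum_toReal_eq fun lam => (ρ N).apply_ne_top lam, this, ENNReal.toReal_one] at h4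
  have s1 : Summable fun lam => ((ρ N) lam).toReal * lam.factorialMoment k := by
    have := (hw.mul_factorialMoment k).summable
    rw [← Complex.summable_ofReal]; simpa [PMF.weight] using this
  have s2 : Summable fun lam => ((ρ N) lam).toReal * lam.factorialMoment k *
      lam.factorialMoment k := by
    have := ((hw.mul_factorialMoment k).mul_factorialMoment k).summable
    rw [← Complex.summable_ofReal]; simpa [PMF.weight] using this
  have s3 : HasSum (fun lam => ((ρ N) lam).toReal * (lam.factorialMoment k - c) ^ 2)
      ((∑' lam, ((ρ N) lam).toReal * lam.factorialMoment k * lam.factorialMoment k) -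
        2 * c * (∑' lam, ((ρ N) lam).toReal * lam.factorialMoment k) + c ^ 2) := by
    have := (s2.hasSum.sub (s1.hasSum.mul_left (2 * c))).add (s0.mul_right (c ^ 2))
    rw [one_mul] at this
    refine this.congr_fun ?_
    intro lam; ring
  rw [← s3.tsum_eq, ENNReal.ofReal_tsum_of_nonneg (fun lam => by positivity) s3.summable]
  refine tsum_congr fun lam => ?_
  rw [ENNReal.ofReal_mul ENNReal.toReal_nonneg, ENNReal.ofReal_toReal ((ρ N).apply_ne_top lam)]

/-! ### From factorial power sums to moments of the empirical measure -/

/-- The mixed power sum `N⁻¹ ∑_i (l_i / N)^a · l_i (l_i - 1) ⋯ (l_i - b + 1) / N^b`. -/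
def Signature.mixedMoment {N : ℕ} (a b : ℕ) (lam : Signature N) : ℝ :=
  (N : ℝ)⁻¹ * ∑ i, ((lam.coord i : ℝ) / N) ^ a *
    (((descPochhammer ℤ b).eval (lam.coord i) : ℤ) : ℝ) / (N : ℝ) ^ b

theorem Signature.mixedMoment_zero_left {N : ℕ} (b : ℕ) (lam : Signature N) :
    lam.mixedMoment 0 b = lam.factorialMoment b := by
  rw [Signature.mixedMoment, Signature.factorialMoment, Signature.factorialSum]
  simp only [pow_zero, one_mul]
  rw [← Finset.sum_div]
  rw [Int.cast_sum, pow_succ']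
  field_simp

theorem Signature.mixedMoment_succ {N : ℕ} (hN : N ≠ 0) (a b : ℕ) (lam : Signature N) :
    lam.mixedMoment (a + 1) b = lam.mixedMoment a (b + 1) +
      ((b : ℝ) / N) * lam.mixedMoment a b := by
  have hN' : (N : ℝ) ≠ 0 := Nat.cast_ne_zero.mpr hN
  simp only [Signature.mixedMoment]
  rw [mul_left_comm ((b : ℝ) / N), ← mul_add, Finset.mul_sum _ _ ((b : ℝ) / N),
    ← Finset.sum_add_distrib]
  congr 1
  refine Finset.sum_congr rfl fun i _ => ?_
  have h1 : (((descPochhammer ℤ (b + 1)).eval (lam.coord i) : ℤ) : ℝ) =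
      (((descPochhammer ℤ b).eval (lam.coord i) : ℤ) : ℝ) *
        ((lam.coord i : ℝ) / N * N - b) := by
    rw [descPochhammer_succ_eval, div_mul_cancel₀ _ hN', Int.cast_mul, Int.cast_sub,
      Int.cast_natCast]
  rw [h1]
  generalize (lam.coord i : ℝ) / N = y
  field_simp
  ring

theorem integral_empiricalMeasure {N : ℕ} (lam : Signature N) (g : ℝ → ℝ) :
    ∫ x, g x ∂(empiricalMeasure lam) = (N : ℝ)⁻¹ * ∑ i, g ((lam.coord i : ℝ) / N) := by
  rw [empiricalMeasure, integral_smul_measure, integral_finsetSum_measure]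
  · simp [integral_dirac]
  · intro i _
    exact integrable_dirac (by simp)

theorem Signature.mixedMoment_zero_right {N : ℕ} (k : ℕ) (lam : Signature N) :
    lam.mixedMoment k 0 = ∫ x, x ^ k ∂(empiricalMeasure lam) := by
  rw [integral_empiricalMeasure, Signature.mixedMoment]
  simp

/-- The recursion `mixedMoment_succ` replaces falling factorials by powers at the cost of a term
with a factor `b / N`, which disappears in the limit. -/
theorem meanSquareTendsto_moment {ρ : ∀ N : ℕ, PMF (Signature N)}
    (hS : ∀ N : ℕ, 1 ≤ N → HasSchurGF (ρ N)) {ψ : PowerSeries ℂ} (hψ : LogDerivTendsto ρ ψ)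
    (k : ℕ) : MeanSquareTendsto ρ (fun _ lam => ∫ x, x ^ k ∂(empiricalMeasure lam))
      (limitMoment ψ k).re := by
  have key : ∀ a b : ℕ, MeanSquareTendsto ρ (fun _ lam => lam.mixedMoment a b)
      (limitMoment ψ (a + b)).re := by
    intro a
    induction a with
    | zero =>
      intro b
      simp only [Signature.mixedMoment_zero_left, zero_add]
      exact (meanSquareTendsto_factorialMoment hS hψ b).2
    | succ a ih =>
      intro b
      have h1 := (ih (b + 1)).add ((ih b).smul_of_tendsto_zero
        (tendsto_const_div_atTop_nhds_zero_nat (b : ℝ)))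
      rw [add_zero, ← add_assoc, add_right_comm] at h1
      refine h1.congr ?_
      filter_upwards [eventually_ne_atTop 0] with N hN
      funext lam
      exact (lam.mixedMoment_succ hN a b).symm
  have := key k 0
  simpa only [Signature.mixedMoment_zero_right, add_zero] using this

/-! ### Existence of the limit measure -/

/-- The function `x ↦ x^k` truncated outside `[-R, R]`. -/
def truncPow (R : ℝ) (k : ℕ) : BoundedContinuousFunction ℝ ℝ :=
  BoundedContinuousFunction.ofNormedAddCommGroup (fun x => (max (-R) (min R x)) ^ k)
    (by fun_prop) (|R| ^ k) (fun x => by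
      rw [norm_pow, Real.norm_eq_abs]
      refine pow_le_pow_left₀ (abs_nonneg _) ?_ k
      rcases le_total 0 R with h | h
      · rw [abs_of_nonneg h, abs_le]
        exact ⟨le_max_left _ _, max_le (by linarith) (min_le_left _ _)⟩
      · rw [abs_of_nonpos h, abs_le]
        refine ⟨by linarith [le_max_left (-R) (min R x)], max_le le_rfl ?_⟩
        linarith [min_le_left R x])

theorem truncPow_apply (R : ℝ) (k : ℕ) (x : ℝ) : truncPow R k x = (max (-R) (min R x)) ^ k := rfl

/-- The exponent `2 (k + 1)` is even, so that its moments are those of a nonnegative function, and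
leaves a negative power of `R` even for `k = 0`. -/
theorem abs_pow_sub_truncPow_le {R : ℝ} (hR : 0 < R) (k : ℕ) (x : ℝ) :
    |x ^ k - truncPow R k x| ≤ 2 / R ^ (k + 2) * x ^ (2 * (k + 1)) := by
  have hpos : 0 ≤ 2 / R ^ (k + 2) * x ^ (2 * (k + 1)) := by
    rw [pow_mul]; positivity
  rw [truncPow_apply]
  rcases le_or_gt |x| R with h | h
  · rw [abs_le] at h
    rw [min_eq_right h.2, max_eq_right h.1, sub_self, abs_zero]
    exact hpos
  · have h1 : |max (-R) (min R x)| ≤ |x| := by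
      refine le_trans ?_ h.le
      rw [abs_le]
      exact ⟨le_max_left _ _, max_le (by linarith) (min_le_left _ _)⟩
    have h2 : |x ^ k - (max (-R) (min R x)) ^ k| ≤ 2 * |x| ^ k := by
      refine (abs_sub _ _).trans ?_
      rw [abs_pow, abs_pow]
      have := pow_le_pow_left₀ (abs_nonneg _) h1 k
      linarith
    refine h2.trans ?_
    have h3 : R ^ (k + 2) ≤ |x| ^ (k + 2) := pow_le_pow_left₀ hR.le h.le _
    have h4 : x ^ (2 * (k + 1)) = |x| ^ k * |x| ^ (k + 2) := by
      rw [← pow_add, ← (even_two_mul (k + 1)).pow_abs]; congr 1; ring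
    rw [h4, div_mul_eq_mul_div, le_div_iff₀ (by positivity), mul_assoc]
    gcongr

theorem abs_integral_pow_sub_truncPow_le {ν : Measure ℝ} [IsProbabilityMeasure ν]
    {R : ℝ} (hR : 0 < R) (k : ℕ) (h1 : Integrable (fun x : ℝ => x ^ k) ν)
    (h2 : Integrable (fun x : ℝ => x ^ (2 * (k + 1))) ν) :
    |(∫ x, x ^ k ∂ν) - ∫ x, truncPow R k x ∂ν| ≤
      2 / R ^ (k + 2) * ∫ x, x ^ (2 * (k + 1)) ∂ν := by
  have h3 : Integrable (truncPow R k) ν := (truncPow R k).integrable ν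
  rw [← integral_sub h1 h3, ← integral_const_mul]
  refine (abs_integral_le_integral_abs).trans ?_
  exact integral_mono (h1.sub h3).abs (h2.const_mul _) fun x => abs_pow_sub_truncPow_le hR k x

theorem isTightMeasureSet_of_second_moment {ν : ℕ → ProbabilityMeasure ℝ} {B : ℝ}
    (h1 : ∀ n, Integrable (fun x : ℝ => x ^ 2) (ν n : Measure ℝ))
    (h2 : ∀ n, ∫ x, x ^ 2 ∂(ν n : Measure ℝ) ≤ B) :
    IsTightMeasureSet (Set.range fun n => (ν n : Measure ℝ)) := by
  refine isTightMeasureSet_of_tendsto_measure_norm_gt ?_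
  have h3 : Tendsto (fun r : ℝ => ENNReal.ofReal (B / r ^ 2)) atTop (𝓝 0) := by
    have : Tendsto (fun r : ℝ => B / r ^ 2) atTop (𝓝 0) :=
      Tendsto.div_atTop tendsto_const_nhds (tendsto_pow_atTop two_ne_zero)
    simpa using ENNReal.tendsto_ofReal this
  refine tendsto_of_tendsto_of_tendsto_of_le_of_le' tendsto_const_nhds h3
    (Eventually.of_forall fun _ => zero_le) ?_
  filter_upwards [eventually_gt_atTop 0] with r hr
  refine iSup₂_le ?_
  rintro _ ⟨n, rfl⟩
  have h4 := mul_meas_ge_le_integral_of_nonneg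
    (Eventually.of_forall fun x : ℝ => sq_nonneg x) (h1 n) (r ^ 2)
  have h5 : {x : ℝ | r < ‖x‖} ⊆ {x : ℝ | r ^ 2 ≤ x ^ 2} := by
    intro x hx
    rw [Set.mem_ofPred_eq, ← sq_abs x]
    exact pow_le_pow_left₀ hr.le (le_of_lt hx) 2
  refine (measure_mono h5).trans ?_
  rw [← ENNReal.ofReal_toReal (measure_ne_top (ν n : Measure ℝ) _)]
  refine ENNReal.ofReal_le_ofReal ?_
  rw [le_div_iff₀ (by positivity), mul_comm]
  exact h4.trans (h2 n)

/-- Bounds on even moments pass to weak limits: they do so for the truncated powers, which increase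
to the full power. -/
theorem integrable_pow_of_tendsto {U : Filter ℕ} [U.NeBot] {ν : ℕ → ProbabilityMeasure ℝ}
    {μ : ProbabilityMeasure ℝ} (hμ : Tendsto ν U (𝓝 μ)) (k : ℕ) {B : ℝ}
    (h1 : ∀ n, Integrable (fun x : ℝ => x ^ (2 * k)) (ν n : Measure ℝ))
    (h2 : ∀ n, ∫ x, x ^ (2 * k) ∂(ν n : Measure ℝ) ≤ B) :
    Integrable (fun x : ℝ => x ^ (2 * k)) (μ : Measure ℝ) ∧
      ∫ x, x ^ (2 * k) ∂(μ : Measure ℝ) ≤ B := by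
  have hB : 0 ≤ B := le_trans (integral_nonneg fun x => by rw [Pi.zero_apply, pow_mul]; positivity)
    (h2 0)
  have hnn : ∀ (R x : ℝ), 0 ≤ truncPow R (2 * k) x := fun R x => by
    rw [truncPow_apply, pow_mul]; positivity
  have habs : ∀ (R x : ℝ), 0 ≤ R → |max (-R) (min R x)| = min R |x| := by
    intro R x hR
    rcases le_total |x| R with h | h
    · rw [min_eq_right h]
      rw [abs_le] at h
      rw [min_eq_right h.2, max_eq_right h.1]
    · rw [min_eq_left h]
      rcases le_abs.mp h with h | h
      · rw [min_eq_left h, max_eq_right (by linarith), abs_of_nonneg hR]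
      · rw [min_eq_right (by linarith), max_eq_left (by linarith), abs_neg, abs_of_nonneg hR]
  have hval : ∀ (R x : ℝ), 0 ≤ R → truncPow R (2 * k) x = (min R |x|) ^ (2 * k) := fun R x hR => by
    rw [truncPow_apply, ← (even_two_mul k).pow_abs, habs R x hR]
  have hR : ∀ R : ℕ, ∫⁻ x, ENNReal.ofReal (truncPow R (2 * k) x) ∂(μ : Measure ℝ) ≤
      ENNReal.ofReal B := by
    intro R
    rw [← ofReal_integral_eq_lintegral_ofReal ((truncPow R (2 * k)).integrable _)
      (Eventually.of_forall (hnn R))]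
    refine ENNReal.ofReal_le_ofReal ?_
    refine le_of_tendsto ((ProbabilityMeasure.tendsto_iff_forall_integral_tendsto.mp hμ)
      (truncPow R (2 * k))) (Eventually.of_forall fun n => ?_)
    refine le_trans (integral_mono ((truncPow R (2 * k)).integrable _) (h1 n) fun x => ?_) (h2 n)
    simp only
    rw [hval _ _ (Nat.cast_nonneg R), ← (even_two_mul k).pow_abs x]
    exact pow_le_pow_left₀ (le_min (Nat.cast_nonneg R) (abs_nonneg x)) (min_le_right _ _) _
  have hlim : ∫⁻ x, ENNReal.ofReal (x ^ (2 * k)) ∂(μ : Measure ℝ) ≤ ENNReal.ofReal B := by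
    refine le_of_tendsto' (lintegral_tendsto_of_tendsto_of_monotone
      (f := fun (R : ℕ) x => ENNReal.ofReal (truncPow R (2 * k) x)) (fun R => ?_) ?_ ?_) hR
    · exact ((truncPow R (2 * k)).continuous.measurable.ennreal_ofReal).aemeasurable
    · refine Eventually.of_forall fun x R R' h => ENNReal.ofReal_le_ofReal ?_
      rw [hval _ _ (Nat.cast_nonneg R), hval _ _ (Nat.cast_nonneg R')]
      exact pow_le_pow_left₀ (le_min (Nat.cast_nonneg R) (abs_nonneg x))
        (min_le_min_right _ (Nat.cast_le.mpr h)) _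
    · refine Eventually.of_forall fun x => tendsto_const_nhds.congr' ?_
      filter_upwards [eventually_ge_atTop ⌈|x|⌉₊] with R hR
      rw [hval _ _ (Nat.cast_nonneg R), min_eq_right (Nat.ceil_le.mp hR), (even_two_mul k).pow_abs]
  have hnn' : 0 ≤ᵐ[(μ : Measure ℝ)] fun x : ℝ => x ^ (2 * k) :=
    Eventually.of_forall fun x => by simp only [Pi.zero_apply, pow_mul]; positivity
  have hint : Integrable (fun x : ℝ => x ^ (2 * k)) (μ : Measure ℝ) := by
    refine ⟨by fun_prop, ?_⟩
    rw [hasFiniteIntegral_iff_ofReal hnn']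
    exact hlim.trans_lt ENNReal.ofReal_lt_top
  refine ⟨hint, ?_⟩
  rw [← ofReal_integral_eq_lintegral_ofReal hint hnn'] at hlim
  exact (ENNReal.ofReal_le_ofReal_iff hB).mp hlim

theorem integrable_pow_of_even {μ : Measure ℝ} [IsProbabilityMeasure μ] {k : ℕ}
    (h : Integrable (fun x : ℝ => x ^ (2 * k)) μ) : Integrable (fun x : ℝ => x ^ k) μ := by
  refine ((integrable_const (1 : ℝ)).add h).mono' (by fun_prop) (Eventually.of_forall fun x => ?_)
  rw [Real.norm_eq_abs, Pi.add_apply, mul_comm 2 k, pow_mul]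
  nlinarith [sq_nonneg (|x ^ k| - 1), sq_abs (x ^ k), abs_nonneg (x ^ k)]

/-- Limits of moment sequences of probability measures are moment sequences. -/
theorem exists_probabilityMeasure_moments (ν : ℕ → ProbabilityMeasure ℝ) (c : ℕ → ℝ)
    (h1 : ∀ k n, Integrable (fun x : ℝ => x ^ k) (ν n : Measure ℝ))
    (h2 : ∀ k, Tendsto (fun n => ∫ x, x ^ k ∂(ν n : Measure ℝ)) atTop (𝓝 (c k))) :
    ∃ μ : ProbabilityMeasure ℝ, ∀ k, Integrable (fun x : ℝ => x ^ k) (μ : Measure ℝ) ∧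
      ∫ x, x ^ k ∂(μ : Measure ℝ) = c k := by
  have hb : ∀ k, ∃ B, ∀ n, ∫ x, x ^ k ∂(ν n : Measure ℝ) ≤ B := fun k => by
    obtain ⟨B, hB⟩ := (h2 k).bddAbove_range
    exact ⟨B, fun n => hB ⟨n, rfl⟩⟩
  choose B hB using hb
  have htight : IsTightMeasureSet {x : Measure ℝ | ∃ μ ∈ Set.range ν, (μ : Measure ℝ) = x} := by
    convert isTightMeasureSet_of_second_moment (h1 2) (hB 2) using 1
    ext x; simp
  have hcomp := isCompact_closure_of_isTightMeasureSet htight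
  -- A limit along an ultrafilter avoids the choice of a weakly convergent subsequence.
  set U : Ultrafilter ℕ := hyperfilter ℕ with hU
  have hUle : (U : Filter ℕ) ≤ atTop := Nat.hyperfilter_le_atTop
  obtain ⟨μ, -, hμ⟩ := hcomp.ultrafilter_le_nhds (U.map ν) (by
    rw [le_principal_iff]
    exact Filter.mem_of_superset (Filter.range_mem_map) subset_closure)
  have hμ' : Tendsto ν U (𝓝 μ) := hμ
  have heven := fun k => integrable_pow_of_tendsto hμ' k (h1 (2 * k)) (hB (2 * k))
  refine ⟨μ, fun k => ⟨integrable_pow_of_even (heven k).1, ?_⟩⟩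
  have hint : Integrable (fun x : ℝ => x ^ k) (μ : Measure ℝ) := integrable_pow_of_even (heven k).1
  set D := B (2 * (k + 1)) with hD
  have key : ∀ R : ℝ, 0 < R → |(∫ x, x ^ k ∂(μ : Measure ℝ)) - c k| ≤ 4 * D / R ^ (k + 2) := by
    intro R hR
    have e1 := abs_integral_pow_sub_truncPow_le hR k hint (heven (k + 1)).1
    have e2 : |c k - ∫ x, truncPow R k x ∂(μ : Measure ℝ)| ≤ 2 / R ^ (k + 2) * D := by
      have ht := (((h2 k).mono_left hUle).sub
        ((ProbabilityMeasure.tendsto_iff_forall_integral_tendsto.mp hμ') (truncPow R k))).abs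
      refine le_of_tendsto ht (Eventually.of_forall fun n => ?_)
      refine (abs_integral_pow_sub_truncPow_le hR k (h1 k n) (h1 _ n)).trans ?_
      exact mul_le_mul_of_nonneg_left (hB _ n) (by positivity)
    have e3 : 2 / R ^ (k + 2) * ∫ x, x ^ (2 * (k + 1)) ∂(μ : Measure ℝ) ≤ 2 / R ^ (k + 2) * D :=
      mul_le_mul_of_nonneg_left (heven (k + 1)).2 (by positivity)
    rw [abs_sub_comm] at e2
    refine (abs_sub_le _ (∫ x, truncPow R k x ∂(μ : Measure ℝ)) _).trans ?_
    have : 4 * D / R ^ (k + 2) = 2 / R ^ (k + 2) * D + 2 / R ^ (k + 2) * D := by ring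
    linarith
  have hlim : Tendsto (fun R : ℝ => 4 * D / R ^ (k + 2)) atTop (𝓝 0) :=
    Tendsto.div_atTop tendsto_const_nhds (tendsto_pow_atTop (by omega))
  have h0 : |(∫ x, x ^ k ∂(μ : Measure ℝ)) - c k| ≤ 0 :=
    ge_of_tendsto hlim ((eventually_gt_atTop 0).mono key)
  exact sub_eq_zero.mp (abs_nonpos_iff.mp h0)

theorem isProbabilityMeasure_empiricalMeasure {N : ℕ} (hN : N ≠ 0) (lam : Signature N) :
    IsProbabilityMeasure (empiricalMeasure lam) := by
  refine ⟨?_⟩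
  rw [empiricalMeasure, Measure.smul_apply, Measure.finsetSum_apply]
  simp only [measure_univ, Finset.sum_const, Finset.card_univ, Fintype.card_fin, nsmul_eq_mul,
    mul_one, smul_eq_mul]
  exact ENNReal.inv_mul_cancel (Nat.cast_ne_zero.mpr hN) (ENNReal.natCast_ne_top N)

theorem integrable_empiricalMeasure {N : ℕ} (hN : N ≠ 0) (lam : Signature N) (g : ℝ → ℝ) :
    Integrable g (empiricalMeasure lam) := by
  refine Integrable.smul_measure ?_ (ENNReal.inv_ne_top.mpr (Nat.cast_ne_zero.mpr hN))
  exact integrable_finsetSum_measure.mpr fun i _ => integrable_dirac (by simp)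

/-- Numbers which are limits in probability of the moments of random empirical measures are the
moments of a probability measure. -/
theorem exists_convergesInMoments {ρ : ∀ N : ℕ, PMF (Signature N)} {c : ℕ → ℝ}
    (h : ∀ k, MeanSquareTendsto ρ (fun _ lam => ∫ x, x ^ k ∂(empiricalMeasure lam)) (c k)) :
    ∃ μ : Measure ℝ, IsProbabilityMeasure μ ∧ ConvergesInMoments ρ μ ∧
      ∀ k, ∫ x, x ^ k ∂μ = c k := by
  -- For each `K`, with positive probability the first `K` moments are close to their limits; any
  -- signature for which this happens provides a deterministic measure.
  have hsel : ∀ K : ℕ, ∃ ν : ProbabilityMeasure ℝ,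
      (∀ k, Integrable (fun x : ℝ => x ^ k) (ν : Measure ℝ)) ∧
      ∀ k ≤ K, |(∫ x, x ^ k ∂(ν : Measure ℝ)) - c k| < 1 / ((K : ℝ) + 1) := by
    intro K
    set A : ℕ → ∀ N, Set (Signature N) := fun k N =>
      {lam | 1 / ((K : ℝ) + 1) ≤ |(∫ x, x ^ k ∂(empiricalMeasure lam)) - c k|} with hA
    have h1 : Tendsto (fun N => ∑ k ∈ Finset.range (K + 1), (ρ N).toMeasure (A k N)) atTop
        (𝓝 0) := by
      have := tendsto_finsetSum (Finset.range (K + 1)) fun k _ =>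
        (h k).tendsto_toMeasure (ε := 1 / ((K : ℝ) + 1)) (by positivity)
      rwa [Finset.sum_const_zero] at this
    -- By the union bound the exceptional events do not exhaust the probability space.
    obtain ⟨N, hN1, hN⟩ := ((h1.eventually_lt_const (zero_lt_one)).and
      (eventually_ne_atTop 0)).exists
    have h2 : (⋃ k ∈ Finset.range (K + 1), A k N) ≠ Set.univ := by
      intro h3
      have h4 := measure_biUnion_finset_le (μ := (ρ N).toMeasure) (Finset.range (K + 1))
        fun k => A k N
      rw [h3, measure_univ] at h4
      exact absurd (h4.trans_lt hN1) (lt_irrefl _)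
    obtain ⟨lam, hlam⟩ := (Set.ne_univ_iff_exists_notMem _).mp h2
    refine ⟨⟨empiricalMeasure lam, isProbabilityMeasure_empiricalMeasure hN lam⟩,
      fun k => integrable_empiricalMeasure hN lam _, fun k hk => ?_⟩
    by_contra h5
    refine hlam (Set.mem_biUnion (x := k) ?_ (not_lt.mp h5))
    simpa [Nat.lt_succ_iff] using hk
  choose ν hν1 hν2 using hsel
  obtain ⟨μ, hμ⟩ := exists_probabilityMeasure_moments ν c (fun k n => hν1 n k) fun k => by
    rw [tendsto_iff_dist_tendsto_zero]
    refine tendsto_of_tendsto_of_tendsto_of_le_of_le' tendsto_const_nhds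
      (tendsto_one_div_add_atTop_nhds_zero_nat (𝕜 := ℝ)) (Eventually.of_forall fun _ => dist_nonneg)
      ?_
    filter_upwards [eventually_ge_atTop k] with K hK
    rw [Real.dist_eq]
    exact (hν2 K k hK).le
  refine ⟨μ, inferInstance, fun k => ⟨(hμ k).1, fun ε hε => ?_⟩, fun k => (hμ k).2⟩
  rw [(hμ k).2]
  exact (h k).tendsto_toMeasure hε

/-! ### Formulas for the limiting moments -/

theorem inVar_injective {N : ℕ} (i : Fin N) : Function.Injective (inVar i) := by
  intro φ ψ h
  ext n
  rw [← coeff_single_inVar i, h, coeff_single_inVar]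

theorem taylorSeries_mul {φ χ : ℂ → ℂ} (hφ : AnalyticAt ℂ φ 1) (hχ : AnalyticAt ℂ χ 1) :
    taylorSeries (fun x => φ x * χ x) = taylorSeries φ * taylorSeries χ := by
  refine inVar_injective (0 : Fin 1) ?_
  rw [map_mul, ← taylor_comp_proj 0 hφ, ← taylor_comp_proj 0 hχ,
    ← taylor_comp_proj 0 (hφ.fun_mul hχ)]
  exact taylor_mul (analyticAt_comp_proj 0 hφ) (analyticAt_comp_proj 0 hχ)

theorem taylorSeries_pow {φ : ℂ → ℂ} (hφ : AnalyticAt ℂ φ 1) (n : ℕ) :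
    taylorSeries (fun x => φ x ^ n) = taylorSeries φ ^ n := by
  refine inVar_injective (0 : Fin 1) ?_
  rw [map_pow, ← taylor_comp_proj 0 hφ, ← taylor_comp_proj 0 (hφ.fun_pow n)]
  exact taylor_pow (analyticAt_comp_proj 0 hφ) n

theorem taylorSeries_id : taylorSeries (fun x => x) = 1 + PowerSeries.X := by
  refine inVar_injective (0 : Fin 1) ?_
  rw [← taylor_comp_proj (φ := fun x => x) 0 analyticAt_id, taylor_proj, map_add, map_one, inVar_X]

theorem limitMoment_taylorSeries {f : ℂ → ℂ} (hf : AnalyticAt ℂ f 1) (k : ℕ) :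
    limitMoment (taylorSeries (deriv f)) k = productMoment f k := by
  rw [limitMoment, productMoment]
  refine Finset.sum_congr rfl fun l _ => ?_
  have h1 : (1 + PowerSeries.X) ^ k * taylorSeries (deriv f) ^ (k - l) =
      taylorSeries (fun x => x ^ k * deriv f x ^ (k - l)) := by
    rw [taylorSeries_mul (φ := fun x => x ^ k) (analyticAt_id.pow k) (hf.deriv.fun_pow _),
      taylorSeries_pow hf.deriv, taylorSeries_pow (φ := fun x => x) analyticAt_id, taylorSeries_id]
  have h2 := congrFun (iteratedDeriv_comp_const_add l
    (fun x : ℂ => x ^ k * deriv f x ^ (k - l)) 1) 0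
  rw [add_zero] at h2
  rw [h1, taylorSeries, PowerSeries.coeff_mk, h2, Nat.descFactorial_eq_factorial_mul_choose]
  have h3 : (l.factorial : ℂ) ≠ 0 := Nat.cast_ne_zero.mpr l.factorial_ne_zero
  have h4 : ((l + 1).factorial : ℂ) ≠ 0 := Nat.cast_ne_zero.mpr (l + 1).factorial_ne_zero
  push_cast
  field_simp

/-- Expanding the power `(1/z + f'(1+z))^{k+1}` turns the contour integral into a sum of
residues. -/
theorem eventually_contourMoment_eq {f : ℂ → ℂ} (hf : AnalyticAt ℂ f 1) (k : ℕ) :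
    ∀ᶠ ε in 𝓝[>] (0 : ℝ), contourMoment f k ε = productMoment f k := by
  set φ : ℂ → ℂ := fun z => deriv f (1 + z) with hφ
  have hφa : AnalyticAt ℂ φ 0 := by
    have h1 : AnalyticAt ℂ (deriv f) (1 + 0) := by rw [add_zero]; exact hf.deriv
    exact AnalyticAt.fun_comp (f := fun z : ℂ => 1 + z) h1 (by fun_prop)
  obtain ⟨δ, hδ, hball⟩ := Metric.eventually_nhds_iff_ball.mp hφa.eventually_analyticAt
  have hmem : Set.Ioo (0 : ℝ) (min δ 1) ∈ 𝓝[>] (0 : ℝ) := Ioo_mem_nhdsGT (by positivity)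
  filter_upwards [hmem] with ε hε
  have hε0 : 0 < ε := hε.1
  have hεδ : ε < δ := hε.2.trans_le (min_le_left _ _)
  have hε1 : ε < 1 := hε.2.trans_le (min_le_right _ _)
  have hsub : Metric.closedBall (0 : ℂ) ε ⊆ Metric.ball 0 δ := Metric.closedBall_subset_ball hεδ
  set h : ℕ → ℂ → ℂ := fun j z => (1 + z) ^ k * φ z ^ j with hh
  have hd : ∀ j, ∀ z ∈ Metric.closedBall (0 : ℂ) ε, DifferentiableAt ℂ (h j) z := by
    intro j z hz
    have := (hball z (hsub hz)).differentiableAt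
    simp only [hh]
    fun_prop
  have hc : ∀ j, ContinuousOn (h j) (Metric.closedBall 0 ε) := fun j z hz =>
    (hd j z hz).continuousAt.continuousWithinAt
  have hz0 : ∀ z ∈ Metric.sphere (0 : ℂ) ε, z ≠ 0 := by
    intro z hz h0
    rw [h0, mem_sphere_zero_iff_norm, norm_zero] at hz
    exact hε0.ne hz
  -- The first term has no pole; in the sum, the index is the order of the pole minus one.
  have hpow : ∀ z ∈ Metric.sphere (0 : ℂ) ε,
      (1 / (1 + z)) * (1 / z + 1 + (1 + z) * deriv f (1 + z)) ^ (k + 1) =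
      h (k + 1) z + ∑ l ∈ Finset.range (k + 1), ((k + 1).choose (l + 1) : ℂ) *
        ((1 / (z - 0) ^ (l + 1)) • h (k - l) z) := by
    intro z hz
    have hzne := hz0 z hz
    have hz1 : 1 + z ≠ 0 := by
      intro h0
      have : z = -1 := by linear_combination h0
      rw [this, mem_sphere_zero_iff_norm, norm_neg, norm_one] at hz
      exact hε1.ne hz.symm
    have e1 : 1 / z + 1 + (1 + z) * deriv f (1 + z) = (1 + z) * (1 / z + φ z) := by
      simp only [hφ]; field_simp
    have e2 : (1 / (1 + z)) * ((1 + z) * (1 / z + φ z)) ^ (k + 1) =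
        (1 + z) ^ k * (1 / z + φ z) ^ (k + 1) := by
      rw [mul_pow, pow_succ (1 + z)]; field_simp
    rw [e1, e2, add_pow (1 / z), Finset.sum_range_succ', mul_add, add_comm, Finset.mul_sum]
    congr 1
    · simp [hh]
    · refine Finset.sum_congr rfl fun l _ => ?_
      rw [Nat.add_sub_add_right, sub_zero, smul_eq_mul, one_div_pow]
      simp only [hh]
      ring
  have hint : ∀ l ∈ Finset.range (k + 1), CircleIntegrable (fun z =>
      ((k + 1).choose (l + 1) : ℂ) * ((1 / (z - 0) ^ (l + 1)) • h (k - l) z)) 0 ε := by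
    intro l _
    refine ContinuousOn.circleIntegrable hε0.le ?_
    refine continuousOn_const.mul (ContinuousOn.fun_smul ?_
      ((hc _).mono Metric.sphere_subset_closedBall))
    refine ContinuousOn.div continuousOn_const (by fun_prop) fun z hz => ?_
    rw [sub_zero]
    exact pow_ne_zero _ (hz0 z hz)
  have hint0 : CircleIntegrable (h (k + 1)) 0 ε :=
    ContinuousOn.circleIntegrable hε0.le ((hc _).mono Metric.sphere_subset_closedBall)
  have hzero : circleIntegral (h (k + 1)) 0 ε = 0 :=
    Complex.circleIntegral_eq_zero_of_differentiable_on_off_countable hε0.le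
      Set.countable_empty (hc _) fun z hz => hd _ z (Metric.ball_subset_closedBall hz.1)
  have hterm : ∀ l, circleIntegral (fun z =>
      ((k + 1).choose (l + 1) : ℂ) * ((1 / (z - 0) ^ (l + 1)) • h (k - l) z)) 0 ε =
      ((k + 1).choose (l + 1) : ℂ) * ((2 * (Real.pi : ℂ) * Complex.I / l.factorial) •
        iteratedDeriv l (h (k - l)) 0) := by
    intro l
    rw [← Complex.circleIntegral_one_div_sub_center_pow_smul_of_differentiable_on_off_countable
      hε0 l Set.countable_empty (hc (k - l))
      fun z hz => hd _ z (Metric.ball_subset_closedBall hz.1)]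
    exact circleIntegral.integral_const_mul _ _ _ _
  rw [contourMoment, circleIntegral.integral_congr hε0.le hpow,
    circleIntegral.integral_add hint0 (CircleIntegrable.fun_sum _ hint), hzero, zero_add,
    circleIntegral.integral_fun_sum hint, Finset.mul_sum, productMoment]
  refine Finset.sum_congr rfl fun l hl => ?_
  rw [hterm, smul_eq_mul]
  simp only [hh, hφ]
  generalize iteratedDeriv l (fun z : ℂ => (1 + z) ^ k * deriv f (1 + z) ^ (k - l)) 0 = D
  have h1 : ((k + 1).choose (l + 1) : ℂ) * ((l : ℂ) + 1) = ((k : ℂ) + 1) * (k.choose l : ℂ) := by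
    have := Nat.add_one_mul_choose_eq k l
    exact_mod_cast this.symm
  have h2 : ((k : ℂ) + 1) ≠ 0 := Nat.cast_add_one_ne_zero k
  have h3 : ((l : ℂ) + 1) ≠ 0 := Nat.cast_add_one_ne_zero l
  have h4 : (l.factorial : ℂ) ≠ 0 := Nat.cast_ne_zero.mpr l.factorial_ne_zero
  have h5 : (Real.pi : ℂ) ≠ 0 := Complex.ofReal_ne_zero.mpr Real.pi_ne_zero
  have h6 := Complex.I_ne_zero
  rw [Nat.factorial_succ]
  push_cast
  field_simp
  linear_combination D * h1

theorem iteratedDeriv_comp_mul_left (G : ℂ → ℂ) (c : ℂ) (n : ℕ) :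
    iteratedDeriv n (fun u => G (c * u)) = fun u => c ^ n * iteratedDeriv n G (c * u) := by
  induction n with
  | zero => simp
  | succ n ih =>
    ext u
    rw [iteratedDeriv_succ, ih, deriv_const_mul_field, deriv_comp_mul_left, iteratedDeriv_succ,
      smul_eq_mul, pow_succ]
    ring

/-- A function invariant under a rotation of order `l + 1` is constant to order `l`, hence does not
affect the derivatives of order `l` of its products. -/
theorem iteratedDeriv_mul_of_rotation_invariant {l : ℕ} {w : ℂ} (hw : IsPrimitiveRoot w (l + 1))
    {H G : ℂ → ℂ} (hH : AnalyticAt ℂ H 0) (hG : AnalyticAt ℂ G 0) (hG0 : G 0 = 1)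
    (hinv : ∀ u, G (w * u) = G u) :
    iteratedDeriv l (fun u => H u * G u) 0 = iteratedDeriv l H 0 := by
  have h1 : ∀ i, i ≠ 0 → i ≤ l → iteratedDeriv i G 0 = 0 := by
    intro i hi hil
    have h2 := congrFun (iteratedDeriv_comp_mul_left G w i) 0
    simp only [hinv, mul_zero] at h2
    have h3 : w ^ i ≠ 1 := hw.pow_ne_one_of_pos_of_lt hi (by omega)
    have h4 : (w ^ i - 1) * iteratedDeriv i G 0 = 0 := by linear_combination -h2
    exact (mul_eq_zero.mp h4).resolve_left (sub_ne_zero.mpr h3)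
  have h5 := iteratedDeriv_mul (n := l) (hH.contDiffAt (n := l)) (hG.contDiffAt (n := l))
  rw [Finset.sum_range_succ, Finset.sum_eq_zero, zero_add] at h5
  · rw [Nat.choose_self, Nat.sub_self, iteratedDeriv_zero, hG0, Nat.cast_one, one_mul,
      mul_one] at h5
    exact h5
  · intro i hi
    have := Finset.mem_range.mp hi
    rw [h1 (l - i) (by omega) (by omega), mul_zero]

/-- Along the points `1 + u w^j` the function `F_{l+1}` is invariant under `u ↦ w u`, so the factor
`F_{l+1}^{k-l}` of the power of `∂_1 F_{l+1} = f' F_{l+1}` does not contribute to the `l`-th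
derivative. -/
theorem generalMoment_eq_productMoment {f : ℂ → ℂ} (hf : AnalyticAt ℂ f 1)
    {F : ∀ k : ℕ, (Fin k → ℂ) → ℂ} (hF1 : ∀ k : ℕ, 1 ≤ k → F k 1 = 1)
    (hF : ∀ k : ℕ, 1 ≤ k →
      ∀ᶠ u in 𝓝 (1 : Fin k → ℂ), F k u = Complex.exp (∑ i : Fin k, f (u i))) (k : ℕ) :
    generalMoment F k = productMoment f k := by
  rw [generalMoment, productMoment]
  refine Finset.sum_congr rfl fun l _ => ?_
  congr 1
  set w := rootW (l + 1) with hw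
  have hprim : IsPrimitiveRoot w (l + 1) := Complex.isPrimitiveRoot_exp (l + 1) (by omega)
  set v : ℂ → Fin (l + 1) → ℂ := fun u j => 1 + u * w ^ (j : ℕ) with hv
  set E : ℂ → ℂ := fun u => Complex.exp (∑ j, f (v u j)) with hE
  have hvc : Tendsto v (𝓝 0) (𝓝 1) := by
    have h1 : Continuous v := by fun_prop
    have h2 : v 0 = 1 := by ext j; simp [hv]
    rw [← h2]; exact h1.tendsto 0
  have hfv : ∀ j, AnalyticAt ℂ (fun u => f (v u j)) 0 := fun j =>
    AnalyticAt.fun_comp (f := fun u : ℂ => v u j) (by simpa [hv] using hf)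
      (by simp only [hv]; fun_prop)
  have hEa : AnalyticAt ℂ E 0 := (Finset.analyticAt_fun_sum _ fun j _ => hfv j).cexp
  have hE0 : E 0 = 1 := by
    have h1 := (hF (l + 1) (by omega)).self_of_nhds
    rw [hF1 (l + 1) (by omega)] at h1
    rw [h1]; simp [hE, hv]
  -- Multiplication of `u` by `w` permutes the points `1 + u w^j` cyclically.
  have hEinv : ∀ u, E (w * u) = E u := by
    intro u
    simp only [hE, hv]
    congr 1
    rw [Fin.sum_univ_eq_sum_range (fun j => f (1 + w * u * w ^ j)) (l + 1),
      Fin.sum_univ_eq_sum_range (fun j => f (1 + u * w ^ j)) (l + 1), Finset.sum_range_succ,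
      Finset.sum_range_succ']
    have h1 : ∀ j, w * u * w ^ j = u * w ^ (j + 1) := fun j => by ring
    simp only [h1, hprim.pow_eq_one, pow_zero]
  have hpart : ∀ᶠ u in 𝓝 (0 : ℂ), partialFirst (F (l + 1)) (v u) = deriv f (1 + u) * E u := by
    have hfe : ∀ᶠ y in 𝓝 (1 : Fin (l + 1) → ℂ), AnalyticAt ℂ f (y 0) :=
      ((continuous_apply 0).tendsto (1 : Fin (l + 1) → ℂ)).eventually hf.eventually_analyticAt
    filter_upwards [hvc.eventually (eventually_eventually_nhds.mpr (hF (l + 1) (by omega))),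
      hvc.eventually hfe] with u hu hfu
    have h0 : v u 0 = 1 + u := by simp [hv]
    have h1 : Tendsto (fun t : ℂ => Function.update (v u) 0 t) (𝓝 (v u 0)) (𝓝 (v u)) := by
      have h2 : Continuous fun t : ℂ => Function.update (v u) 0 t := by fun_prop
      have h3 := h2.tendsto (v u 0)
      rwa [Function.update_eq_self] at h3
    have h2 : (fun t : ℂ => F (l + 1) (Function.update (v u) 0 t)) =ᶠ[𝓝 (v u 0)]
        fun t => Complex.exp (f t + ∑ j : Fin l, f (v u j.succ)) := by
      filter_upwards [h1.eventually hu] with t ht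
      rw [ht, Fin.sum_univ_succ]
      simp
    rw [partialFirst, h2.deriv_eq]
    have h3 := ((hfu.differentiableAt.hasDerivAt).add_const
      (∑ j : Fin l, f (v u j.succ))).cexp
    rw [h3.deriv, ← Fin.sum_univ_succ (fun j => f (v u j)), h0, mul_comm]
  have h1 : (fun u : ℂ => (1 + u) ^ k * partialFirst (F (l + 1)) (v u) ^ (k - l)) =ᶠ[𝓝 0]
      fun u => ((1 + u) ^ k * deriv f (1 + u) ^ (k - l)) * E u ^ (k - l) := by
    filter_upwards [hpart] with u hu
    rw [hu, mul_pow, mul_assoc]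
  rw [h1.iteratedDeriv_eq l]
  refine iteratedDeriv_mul_of_rotation_invariant hprim ?_ (hEa.fun_pow _) (by simp [hE0])
    fun u => by rw [hEinv]
  have h2 : AnalyticAt ℂ (fun u => deriv f (1 + u)) 0 :=
    AnalyticAt.fun_comp (f := fun u : ℂ => 1 + u) (by rw [add_zero]; exact hf.deriv) (by fun_prop)
  exact AnalyticAt.fun_mul (by fun_prop) (h2.fun_pow _)

/-! ### The law of large numbers -/

theorem LogDerivTendsto.exists_measure {ρ : ∀ N : ℕ, PMF (Signature N)} {f : ℂ → ℂ}
    (hf : AnalyticAt ℂ f 1) (hS : ∀ N : ℕ, 1 ≤ N → HasSchurGF (ρ N))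
    (h : LogDerivTendsto ρ (taylorSeries (deriv f))) :
    ∃ μ : Measure ℝ, IsProbabilityMeasure μ ∧ ConvergesInMoments ρ μ ∧
      ∀ k : ℕ, ((∫ x, x ^ k ∂μ : ℝ) : ℂ) = productMoment f k := by
  obtain ⟨μ, hμ, hconv, hmom⟩ := exists_convergesInMoments (meanSquareTendsto_moment hS h)
  refine ⟨μ, hμ, hconv, fun k => ?_⟩
  rw [hmom, ← limitMoment_taylorSeries hf]
  exact Complex.ext (by simp) (by simp [(meanSquareTendsto_factorialMoment hS h k).1])

/-- The normalisation of the branches of the root determines the value of the limit at `1^k`. -/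
theorem RootTendsto.apply_one {ρ : ∀ N : ℕ, PMF (Signature N)} {k : ℕ} {F : (Fin k → ℂ) → ℂ}
    (h : RootTendsto ρ k F) : F 1 = 1 := by
  obtain ⟨r, hr, g, hg, hlim⟩ := h
  refine tendsto_nhds_unique (hlim.tendsto_at (Metric.mem_ball_self hr)) ?_
  exact tendsto_const_nhds.congr' (hg.mono fun N hN => hN.2.1.symm)

end

theorem mainTheorem10 (ρ : ∀ N : ℕ, PMF (Signature N)) (f : ℂ → ℂ) (hf : AnalyticAt ℂ f 1) :
    -- the law of large numbers for limits of exponential product form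
    (∀ F : (∀ k : ℕ, (Fin k → ℂ) → ℂ), LLNAssumption ρ F →
      (∀ k : ℕ, 1 ≤ k →
        ∀ᶠ u in 𝓝 (1 : Fin k → ℂ), F k u = Complex.exp (∑ i : Fin k, f (u i))) →
      ∃ μ : Measure ℝ, IsProbabilityMeasure μ ∧ ConvergesInMoments ρ μ ∧
        ∀ k : ℕ, ((∫ x, x ^ k ∂μ : ℝ) : ℂ) = generalMoment F k ∧
          generalMoment F k = productMoment f k) ∧
    -- the law of large numbers in terms of logarithms which is recovered
    ((∀ N : ℕ, 1 ≤ N → HasSchurGF (ρ N)) →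
      (∀ k : ℕ, 1 ≤ k → LogTendsto ρ k (fun u => ∑ i : Fin k, f (u i))) →
      ∃ μ : Measure ℝ, IsProbabilityMeasure μ ∧ ConvergesInMoments ρ μ ∧
        ∀ k : ℕ, ((∫ x, x ^ k ∂μ : ℝ) : ℂ) = productMoment f k ∧
          ∀ᶠ ε in 𝓝[>] (0 : ℝ), ((∫ x, x ^ k ∂μ : ℝ) : ℂ) = contourMoment f k ε) := by
  constructor
  · intro F hF hexp
    obtain ⟨μ, hμ, hconv, hmom⟩ := (logDerivTendsto_of_root hf hF.tendsto hexp).exists_measure hf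
      hF.hasSchurGF
    have h1 := generalMoment_eq_productMoment hf (fun k hk => (hF.tendsto k hk).apply_one) hexp
    exact ⟨μ, hμ, hconv, fun k => ⟨(hmom k).trans (h1 k).symm, h1 k⟩⟩
  · intro hS hlog
    obtain ⟨μ, hμ, hconv, hmom⟩ := (logDerivTendsto_of_log hf hlog).exists_measure hf hS
    refine ⟨μ, hμ, hconv, fun k => ⟨hmom k, ?_⟩⟩
    filter_upwards [eventually_contourMoment_eq hf k] with ε hε
    rw [hmom, hε]
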